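/- Let $n\ge 1$. Consider the Gaussian channel $Y=X+Z$ in $\mathbb{R}^n$, where $Z\sim\mathcal N(0,I_n)$ is independent of the input $X$, and, for $R\ge 0$, the capacity problem $$\max_{\|X\|\le R} I(X;Y),\qquad(1)$$ where the maximum is over all distributions of $X$ supported in the closed Euclidean ball of radius $R$ centered at $0$, and $I(X;Y)$ is the mutual information. Let $X_R$ be uniformly distributed on the sphere $\{x\in\mathbb{R}^n:\|x\|=R\}$, and let $\bar R_n$ be the largest $R\ge0$ for which $X_R$ attains the maximum in (1). Let $h_v(x)=I_v(x)/I_{v-1}(x)$ for $x>0$, where $I_v$ is the modified Bessel function of the first kind of order $v$, with $h_v(0)=0$ (the limit at $0$ for $v\ge\frac12$). Theorem (Characterization of the Small Amplitude Regime). For every $n\ge1$ the number $\bar R_n$ exists (the maximum is attained and finite) and is positive, and for every $R\ge 0$ the input $X_R$ attains the maximum in (1) if and only if $R\le\bar R_n$. Moreover, $\bar R_n$ is the unique solution $R>0$ of the equation $$\int_0^1 \mathbb{E}\left[h_{n/2}^2\left(\sqrt\gamma\,R\,\|Z\|\right)\right]+\mathbb{E}\left[h_{n/2}^2\left(\sqrt\gamma\,R\,\|\sqrt\gamma\,x+Z\|\right)\right]d\gamma=1,$$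 where $x\in\mathbb{R}^n$ is any vector with $\|x\|=R$ (the choice of $x$ does not matter). In addition, $R\le\sqrt n$ is sufficient for the optimality of $X_R$, that is, $\sqrt n\le\bar R_n$, and $$\lim_{n\to\infty}\frac{\bar R_n}{\sqrt n}=c\approx 1.860935682,$$ where the numerical value is correct to all the digits shown, that is, $|c-1.860935682|\le 5\cdot 10^{-10}$, and $c$ is the unique positive solution of the equation $$\int_0^1\frac{\gamma c^2}{\left(\frac12+\sqrt{\frac14+\gamma c^2}\right)^2}+\frac{\gamma c^2(1+\gamma c^2)}{\left(\frac12+\sqrt{\frac14+\gamma c^2(1+\gamma c^2)}\right)^2}\,d\gamma=1.$$ -/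

import Mathlib

open MeasureTheory ProbabilityTheory

/-- The space `ℝⁿ` with the Euclidean norm. -/
abbrev Rn (n : ℕ) : Type := EuclideanSpace ℝ (Fin n)

noncomputable section

/-- The modified Bessel function of the first kind of real order `v`, for an argument `x > 0`,
`I_v(x) = ∑ₖ (x/2)^(2k+v) / (k! Γ(k+v+1))`. -/
def besselI (v x : ℝ) : ℝ :=
  ∑' k : ℕ, (x / 2) ^ (2 * (k : ℝ) + v) / ((k.factorial : ℝ) * Real.Gamma ((k : ℝ) + v + 1))

/-- The ratio `h_v(x) = I_v(x) / I_{v-1}(x)`. For `v ≥ 1/2` its value at `x = 0` is the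
limit `0`. -/
def besselRatio (v x : ℝ) : ℝ := besselI v x / besselI (v - 1) x

/-- The mutual information of a pair of random variables with joint law `ρ`: the relative entropy
of the joint law with respect to the product of the marginals (in nats). -/
def mutualInfo {α β : Type*} [MeasurableSpace α] [MeasurableSpace β] (ρ : Measure (α × β)) :
    ENNReal :=
  InformationTheory.klDiv ρ (ρ.fst.prod ρ.snd)

/-- The joint law of `(X, Y)` with `Y = X + Z`, where `X ∼ P` and `Z ∼ N(0, Iₙ)` are
independent. -/
def channelLaw (n : ℕ) (P : Measure (Rn n)) : Measure (Rn n × Rn n) :=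
  (P.prod (stdGaussian (Rn n))).map (fun p => (p.1, p.1 + p.2))

/-- `I(P_X) = I(X; Y)`, the information that the Gaussian channel transmits for the input
law `P`. -/
def inputInfo (n : ℕ) (P : Measure (Rn n)) : ENNReal := mutualInfo (channelLaw n P)

/-- The laws of the random vectors `X` with `‖X‖ ≤ R`. -/
def ballInputs (n : ℕ) (R : ℝ) : Set (Measure (Rn n)) :=
  {P | IsProbabilityMeasure P ∧ ∀ᵐ x ∂P, x ∈ Metric.closedBall (0 : Rn n) R}

/-- `P` attains the maximum of `I(X; Y)` over all inputs `X` with `‖X‖ ≤ R`. -/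
def IsCapacityAchieving (n : ℕ) (R : ℝ) (P : Measure (Rn n)) : Prop :=
  P ∈ ballInputs n R ∧ ∀ Q ∈ ballInputs n R, inputInfo n Q ≤ inputInfo n P

/-- The uniform distribution on the unit sphere of `ℝⁿ`: the normalized surface measure. -/
def uniformUnitSphere (n : ℕ) : Measure (Metric.sphere (0 : Rn n) 1) :=
  ((volume : Measure (Rn n)).toSphere Set.univ)⁻¹ • (volume : Measure (Rn n)).toSphere

/-- The uniform distribution on the sphere of radius `R` centered at the origin. -/
def uniformSphere (n : ℕ) (R : ℝ) : Measure (Rn n) :=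
  (uniformUnitSphere n).map (fun u : Metric.sphere (0 : Rn n) 1 => R • (u : Rn n))

/-- The radii `R ≥ 0` for which the uniform distribution on the sphere of radius `R` is
capacity-achieving under the constraint `‖X‖ ≤ R`. -/
def smallAmplitudeRadii (n : ℕ) : Set ℝ :=
  {R | 0 ≤ R ∧ IsCapacityAchieving n R (uniformSphere n R)}

/-- `R̄ₙ`, the largest radius for which the uniform distribution on the sphere is
capacity-achieving. -/
def Rbar (n : ℕ) : ℝ := sSup (smallAmplitudeRadii n)

/-- `∫₀¹ E[h²_{n/2}(√γ R ‖Z‖)] + E[h²_{n/2}(√γ R ‖√γ x + Z‖)] dγ` with `Z ∼ N(0, Iₙ)`. -/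
def radiusIntegral (n : ℕ) (R : ℝ) (x : Rn n) : ℝ :=
  ∫ γ in (0 : ℝ)..1,
    ((∫ z, besselRatio ((n : ℝ) / 2) (√γ * R * ‖z‖) ^ 2 ∂(stdGaussian (Rn n)))
      + ∫ z, besselRatio ((n : ℝ) / 2) (√γ * R * ‖√γ • x + z‖) ^ 2 ∂(stdGaussian (Rn n)))

/-- The left-hand side of the limiting integral equation. -/
def limitIntegral (c : ℝ) : ℝ :=
  ∫ γ in (0 : ℝ)..1,
    (γ * c ^ 2 / (1 / 2 + √(1 / 4 + γ * c ^ 2)) ^ 2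
      + γ * c ^ 2 * (1 + γ * c ^ 2)
        / (1 / 2 + √(1 / 4 + γ * c ^ 2 * (1 + γ * c ^ 2))) ^ 2)

end

/-!
Write `Q` for the uniform distribution on the sphere of radius `R`, `Φ(‖y‖) = ∫ exp ⟨y, θ⟩ dθ` for
the moment generating function of the unit sphere, and `h = Φ'/Φ`, which is `h_{n/2}` because `Φ`
is, up to constants, `x^(1-n/2) I_{n/2-1}(x)` (`besselRatio_half`).

*Optimality of `Q`.* With respect to the law of the noise, the output law of an input `P` has the
density `m_P(y) = ∫ exp (⟨x, y⟩ - ‖x‖²/2) dP(x)`, so that `m_Q(y) = exp (-R²/2) Φ(R ‖y‖)`. Put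
`j(x) = ‖x‖²/2 - 𝔼 log m_Q(x + Z)`, the relative entropy of the output for the input `x` with
respect to the output law of `Q`. The inequality `log t ≥ 1 - 1/t` gives `I(P) ≤ ∫ j dP` for every
`P`, with equality at `Q`; and `j` depends only on `r = ‖x‖`. Differentiation under the integral and
Stein's identity for `‖Z‖` write `j'(r) / r` as one minus a mean of a decreasing function, under a
law that increases stochastically with `r` (monotone likelihood ratio). Hence `j'(r) / r` is
nondecreasing, `j` is a convex function of `r²`, and on `[0, R]` it is at most
`max (j 0) (j R)`. So `j(0) ≤ j(R)` implies that `Q` is optimal, and if `j(R) < j(0)`, moving a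
little mass of `Q` to the origin increases the information. This is
`isCapacityAchieving_uniformSphere_iff`.

*The integral equation.* Stein's identity once more, with the Riccati equation
`h' + h² + (n-1) h / x = 1`, gives the derivatives in `r` of `𝔼 log Φ(r ‖Z‖)` and of its
analogue for `‖x + Z‖` with `‖x‖ = r`: up to the factor `r`, they are `1 - a(r)` and `1 + b(r)`,
where `a` and `b` are the two expectations in the integral equation. Integrating along
`r = √γ R` shows that `j(R) - j(0)` is `R²/2` times one minus the integral of the equation,
whence the criterion: `Q` is optimal if and only if that integral is at most `1`
(`exists_radiusMean_eq_one`). The integral increases strictly with `R`, as `h` does, and exceeds `1`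
for large `R`, so the equation has exactly one root. If `R ≤ √n`, the bound `h(x) ≤ x/n` makes
`j'` nonnegative, so the root is at least `√n`.

*High dimensions.* The Riccati bounds `1 ≤ h² + n h / x` and `h² + (n-1) h / x ≤ 1` place `h²(n s)`
within `2/n` of the function `φ(s²)` (`limitRatioSq`), where `φ(p) = p / (1/2 + √(1/4 + p))²`. Since
`φ` is 1-Lipschitz and `‖x + Z‖²` deviates from `n + ‖x‖²` by a standard deviation of order `√n`,
the integral at radius `c √n` converges to `limitIntegral c` (`tendsto_radiusMean`). Both integrals
being strictly increasing, the roots converge. Finally `limitIntegral` has a closed form, with which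
its value is compared with `1` at the two ends of the interval claimed for the root.
-/

/-! ### The Gaussian measure in polar coordinates -/

/-- The density of `stdGaussian (Rn n)`, as a function of the norm. -/
noncomputable def gaussProfile (n : ℕ) (s : ℝ) : ℝ :=
  (2 * Real.pi) ^ (-(n : ℝ) / 2) * Real.exp (-s ^ 2 / 2)

lemma gaussProfile_pos (n : ℕ) (s : ℝ) : 0 < gaussProfile n s := by
  unfold gaussProfile; positivity

@[fun_prop]
lemma continuous_gaussProfile (n : ℕ) : Continuous (gaussProfile n) := by
  unfold gaussProfile; fun_prop

lemma integral_gaussProfile (n : ℕ) : ∫ y : Rn n, gaussProfile n ‖y‖ = 1 := by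
  have h := GaussianFourier.integral_rexp_neg_mul_sq_norm (V := Rn n) (b := 1 / 2) (by norm_num)
  have e : ∀ y : Rn n, gaussProfile n ‖y‖
      = (2 * Real.pi) ^ (-(n : ℝ) / 2) * Real.exp (-(1 / 2) * ‖y‖ ^ 2) := by
    intro y; unfold gaussProfile; congr 2; ring
  simp only [e]
  rw [integral_const_mul, h, finrank_euclideanSpace_fin,
    show Real.pi / (1 / 2) = 2 * Real.pi by ring, ← Real.rpow_add (by positivity)]
  rw [show -(n : ℝ) / 2 + n / 2 = 0 by ring, Real.rpow_zero]

lemma integrable_gaussProfile (n : ℕ) :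
    Integrable (fun y : Rn n => gaussProfile n ‖y‖) := by
  by_contra h
  have := integral_gaussProfile n
  rw [integral_undef h] at this
  norm_num at this

/-- The standard Gaussian measure is given by its Lebesgue density: both have the same
characteristic function. -/
lemma stdGaussian_eq_withDensity (n : ℕ) :
    stdGaussian (Rn n)
      = (volume : Measure (Rn n)).withDensity (fun y => ENNReal.ofReal (gaussProfile n ‖y‖)) := by
  have hint := integrable_gaussProfile n
  have : IsFiniteMeasure
      ((volume : Measure (Rn n)).withDensity (fun y => ENNReal.ofReal (gaussProfile n ‖y‖))) :=
    isFiniteMeasure_withDensity_ofReal hint.2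
  apply Measure.ext_of_charFun
  ext t
  rw [charFun_stdGaussian, charFun_apply]
  rw [integral_withDensity_eq_integral_toReal_smul (by fun_prop) (by simp)]
  have h := GaussianFourier.integral_cexp_neg_mul_sq_norm_add (V := Rn n) (b := 1 / 2)
    (by norm_num) Complex.I t
  have e : ∀ y : Rn n, (ENNReal.ofReal (gaussProfile n ‖y‖)).toReal
      • Complex.exp (inner ℝ y t * Complex.I)
      = ((2 * Real.pi) ^ (-(n : ℝ) / 2) : ℝ)
        * Complex.exp (-(1 / 2) * ‖y‖ ^ 2 + Complex.I * (inner ℝ t y : ℝ)) := by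
    intro y
    rw [ENNReal.toReal_ofReal (gaussProfile_pos n _).le, gaussProfile, Complex.real_smul,
      Complex.exp_add, real_inner_comm]
    push_cast
    ring_nf
  simp only [e]
  rw [integral_const_mul, h, finrank_euclideanSpace_fin, ← mul_assoc]
  have e2 : (((2 * Real.pi) ^ (-(n : ℝ) / 2) : ℝ) : ℂ) * (Real.pi / (1 / 2)) ^ ((n : ℂ) / 2) = 1 := by
    rw [show (Real.pi : ℂ) / (1 / 2) = ((2 * Real.pi : ℝ) : ℂ) by push_cast; ring,
      show (n : ℂ) / 2 = ((n / 2 : ℝ) : ℂ) by push_cast; ring,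
      ← Complex.ofReal_cpow (by positivity), ← Complex.ofReal_mul, ← Real.rpow_add (by positivity)]
    rw [show -(n : ℝ) / 2 + n / 2 = 0 by ring, Real.rpow_zero, Complex.ofReal_one]
  rw [e2, one_mul]
  congr 1
  rw [Complex.I_sq]
  ring

/-- The total surface area of the unit sphere of `ℝⁿ`. -/
noncomputable def sphereArea (n : ℕ) : ℝ :=
  ((volume : Measure (Rn n)).toSphere Set.univ).toReal

lemma toSphere_univ_ne_zero (n : ℕ) [NeZero n] :
    (volume : Measure (Rn n)).toSphere Set.univ ≠ 0 := by
  rw [Measure.measure_univ_ne_zero]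
  exact Measure.toSphere_ne_zero _

lemma sphereArea_pos (n : ℕ) [NeZero n] : 0 < sphereArea n :=
  ENNReal.toReal_pos (toSphere_univ_ne_zero n) (measure_ne_top _ _)

instance isProbabilityMeasure_uniformUnitSphere (n : ℕ) [NeZero n] :
    IsProbabilityMeasure (uniformUnitSphere n) := by
  constructor
  rw [uniformUnitSphere, Measure.smul_apply, smul_eq_mul]
  exact ENNReal.inv_mul_cancel (toSphere_univ_ne_zero n) (measure_ne_top _ _)

/-- The density of the law of the norm of a standard Gaussian vector in `ℝⁿ`. -/
noncomputable def chiDensity (n : ℕ) (s : ℝ) : ℝ :=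
  sphereArea n * (s ^ (n - 1) * gaussProfile n s)

/-- The law of the norm of a standard Gaussian vector in `ℝⁿ`, given by its density on
`(0, ∞)`. -/
noncomputable def chi (n : ℕ) : Measure ℝ :=
  (volume.restrict (Set.Ioi 0)).withDensity (fun s => ENNReal.ofReal (chiDensity n s))

@[fun_prop]
lemma continuous_chiDensity (n : ℕ) : Continuous (chiDensity n) := by
  unfold chiDensity; fun_prop

instance sFinite_chi (n : ℕ) : SFinite (chi n) := by unfold chi; infer_instance

lemma chiDensity_pos {n : ℕ} [NeZero n] {s : ℝ} (hs : 0 < s) : 0 < chiDensity n s := by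
  have := sphereArea_pos n
  have := gaussProfile_pos n s
  unfold chiDensity; positivity

lemma lintegral_stdGaussian_polar (n : ℕ) [NeZero n] (F : Rn n → ENNReal) (hF : Measurable F) :
    ∫⁻ y, F y ∂(stdGaussian (Rn n))
      = ∫⁻ θ, ∫⁻ s, F (s • (θ : Rn n)) ∂(chi n) ∂(uniformUnitSphere n) := by
  have hmp := (volume : Measure (Rn n)).measurePreserving_homeomorphUnitSphereProd
  set G : Rn n → ENNReal := fun y => ENNReal.ofReal (gaussProfile n ‖y‖) * F y with hG
  have hGm : Measurable G := by fun_prop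
  rw [stdGaussian_eq_withDensity, lintegral_withDensity_eq_lintegral_mul _ (by fun_prop) hF]
  change ∫⁻ y, G y = _
  have h1 : ∫⁻ y, G y = ∫⁻ y : ({0}ᶜ : Set (Rn n)), G y ∂((volume : Measure (Rn n)).comap Subtype.val) := by
    rw [lintegral_subtype_comap (measurableSet_singleton _).compl, restrict_compl_singleton]
  have h2 : ∫⁻ y : ({0}ᶜ : Set (Rn n)), G y ∂((volume : Measure (Rn n)).comap Subtype.val)
      = ∫⁻ p, G (p.2.1 • (p.1 : Rn n))
        ∂((volume : Measure (Rn n)).toSphere.prod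
          (Measure.volumeIoiPow (Module.finrank ℝ (Rn n) - 1))) := by
    rw [← hmp.lintegral_comp (by fun_prop)]
    apply lintegral_congr
    intro y
    congr 1
    have : (y : Rn n) ≠ 0 := y.2
    simp [homeomorphUnitSphereProd, smul_smul, this]
  rw [h1, h2, lintegral_prod _ (by fun_prop), uniformUnitSphere, lintegral_smul_measure,
    smul_eq_mul, ← lintegral_const_mul _ ?_]
  swap
  · apply Measurable.lintegral_prod_right' (f := fun p : Metric.sphere (0 : Rn n) 1 × ℝ => F (p.2 • (p.1 : Rn n)))
    fun_prop
  apply lintegral_congr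
  intro θ
  have hθ : ‖(θ : Rn n)‖ = 1 := by simp
  rw [Measure.volumeIoiPow, lintegral_withDensity_eq_lintegral_mul _ (by fun_prop) (by fun_prop)]
  simp only [Pi.mul_apply]
  rw [lintegral_subtype_comap measurableSet_Ioi
      (f := fun r : ℝ => ENNReal.ofReal (r ^ (Module.finrank ℝ (Rn n) - 1)) * G (r • (θ : Rn n))),
    chi, lintegral_withDensity_eq_lintegral_mul _ (by fun_prop) (by fun_prop),
    ← lintegral_const_mul _ (by fun_prop)]
  apply setLIntegral_congr_fun measurableSet_Ioi
  intro s hs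
  have hs : 0 < s := hs
  simp only [hG, Pi.mul_apply, norm_smul, hθ, mul_one, finrank_euclideanSpace_fin,
    Real.norm_eq_abs, abs_of_pos hs, chiDensity]
  rw [ENNReal.ofReal_mul (sphereArea_pos n).le, ENNReal.ofReal_mul (by positivity), sphereArea,
    ENNReal.ofReal_toReal (measure_ne_top _ _)]
  simp only [← mul_assoc]
  rw [ENNReal.inv_mul_cancel (toSphere_univ_ne_zero n) (measure_ne_top _ _), one_mul]

instance isProbabilityMeasure_chi (n : ℕ) [NeZero n] : IsProbabilityMeasure (chi n) := by
  constructor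
  have := lintegral_stdGaussian_polar n (fun _ => 1) measurable_const
  simpa using this.symm

/-- A standard Gaussian vector is the product of its norm and of an independent uniform point of
the unit sphere. -/
lemma measurePreserving_polar (n : ℕ) [NeZero n] :
    MeasurePreserving (fun p : Metric.sphere (0 : Rn n) 1 × ℝ => p.2 • (p.1 : Rn n))
      ((uniformUnitSphere n).prod (chi n)) (stdGaussian (Rn n)) := by
  refine ⟨by fun_prop, ?_⟩
  refine Measure.ext_of_lintegral _ fun F hF => ?_
  rw [lintegral_map hF (by fun_prop), lintegral_prod _ (by fun_prop),
    lintegral_stdGaussian_polar n F hF]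

lemma ae_chi_pos (n : ℕ) : ∀ᵐ s ∂(chi n), 0 < s := by
  unfold chi
  apply (withDensity_absolutelyContinuous _ _).ae_le
  exact ae_restrict_mem measurableSet_Ioi

/-- `chi n` is the law of the norm. -/
lemma measurePreserving_norm (n : ℕ) [NeZero n] :
    MeasurePreserving (fun z : Rn n => ‖z‖) (stdGaussian (Rn n)) (chi n) := by
  refine ⟨by fun_prop, ?_⟩
  refine Measure.ext_of_lintegral _ fun F hF => ?_
  rw [lintegral_map hF (by fun_prop), lintegral_stdGaussian_polar n _ (by fun_prop)]
  have : ∀ θ : Metric.sphere (0 : Rn n) 1, ∫⁻ s, F ‖s • (θ : Rn n)‖ ∂(chi n) = ∫⁻ s, F s ∂(chi n) := by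
    intro θ
    apply lintegral_congr_ae
    filter_upwards [ae_chi_pos n] with s hs
    have hθ : ‖(θ : Rn n)‖ = 1 := by simp
    simp [norm_smul, hθ, abs_of_pos hs]
  simp [this]

lemma integral_chi (n : ℕ) [NeZero n] (f : ℝ → ℝ) :
    ∫ s, f s ∂(chi n) = ∫ s in Set.Ioi 0, chiDensity n s * f s := by
  unfold chi
  rw [integral_withDensity_eq_integral_toReal_smul (by fun_prop) (by simp)]
  apply setIntegral_congr_fun measurableSet_Ioi
  intro s hs
  simp only [smul_eq_mul]
  rw [ENNReal.toReal_ofReal (chiDensity_pos hs).le]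

lemma integrable_chi_iff (n : ℕ) [NeZero n] (f : ℝ → ℝ) :
    Integrable f (chi n) ↔ IntegrableOn (fun s => chiDensity n s * f s) (Set.Ioi 0) := by
  unfold chi
  rw [integrable_withDensity_iff_integrable_smul' (by fun_prop) (by simp), IntegrableOn]
  apply integrable_congr
  filter_upwards [ae_restrict_mem measurableSet_Ioi] with s hs
  rw [ENNReal.toReal_ofReal (chiDensity_pos hs).le, smul_eq_mul]

/-- The law of a translate of a standard Gaussian vector has density
`y ↦ exp (⟪x, y⟫ - ‖x‖² / 2)` with respect to the untranslated law. -/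
lemma lintegral_stdGaussian_add (n : ℕ) (x : Rn n) (F : Rn n → ENNReal) (hF : Measurable F) :
    ∫⁻ z, F (x + z) ∂(stdGaussian (Rn n))
      = ∫⁻ z, ENNReal.ofReal (Real.exp (inner ℝ x z - ‖x‖ ^ 2 / 2)) * F z
          ∂(stdGaussian (Rn n)) := by
  rw [stdGaussian_eq_withDensity, lintegral_withDensity_eq_lintegral_mul _ (by fun_prop) (by fun_prop),
    lintegral_withDensity_eq_lintegral_mul _ (by fun_prop) (by fun_prop)]
  rw [← lintegral_add_left_eq_self (μ := (volume : Measure (Rn n)))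
    ((fun y => ENNReal.ofReal (gaussProfile n ‖y‖))
      * fun z => ENNReal.ofReal (Real.exp (inner ℝ x z - ‖x‖ ^ 2 / 2)) * F z) x]
  apply lintegral_congr
  intro y
  simp only [Pi.mul_apply]
  rw [← mul_assoc, ← ENNReal.ofReal_mul (gaussProfile_pos n _).le]
  congr 2
  simp only [gaussProfile, mul_assoc, ← Real.exp_add]
  rw [norm_add_sq_real, inner_add_right, real_inner_self_eq_norm_sq]
  ring_nf

/-- The law of a translate of a standard Gaussian vector. -/
lemma map_add_stdGaussian (n : ℕ) (x : Rn n) :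
    (stdGaussian (Rn n)).map (fun z => x + z)
      = (stdGaussian (Rn n)).withDensity
          (fun z => ENNReal.ofReal (Real.exp (inner ℝ x z - ‖x‖ ^ 2 / 2))) := by
  refine Measure.ext_of_lintegral _ fun F hF => ?_
  rw [lintegral_map hF (by fun_prop), lintegral_stdGaussian_add n x F hF,
    lintegral_withDensity_eq_lintegral_mul _ (by fun_prop) hF]
  rfl

lemma integral_stdGaussian_add (n : ℕ) (x : Rn n) (f : Rn n → ℝ) (hf : Measurable f) :
    ∫ z, f (x + z) ∂(stdGaussian (Rn n))
      = ∫ z, Real.exp (inner ℝ x z - ‖x‖ ^ 2 / 2) * f z ∂(stdGaussian (Rn n)) := by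
  rw [← integral_map (φ := fun z => x + z) (by fun_prop) (by fun_prop), map_add_stdGaussian,
    integral_withDensity_eq_integral_toReal_smul (by fun_prop) (by simp)]
  simp only [ENNReal.toReal_ofReal (Real.exp_pos _).le, smul_eq_mul]

/-! ### Exponential moments and Stein's identity for the norm -/

lemma exists_chiDensity_mul_exp_le (n : ℕ) (C : ℝ) :
    ∃ K : ℝ, ∀ s, 0 < s → chiDensity n s * Real.exp (C * s) ≤ K * Real.exp (-s) := by
  refine ⟨sphereArea n * (2 * Real.pi) ^ (-(n : ℝ) / 2) * (n - 1).factorial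
    * Real.exp ((C + 2) ^ 2 / 2), fun s hs => ?_⟩
  have h1 : s ^ (n - 1) ≤ (n - 1).factorial * Real.exp s := by
    have := Real.pow_div_factorial_le_exp s hs.le (n - 1)
    rwa [div_le_iff₀' (by positivity)] at this
  have h2 : Real.exp s * (Real.exp (-s ^ 2 / 2) * Real.exp (C * s))
      ≤ Real.exp ((C + 2) ^ 2 / 2) * Real.exp (-s) := by
    rw [← Real.exp_add, ← Real.exp_add, ← Real.exp_add]
    apply Real.exp_le_exp.2
    nlinarith [sq_nonneg (C + 2 - s)]
  have hA : 0 ≤ sphereArea n := ENNReal.toReal_nonneg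
  have hp : 0 < (2 * Real.pi) ^ (-(n : ℝ) / 2) := by positivity
  unfold chiDensity gaussProfile
  calc _ = sphereArea n * (2 * Real.pi) ^ (-(n : ℝ) / 2)
        * (s ^ (n - 1) * (Real.exp (-s ^ 2 / 2) * Real.exp (C * s))) := by ring
    _ ≤ sphereArea n * (2 * Real.pi) ^ (-(n : ℝ) / 2)
        * ((n - 1).factorial * Real.exp s * (Real.exp (-s ^ 2 / 2) * Real.exp (C * s))) := by
        gcongr
    _ = sphereArea n * (2 * Real.pi) ^ (-(n : ℝ) / 2) * (n - 1).factorial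
        * (Real.exp s * (Real.exp (-s ^ 2 / 2) * Real.exp (C * s))) := by ring
    _ ≤ sphereArea n * (2 * Real.pi) ^ (-(n : ℝ) / 2) * (n - 1).factorial
        * (Real.exp ((C + 2) ^ 2 / 2) * Real.exp (-s)) := by gcongr
    _ = _ := by ring

lemma integrable_exp_mul_chi (n : ℕ) [NeZero n] (C : ℝ) :
    Integrable (fun s => Real.exp (C * s)) (chi n) := by
  rw [integrable_chi_iff]
  obtain ⟨K, hK⟩ := exists_chiDensity_mul_exp_le n C
  refine ((integrableOn_exp_neg_Ioi 0).const_mul K).mono' (by fun_prop) ?_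
  filter_upwards [ae_restrict_mem measurableSet_Ioi] with s hs
  have hs : 0 < s := hs
  have := chiDensity_pos (n := n) hs
  rw [Real.norm_of_nonneg (by positivity)]
  exact hK s hs

/-- Functions on `[0, ∞)` of at most exponential growth. -/
def ExpGrowth (f : ℝ → ℝ) : Prop := ∃ C : ℝ, ∀ s, 0 < s → |f s| ≤ Real.exp (C * (1 + s))

namespace ExpGrowth

variable {f g : ℝ → ℝ}

lemma exists_nonneg (hf : ExpGrowth f) :
    ∃ C : ℝ, 0 ≤ C ∧ ∀ s, 0 < s → |f s| ≤ Real.exp (C * (1 + s)) := by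
  obtain ⟨C, hC⟩ := hf
  refine ⟨max C 0, le_max_right _ _, fun s hs => (hC s hs).trans ?_⟩
  gcongr
  exact le_max_left _ _

lemma mul (hf : ExpGrowth f) (hg : ExpGrowth g) : ExpGrowth (fun s => f s * g s) := by
  obtain ⟨A, hA⟩ := hf
  obtain ⟨B, hB⟩ := hg
  refine ⟨A + B, fun s hs => ?_⟩
  rw [abs_mul, add_mul, Real.exp_add]
  exact mul_le_mul (hA s hs) (hB s hs) (abs_nonneg _) (Real.exp_pos _).le

lemma add (hf : ExpGrowth f) (hg : ExpGrowth g) : ExpGrowth (fun s => f s + g s) := by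
  obtain ⟨A, hA0, hA⟩ := hf.exists_nonneg
  obtain ⟨B, hB0, hB⟩ := hg.exists_nonneg
  refine ⟨A + B + 1, fun s hs => (abs_add_le _ _).trans ?_⟩
  have h1 : Real.exp (A * (1 + s)) ≤ Real.exp ((A + B) * (1 + s)) := by gcongr; linarith
  have h2 : Real.exp (B * (1 + s)) ≤ Real.exp ((A + B) * (1 + s)) := by gcongr; linarith
  have h3 : 2 ≤ Real.exp (1 + s) := by linarith [Real.add_one_le_exp (1 + s)]
  rw [show (A + B + 1) * (1 + s) = (1 + s) + (A + B) * (1 + s) by ring, Real.exp_add]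
  nlinarith [hA s hs, hB s hs, Real.exp_pos ((A + B) * (1 + s))]

lemma of_abs_le (hg : ExpGrowth g) (h : ∀ s, 0 < s → |f s| ≤ |g s|) : ExpGrowth f := by
  obtain ⟨C, hC⟩ := hg
  exact ⟨C, fun s hs => (h s hs).trans (hC s hs)⟩

lemma const (c : ℝ) : ExpGrowth (fun _ => c) := by
  refine ⟨|c|, fun s hs => ?_⟩
  have := Real.add_one_le_exp (|c| * (1 + s))
  nlinarith [abs_nonneg c]

lemma neg (hf : ExpGrowth f) : ExpGrowth (fun s => -f s) :=
  hf.of_abs_le fun s _ => by rw [abs_neg]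

lemma sub (hf : ExpGrowth f) (hg : ExpGrowth g) : ExpGrowth (fun s => f s - g s) := by
  simpa [sub_eq_add_neg] using hf.add hg.neg

lemma id : ExpGrowth (fun s => s) := by
  refine ⟨1, fun s hs => ?_⟩
  rw [abs_of_pos hs]
  linarith [Real.add_one_le_exp (1 * (1 + s))]

lemma exp (C : ℝ) : ExpGrowth (fun s => Real.exp (C * s)) := by
  refine ⟨|C|, fun s hs => ?_⟩
  rw [abs_of_pos (Real.exp_pos _)]
  apply Real.exp_le_exp.2
  nlinarith [le_abs_self C, abs_nonneg C]

lemma pow (hf : ExpGrowth f) (k : ℕ) : ExpGrowth (fun s => f s ^ k) := by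
  induction k with
  | zero => simpa using ExpGrowth.const 1
  | succ k ih => simpa [pow_succ] using ih.mul hf

lemma integrable_chi (hf : ExpGrowth f) (n : ℕ) [NeZero n]
    (hm : AEStronglyMeasurable f (chi n)) : Integrable f (chi n) := by
  obtain ⟨C, hC⟩ := hf
  refine ((integrable_exp_mul_chi n C).const_mul (Real.exp C)).mono' hm ?_
  filter_upwards [ae_chi_pos n] with s hs
  rw [← Real.exp_add]
  exact (hC s hs).trans_eq (by ring_nf)

end ExpGrowth

lemma tendsto_chiDensity_mul {f : ℝ → ℝ} (hf : ExpGrowth f) (n : ℕ) [NeZero n] :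
    Filter.Tendsto (fun s => chiDensity n s * f s) Filter.atTop (nhds 0) := by
  obtain ⟨C, hC⟩ := hf
  obtain ⟨K, hK⟩ := exists_chiDensity_mul_exp_le n C
  have h : Filter.Tendsto (fun s : ℝ => Real.exp C * (K * Real.exp (-s))) Filter.atTop (nhds 0) := by
    simpa using (Real.tendsto_exp_neg_atTop_nhds_zero.const_mul K).const_mul (Real.exp C)
  refine squeeze_zero_norm' ?_ h
  filter_upwards [Filter.eventually_gt_atTop 0] with s hs
  rw [norm_mul, Real.norm_of_nonneg (chiDensity_pos hs).le, Real.norm_eq_abs]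
  calc chiDensity n s * |f s| ≤ chiDensity n s * Real.exp (C * (1 + s)) := by
        have := (chiDensity_pos (n := n) hs).le
        gcongr
        exact hC s hs
    _ = Real.exp C * (chiDensity n s * Real.exp (C * s)) := by
        rw [mul_add, mul_one, Real.exp_add]; ring
    _ ≤ _ := mul_le_mul_of_nonneg_left (hK s hs) (Real.exp_pos _).le

/-- Stein's identity for the law of the norm of a standard Gaussian vector. -/
lemma integral_chi_stein (n : ℕ) [NeZero n] {u v : ℝ → ℝ} (hu : ∀ s, 0 < s → HasDerivAt u (v s) s)
    (hu0 : ContinuousWithinAt u (Set.Ici 0) 0) (h0 : u 0 = 0)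
    (hug : ExpGrowth u) (hint : Integrable (fun s => v s + (n - 1) * (u s / s) - s * u s) (chi n)) :
    ∫ s, (v s + (n - 1) * (u s / s) - s * u s) ∂(chi n) = 0 := by
  rw [integral_chi]
  rw [integrable_chi_iff] at hint
  rw [integral_Ioi_of_hasDerivAt_of_tendsto (f := fun s => chiDensity n s * u s) (m := 0) ?_ ?_ hint
    (tendsto_chiDensity_mul hug n), h0]
  · simp
  · exact (continuous_chiDensity n).continuousWithinAt.mul hu0
  · intro s hs
    have hs : 0 < s := hs
    have h1 : HasDerivAt (chiDensity n) (chiDensity n s * ((n - 1) / s - s)) s := by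
      unfold chiDensity gaussProfile
      have e1 : HasDerivAt (fun s : ℝ => Real.exp (-s ^ 2 / 2)) (Real.exp (-s ^ 2 / 2) * (-s)) s := by
        convert! (((hasDerivAt_id s).pow 2).neg.div_const 2).exp using 1
        simp; ring
      have e2 := ((hasDerivAt_pow (n - 1) s).mul (e1.const_mul ((2 * Real.pi) ^ (-(n : ℝ) / 2)))).const_mul
        (sphereArea n)
      convert! e2 using 1
      obtain ⟨m, rfl⟩ : ∃ m, n = m + 1 := ⟨n - 1, (Nat.succ_pred_eq_of_ne_zero (NeZero.ne n)).symm⟩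
      have hm : (m : ℝ) * s ^ m = m * s ^ (m - 1) * s := by
        rcases Nat.eq_zero_or_pos m with rfl | hm
        · simp
        · rw [mul_assoc, ← pow_succ, Nat.sub_add_cancel hm]
      simp only [Nat.add_sub_cancel]
      push_cast
      field_simp
      linear_combination sphereArea (m + 1) * hm
    convert! h1.mul (hu s hs) using 1
    field_simp
    ring

/-! ### The Bessel-type power series -/

/-- The coefficients of `sphMgf`. -/
noncomputable def sphCoeff (n k : ℕ) : ℝ :=
  ∏ i ∈ Finset.range k, 1 / ((2 * (i : ℝ) + 2) * (2 * i + n))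

/-- The power series `∑ₖ x^(2k) / (2^k k! n (n+2) ⋯ (n+2k-2))`, that is,
`Γ(n/2) (2/x)^(n/2-1) I_{n/2-1}(x)`. It is the moment generating function of a coordinate of a
uniform point of the unit sphere of `ℝⁿ`. -/
noncomputable def sphMgf (n : ℕ) (x : ℝ) : ℝ := ∑' k : ℕ, sphCoeff n k * x ^ (2 * k)

section Series

variable (n : ℕ) [NeZero n]

lemma natCast_pos_of_neZero : (0 : ℝ) < n := Nat.cast_pos.2 (Nat.pos_of_ne_zero (NeZero.ne n))

lemma one_le_natCast_of_neZero : (1 : ℝ) ≤ n :=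
  Nat.one_le_cast.2 (Nat.pos_of_ne_zero (NeZero.ne n))

lemma sphCoeff_zero (n : ℕ) : sphCoeff n 0 = 1 := by simp [sphCoeff]

lemma sphCoeff_succ (k : ℕ) :
    sphCoeff n (k + 1) * ((2 * (k : ℝ) + 2) * (2 * k + n)) = sphCoeff n k := by
  have := natCast_pos_of_neZero n
  rw [sphCoeff, Finset.prod_range_succ, ← sphCoeff]
  field_simp

lemma sphCoeff_pos (k : ℕ) : 0 < sphCoeff n k := by
  have := natCast_pos_of_neZero n
  exact Finset.prod_pos fun i _ => by positivity

lemma sphCoeff_add_two (k : ℕ) : sphCoeff (n + 2) k * (n + 2 * k) = n * sphCoeff n k := by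
  have h0 := natCast_pos_of_neZero n
  induction k with
  | zero => simp [sphCoeff_zero]
  | succ k ih =>
    have h1 := sphCoeff_succ n k
    have h2 := sphCoeff_succ (n + 2) k
    rw [← h1, ← h2] at ih
    push_cast at ih ⊢
    have h3 : ((2 * (k : ℝ) + 2) * (2 * k + n)) ≠ 0 := by positivity
    apply mul_right_cancel₀ h3
    linear_combination ih

lemma sphCoeff_succ_mul (k : ℕ) :
    sphCoeff n (k + 1) * (2 * (k : ℝ) + 2) = sphCoeff (n + 2) k / n := by
  have h0 := natCast_pos_of_neZero n
  have h1 := sphCoeff_succ n k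
  have h2 := sphCoeff_add_two n k
  rw [← h1] at h2
  have h3 : (n + 2 * (k : ℝ)) ≠ 0 := by positivity
  rw [eq_div_iff h0.ne']
  apply mul_right_cancel₀ h3
  linear_combination -h2

lemma sphCoeff_le (k : ℕ) : sphCoeff n k ≤ 1 / (2 * k).factorial := by
  have h0 := one_le_natCast_of_neZero n
  induction k with
  | zero => simp [sphCoeff_zero]
  | succ k ih =>
    have h1 := sphCoeff_succ n k
    have hp := (sphCoeff_pos n (k + 1)).le
    rw [show 2 * (k + 1) = 2 * k + 1 + 1 by ring, Nat.factorial_succ, Nat.factorial_succ]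
    push_cast
    rw [← h1, le_div_iff₀ (by positivity)] at ih
    rw [le_div_iff₀ (by positivity)]
    refine le_trans ?_ ih
    have : (2 * (k : ℝ) + 1 + 1) * ((2 * k + 1) * ((2 * k).factorial : ℝ))
      ≤ ((2 * k + 2) * (2 * k + n)) * ((2 * k).factorial : ℝ) := by
      rw [← mul_assoc]
      refine mul_le_mul_of_nonneg_right ?_ (by positivity)
      exact mul_le_mul (by linarith) (by linarith) (by positivity) (by positivity)
    nlinarith

lemma summable_sphMgf (x : ℝ) : Summable (fun k => sphCoeff n k * x ^ (2 * k)) := by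
  refine (Real.hasSum_cosh x).summable.of_nonneg_of_le (fun k => ?_) fun k => ?_
  · exact mul_nonneg (sphCoeff_pos n k).le (by rw [pow_mul]; positivity)
  · rw [div_eq_inv_mul, ← one_div]
    exact mul_le_mul_of_nonneg_right (sphCoeff_le n k) (by rw [pow_mul]; positivity)

lemma sphMgf_zero (n : ℕ) : sphMgf n 0 = 1 := by
  rw [sphMgf, tsum_eq_single 0]
  · simp [sphCoeff_zero]
  · intro k hk
    simp [hk]

lemma one_le_sphMgf (x : ℝ) : 1 ≤ sphMgf n x := by
  have := (summable_sphMgf n x).le_tsum 0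
    (fun k _ => mul_nonneg (sphCoeff_pos n k).le (by rw [pow_mul]; positivity))
  rw [sphMgf]
  simpa [sphCoeff_zero] using this

lemma sphMgf_pos (x : ℝ) : 0 < sphMgf n x := zero_lt_one.trans_le (one_le_sphMgf n x)

lemma sphMgf_le_exp {x : ℝ} (hx : 0 ≤ x) : sphMgf n x ≤ Real.exp x := by
  have h : sphMgf n x ≤ Real.cosh x := by
    rw [← (Real.hasSum_cosh x).tsum_eq]
    refine (summable_sphMgf n x).tsum_le_tsum (fun k => ?_) (Real.hasSum_cosh x).summable
    rw [div_eq_inv_mul, ← one_div]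
    exact mul_le_mul_of_nonneg_right (sphCoeff_le n k) (by rw [pow_mul]; positivity)
  refine h.trans ?_
  rw [Real.cosh_eq]
  have : Real.exp (-x) ≤ Real.exp x := Real.exp_le_exp.2 (by linarith)
  linarith

lemma hasDerivAt_sphMgf (x : ℝ) : HasDerivAt (sphMgf n) (x / n * sphMgf (n + 2) x) x := by
  have h0 := natCast_pos_of_neZero n
  set B := |x| + 1 with hB
  have hB0 : 0 < B := by positivity
  have hsucc : ∀ (k : ℕ) (y : ℝ), sphCoeff n (k + 1) * ((2 * (k + 1) : ℕ) * y ^ (2 * (k + 1) - 1))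
      = y / n * (sphCoeff (n + 2) k * y ^ (2 * k)) := by
    intro k y
    have := sphCoeff_succ_mul n k
    rw [show 2 * (k + 1) - 1 = 2 * k + 1 by omega, pow_succ]
    push_cast
    linear_combination y ^ (2 * k) * y * this
  have hu : Summable (fun k : ℕ => sphCoeff n k * ((2 * k : ℕ) * B ^ (2 * k - 1))) := by
    rw [← summable_nat_add_iff 1]
    simp only [hsucc]
    exact (summable_sphMgf (n + 2) B).mul_left _
  have hd := hasDerivAt_tsum_of_isPreconnected (t := Metric.ball (0 : ℝ) B)
    (g := fun k y => sphCoeff n k * y ^ (2 * k))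
    (g' := fun k y => sphCoeff n k * ((2 * k : ℕ) * y ^ (2 * k - 1))) hu Metric.isOpen_ball
    (convex_ball _ _).isPreconnected (fun k y _ => (hasDerivAt_pow (2 * k) y).const_mul _) ?_
    (y₀ := x) (by simp [hB]) (summable_sphMgf n x) (y := x) (by simp [hB])
  · convert! hd using 1
    have hs : Summable (fun k : ℕ => sphCoeff n k * ((2 * k : ℕ) * x ^ (2 * k - 1))) := by
      rw [← summable_nat_add_iff 1]
      simp only [hsucc]
      exact (summable_sphMgf (n + 2) x).mul_left _
    rw [hs.tsum_eq_zero_add]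
    simp only [hsucc]
    rw [tsum_mul_left, sphMgf]
    simp
  · intro k y hy
    have hy : |y| ≤ B := by simpa using (Metric.mem_ball.1 hy).le
    rw [norm_mul, norm_mul, norm_pow, Real.norm_of_nonneg (sphCoeff_pos n k).le,
      Real.norm_of_nonneg (Nat.cast_nonneg _), Real.norm_eq_abs]
    have := (sphCoeff_pos n k).le
    gcongr

@[fun_prop]
lemma continuous_sphMgf : Continuous (sphMgf n) :=
  continuous_iff_continuousAt.2 fun x => (hasDerivAt_sphMgf n x).continuousAt

/-- The three-term recurrence of the modified Bessel functions. -/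
lemma sphMgf_recurrence (x : ℝ) :
    sphMgf (n + 2) x + x ^ 2 / (n * (n + 2)) * sphMgf (n + 2 + 2) x = sphMgf n x := by
  have h0 := natCast_pos_of_neZero n
  have hterm : ∀ k : ℕ, sphCoeff (n + 2) (k + 1) * x ^ (2 * (k + 1))
      + x ^ 2 / (n * (n + 2)) * (sphCoeff (n + 2 + 2) k * x ^ (2 * k))
      = sphCoeff n (k + 1) * x ^ (2 * (k + 1)) := by
    intro k
    have h1 := sphCoeff_succ_mul (n + 2) k
    have h2 := sphCoeff_add_two n (k + 1)
    push_cast at h1 h2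
    rw [eq_div_iff (by positivity)] at h1
    rw [← h1, show 2 * (k + 1) = 2 * k + 2 by ring, pow_add]
    field_simp
    linear_combination x ^ 2 * x ^ (k * 2) * h2
  rw [sphMgf, (summable_sphMgf (n + 2) x).tsum_eq_zero_add,
    sphMgf, sphMgf, (summable_sphMgf n x).tsum_eq_zero_add, ← tsum_mul_left, add_assoc,
    ← Summable.tsum_add ((summable_nat_add_iff 1).2 (summable_sphMgf (n + 2) x))
      ((summable_sphMgf (n + 2 + 2) x).mul_left _)]
  simp only [hterm, sphCoeff_zero]

lemma hasDerivAt_sphMgf_add_two {x : ℝ} (hx : x ≠ 0) :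
    HasDerivAt (sphMgf (n + 2)) (n * (sphMgf n x - sphMgf (n + 2) x) / x) x := by
  have h0 := natCast_pos_of_neZero n
  convert! hasDerivAt_sphMgf (n + 2) x using 1
  rw [← sphMgf_recurrence n x]
  push_cast
  field_simp
  ring

/-- The derivative of `sphMgf`. -/
noncomputable def sphMgfDeriv (n : ℕ) (x : ℝ) : ℝ := x / n * sphMgf (n + 2) x

lemma hasDerivAt_sphMgfDeriv (x : ℝ) :
    HasDerivAt (sphMgfDeriv n) (sphMgf n x - (n - 1) * (sphMgf (n + 2) x / n)) x := by
  have h0 := natCast_pos_of_neZero n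
  unfold sphMgfDeriv
  convert! ((hasDerivAt_id x).div_const (n : ℝ)).mul (hasDerivAt_sphMgf (n + 2) x) using 1
  rw [← sphMgf_recurrence n x]
  push_cast
  simp only [id]
  field_simp
  ring

@[fun_prop]
lemma continuous_sphMgfDeriv : Continuous (sphMgfDeriv n) :=
  continuous_iff_continuousAt.2 fun x => (hasDerivAt_sphMgfDeriv n x).continuousAt

/-! ### The ratio `h` and its monotonicity -/

/-- The logarithmic derivative of `sphMgf n`, which is the Bessel ratio `h_{n/2}`. -/
noncomputable def sphRatio (n : ℕ) (x : ℝ) : ℝ := sphMgfDeriv n x / sphMgf n x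

/-- The function `sphRatio n x / x`, continued to `x = 0`. -/
noncomputable def sphSlope (n : ℕ) (x : ℝ) : ℝ := sphMgf (n + 2) x / (n * sphMgf n x)

lemma sphRatio_eq (n : ℕ) (x : ℝ) : sphRatio n x = x * sphSlope n x := by
  unfold sphRatio sphSlope sphMgfDeriv
  rw [← div_div]
  ring

@[fun_prop]
lemma continuous_sphSlope : Continuous (sphSlope n) := by
  have h0 := natCast_pos_of_neZero n
  unfold sphSlope
  exact (continuous_sphMgf (n + 2)).div (continuous_const.mul (continuous_sphMgf n))
    fun x => (mul_pos h0 (sphMgf_pos n x)).ne'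

@[fun_prop]
lemma continuous_sphRatio : Continuous (sphRatio n) :=
  (continuous_sphMgfDeriv n).div (continuous_sphMgf n) fun x => (sphMgf_pos n x).ne'

lemma sphSlope_pos (x : ℝ) : 0 < sphSlope n x :=
  div_pos (sphMgf_pos _ x) (mul_pos (natCast_pos_of_neZero n) (sphMgf_pos n x))

lemma sphSlope_zero (n : ℕ) : sphSlope n 0 = 1 / n := by
  simp [sphSlope, sphMgf_zero]

lemma sphRatio_zero (n : ℕ) : sphRatio n 0 = 0 := by simp [sphRatio_eq]

lemma sphRatio_pos {x : ℝ} (hx : 0 < x) : 0 < sphRatio n x := by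
  rw [sphRatio_eq]; exact mul_pos hx (sphSlope_pos n x)

lemma sphRatio_nonneg {x : ℝ} (hx : 0 ≤ x) : 0 ≤ sphRatio n x := by
  rw [sphRatio_eq]; exact mul_nonneg hx (sphSlope_pos n x).le

/-- The Riccati equation of the Bessel ratio. -/
lemma hasDerivAt_sphRatio (x : ℝ) :
    HasDerivAt (sphRatio n) (1 - sphRatio n x ^ 2 - (n - 1) * sphSlope n x) x := by
  have h0 := natCast_pos_of_neZero n
  have h1 := sphMgf_pos n x
  convert! (hasDerivAt_sphMgfDeriv n x).div (hasDerivAt_sphMgf n x) h1.ne' using 1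
  unfold sphRatio sphSlope sphMgfDeriv
  field_simp
  ring

lemma hasDerivAt_sphSlope {x : ℝ} (hx : x ≠ 0) :
    HasDerivAt (sphSlope n) ((1 - sphRatio n x ^ 2 - n * sphSlope n x) / x) x := by
  have h0 := natCast_pos_of_neZero n
  have h1 := sphMgf_pos n x
  convert! (hasDerivAt_sphMgf_add_two n hx).div ((hasDerivAt_sphMgf n x).const_mul (n : ℝ))
    (mul_pos h0 h1).ne' using 1
  unfold sphRatio sphSlope sphMgfDeriv
  field_simp
  ring

/-- `Φ² - Φ'² ≥ 1` for `Φ = sphMgf n`: this function of `x` has a nonnegative derivative and the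
value `1` at `0`. -/
lemma one_le_sphMgf_sq_sub {x : ℝ} (hx : 0 ≤ x) :
    1 ≤ sphMgf n x ^ 2 - sphMgfDeriv n x ^ 2 := by
  have h0 := one_le_natCast_of_neZero n
  have hmono : MonotoneOn (fun x => sphMgf n x ^ 2 - sphMgfDeriv n x ^ 2) (Set.Ici 0) := by
    refine monotoneOn_of_hasDerivWithinAt_nonneg (convex_Ici 0) (by fun_prop)
      (fun y hy => (((hasDerivAt_sphMgf n y).pow 2).sub
        ((hasDerivAt_sphMgfDeriv n y).pow 2)).hasDerivWithinAt) fun y hy => ?_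
    rw [interior_Ici] at hy
    have hy : 0 < y := hy
    have e : (2 : ℕ) * sphMgf n y ^ (2 - 1) * (y / n * sphMgf (n + 2) y)
        - (2 : ℕ) * sphMgfDeriv n y ^ (2 - 1) * (sphMgf n y - (n - 1) * (sphMgf (n + 2) y / n))
        = 2 * y * (n - 1) * (sphMgf (n + 2) y / n) ^ 2 := by
      unfold sphMgfDeriv
      push_cast
      field_simp
      ring
    rw [e]
    have : (0 : ℝ) ≤ n - 1 := by linarith
    positivity
  have := hmono (Set.mem_Ici.2 le_rfl) hx hx
  simpa [sphMgf_zero, sphMgfDeriv] using this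

lemma sphRatio_sq_lt_one {x : ℝ} (hx : 0 ≤ x) : sphRatio n x ^ 2 < 1 := by
  have h1 := sphMgf_pos n x
  rw [sphRatio, div_pow, div_lt_one (by positivity)]
  linarith [one_le_sphMgf_sq_sub n hx]

lemma sphRatio_lt_one {x : ℝ} (hx : 0 ≤ x) : sphRatio n x < 1 := by
  have := sphRatio_sq_lt_one n hx
  nlinarith

/-- The lower bound `1 - h² - n h / x ≤ 0` for the Bessel ratio `h`: after multiplication by
`x^n Φ²` the left-hand side has derivative `-2 x^(n-1) Φ'²`. -/
lemma one_sub_sphRatio_sq_sub_nonpos {x : ℝ} (hx : 0 ≤ x) :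
    1 - sphRatio n x ^ 2 - n * sphSlope n x ≤ 0 := by
  have h0 := natCast_pos_of_neZero n
  set E : ℝ → ℝ := fun x =>
    x ^ n * (sphMgf n x ^ 2 - sphMgfDeriv n x ^ 2 - sphMgf n x * sphMgf (n + 2) x) with hE
  have hE' : ∀ y, 0 < y → HasDerivAt E (-2 * y ^ (n - 1) * sphMgfDeriv n y ^ 2) y := by
    intro y hy
    convert! (hasDerivAt_pow n y).mul ((((hasDerivAt_sphMgf n y).pow 2).sub
      ((hasDerivAt_sphMgfDeriv n y).pow 2)).sub ((hasDerivAt_sphMgf n y).mul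
      (hasDerivAt_sphMgf_add_two n hy.ne'))) using 1
    have e : y ^ n = y ^ (n - 1) * y := by
      rw [← pow_succ, Nat.sub_add_cancel (Nat.pos_of_ne_zero (NeZero.ne n))]
    rw [e]
    simp only [Pi.sub_apply, Pi.mul_apply, Pi.pow_apply]
    unfold sphMgfDeriv
    push_cast
    field_simp
    ring
  have hanti : AntitoneOn E (Set.Ici 0) := by
    refine antitoneOn_of_hasDerivWithinAt_nonpos (convex_Ici 0) (by fun_prop)
      (fun y hy => (hE' y (by rwa [interior_Ici] at hy)).hasDerivWithinAt) fun y hy => ?_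
    rw [interior_Ici] at hy
    have hy : 0 < y := hy
    have : 0 ≤ y ^ (n - 1) * sphMgfDeriv n y ^ 2 := by positivity
    linarith
  rcases hx.eq_or_lt with rfl | hx'
  · rw [sphRatio_zero, sphSlope_zero]
    field_simp
    norm_num
  · have h2 := hanti (Set.mem_Ici.2 le_rfl) hx hx
    have h3 : E 0 = 0 := by simp [hE, NeZero.ne n]
    rw [h3] at h2
    have h1 := sphMgf_pos n x
    have h4 : E x = x ^ n * sphMgf n x ^ 2 * (1 - sphRatio n x ^ 2 - n * sphSlope n x) := by
      simp only [hE]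
      unfold sphRatio sphSlope
      field_simp
    rw [h4] at h2
    exact nonpos_of_mul_nonpos_right h2 (by positivity)

/-- The upper bound `1 - h² - (n - 1) h / x > 0` for the Bessel ratio `h`, which says that `h` has
a positive derivative: after multiplication by `x^n Φ²` the left-hand side has derivative
`x^(n-1) (Φ² - Φ'²) > 0`. -/
lemma one_sub_sphRatio_sq_sub_pos {x : ℝ} (hx : 0 < x) :
    0 < 1 - sphRatio n x ^ 2 - (n - 1) * sphSlope n x := by
  have h0 := natCast_pos_of_neZero n
  set W : ℝ → ℝ := fun x =>
    x ^ n * (sphMgf n x ^ 2 - sphMgfDeriv n x ^ 2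
      - (n - 1) / n * (sphMgf n x * sphMgf (n + 2) x)) with hW
  have hW' : ∀ y, 0 < y →
      HasDerivAt W (y ^ (n - 1) * (sphMgf n y ^ 2 - sphMgfDeriv n y ^ 2)) y := by
    intro y hy
    convert! (hasDerivAt_pow n y).mul ((((hasDerivAt_sphMgf n y).pow 2).sub
      ((hasDerivAt_sphMgfDeriv n y).pow 2)).sub (((hasDerivAt_sphMgf n y).mul
      (hasDerivAt_sphMgf_add_two n hy.ne')).const_mul (((n : ℝ) - 1) / n))) using 1
    have e : y ^ n = y ^ (n - 1) * y := by
      rw [← pow_succ, Nat.sub_add_cancel (Nat.pos_of_ne_zero (NeZero.ne n))]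
    rw [e]
    simp only [Pi.sub_apply, Pi.mul_apply, Pi.pow_apply]
    unfold sphMgfDeriv
    push_cast
    field_simp
    ring
  have hmono : StrictMonoOn W (Set.Ici 0) := by
    refine strictMonoOn_of_hasDerivWithinAt_pos (convex_Ici 0) (by fun_prop)
      (fun y hy => (hW' y (by rwa [interior_Ici] at hy)).hasDerivWithinAt) fun y hy => ?_
    rw [interior_Ici] at hy
    have hy : 0 < y := hy
    have := one_le_sphMgf_sq_sub n hy.le
    have : 0 < sphMgf n y ^ 2 - sphMgfDeriv n y ^ 2 := by linarith
    positivity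
  have h2 := hmono (Set.mem_Ici.2 le_rfl) hx.le hx
  have h3 : W 0 = 0 := by simp [hW, NeZero.ne n]
  rw [h3] at h2
  have h1 := sphMgf_pos n x
  have h4 : W x = x ^ n * sphMgf n x ^ 2 * (1 - sphRatio n x ^ 2 - (n - 1) * sphSlope n x) := by
    simp only [hW]
    unfold sphRatio sphSlope
    field_simp
  rw [h4] at h2
  exact pos_of_mul_pos_right h2 (by positivity)

lemma strictMonoOn_sphRatio : StrictMonoOn (sphRatio n) (Set.Ici 0) := by
  refine strictMonoOn_of_hasDerivWithinAt_pos (convex_Ici 0) (by fun_prop)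
    (fun y _ => (hasDerivAt_sphRatio n y).hasDerivWithinAt) fun y hy => ?_
  rw [interior_Ici] at hy
  exact one_sub_sphRatio_sq_sub_pos n hy

lemma antitoneOn_sphSlope : AntitoneOn (sphSlope n) (Set.Ici 0) := by
  refine antitoneOn_of_hasDerivWithinAt_nonpos (convex_Ici 0) (by fun_prop)
    (f' := fun x => (1 - sphRatio n x ^ 2 - n * sphSlope n x) / x)
    (fun y hy => ?_) fun y hy => ?_ <;> rw [interior_Ici] at hy <;> have hy : 0 < y := hy
  · exact (hasDerivAt_sphSlope n hy.ne').hasDerivWithinAt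
  · exact div_nonpos_of_nonpos_of_nonneg (one_sub_sphRatio_sq_sub_nonpos n hy.le) hy.le

lemma sphSlope_le {x : ℝ} (hx : 0 ≤ x) : sphSlope n x ≤ 1 / n := by
  rw [← sphSlope_zero n]
  exact antitoneOn_sphSlope n (Set.mem_Ici.2 le_rfl) hx hx

/-! ### Bessel functions of half-integer order -/

/-- Termwise comparison of the two power series. For `n = 1` the order is `-1/2`, where the
series of `besselI` is still free of poles of `Γ`. -/
lemma besselI_half_sub_one {x : ℝ} (hx : 0 < x) :
    besselI ((n : ℝ) / 2 - 1) x
      = (x / 2) ^ ((n : ℝ) / 2 - 1) / Real.Gamma (n / 2) * sphMgf n x := by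
  have h0 := natCast_pos_of_neZero n
  have hΓ : ∀ k : ℕ, sphCoeff n k * (4 ^ k * k.factorial * Real.Gamma ((k : ℝ) + n / 2))
      = Real.Gamma (n / 2) := by
    intro k
    induction k with
    | zero => simp [sphCoeff_zero]
    | succ k ih =>
      rw [← ih, ← sphCoeff_succ n k, Nat.factorial_succ]
      push_cast
      rw [show (k : ℝ) + 1 + n / 2 = (k + n / 2) + 1 by ring, Real.Gamma_add_one (by positivity)]
      ring
  rw [besselI, sphMgf, ← tsum_mul_left]
  refine tsum_congr fun k => ?_
  have hG : 0 < Real.Gamma (n / 2 : ℝ) := Real.Gamma_pos_of_pos (by positivity)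
  have hGk : 0 < Real.Gamma ((k : ℝ) + n / 2) := Real.Gamma_pos_of_pos (by positivity)
  rw [show (k : ℝ) + ((n : ℝ) / 2 - 1) + 1 = k + n / 2 by ring, Real.rpow_add (by positivity),
    show (2 * (k : ℝ)) = ((2 * k : ℕ) : ℝ) by push_cast; ring, Real.rpow_natCast]
  have e1 : (x / 2) ^ (2 * k) * 4 ^ k = x ^ (2 * k) := by
    rw [div_pow, pow_mul 2 2 k]
    norm_num
  rw [← e1, ← hΓ k]
  have := sphCoeff_pos n k
  field_simp

/-- At `x = 0` both sides vanish, on the left because `besselI (n / 2) 0 = 0`. -/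
lemma besselRatio_half {x : ℝ} (hx : 0 ≤ x) : besselRatio ((n : ℝ) / 2) x = sphRatio n x := by
  have h0 := natCast_pos_of_neZero n
  rcases hx.eq_or_lt with rfl | hx
  · have : besselI ((n : ℝ) / 2) 0 = 0 := by
      have hz : ∀ k : ℕ, (0 : ℝ) ^ (2 * (k : ℝ) + (n : ℝ) / 2) = 0 := fun k =>
        Real.zero_rpow (by positivity)
      simp [besselI, hz]
    rw [besselRatio, this, zero_div, sphRatio_zero]
  · have h1 := besselI_half_sub_one n hx
    have h2 := besselI_half_sub_one (n + 2) hx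
    have hG : 0 < Real.Gamma (n / 2 : ℝ) := Real.Gamma_pos_of_pos (by positivity)
    push_cast at h2
    rw [show ((n : ℝ) + 2) / 2 - 1 = n / 2 by ring, show ((n : ℝ) + 2) / 2 = n / 2 + 1 by ring,
      Real.Gamma_add_one (by positivity)] at h2
    rw [besselRatio, h1, h2, sphRatio, sphMgfDeriv, Real.rpow_sub_one (by positivity)]
    have := sphMgf_pos n x
    have : 0 < (x / 2) ^ ((n : ℝ) / 2) := by positivity
    field_simp

end Series

/-! ### The moment generating function of the uniform distribution on the sphere -/

lemma integral_chi_pow_add_two (n : ℕ) [NeZero n] (k : ℕ) :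
    ∫ s, s ^ (2 * (k + 1)) ∂(chi n) = (n + 2 * k) * ∫ s, s ^ (2 * k) ∂(chi n) := by
  have hint : ∀ j : ℕ, Integrable (fun s : ℝ => s ^ j) (chi n) := fun j =>
    (ExpGrowth.id.pow j).integrable_chi n (by fun_prop)
  have e : ∀ s : ℝ, 0 < s → ((2 * k + 1 : ℕ) * s ^ (2 * k) + (n - 1) * (s ^ (2 * k + 1) / s)
      - s * s ^ (2 * k + 1)) = (n + 2 * k) * s ^ (2 * k) - s ^ (2 * (k + 1)) := by
    intro s hs
    rw [pow_succ, mul_div_cancel_right₀ _ hs.ne']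
    push_cast
    ring
  have hae := (ae_chi_pos n).mono e
  have h := integral_chi_stein n (u := fun s => s ^ (2 * k + 1))
    (v := fun s => (2 * k + 1 : ℕ) * s ^ (2 * k))
    (fun s _ => by simpa using hasDerivAt_pow (2 * k + 1) s)
    (by fun_prop) (by simp) (ExpGrowth.id.pow _)
    (((hint _).const_mul _ |>.sub (hint _)).congr (hae.mono fun s hs => hs.symm))
  rw [integral_congr_ae hae, integral_sub ((hint _).const_mul _) (hint _), integral_const_mul] at h
  linarith

lemma integral_chi_pow (n : ℕ) [NeZero n] (k : ℕ) :
    ∫ s, s ^ (2 * k) ∂(chi n) = ∏ i ∈ Finset.range k, ((n : ℝ) + 2 * i) := by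
  induction k with
  | zero => simp
  | succ k ih => rw [integral_chi_pow_add_two, ih, Finset.prod_range_succ, mul_comm]

/-- A linear form of a standard Gaussian vector has the law of a multiple of a standard Gaussian
variable. -/
lemma map_inner_stdGaussian (n : ℕ) (y : Rn n) :
    (stdGaussian (Rn n)).map (fun z => inner ℝ y z)
      = (stdGaussian (Rn 1)).map (fun z => inner ℝ (EuclideanSpace.single 0 ‖y‖) z) := by
  have key : ∀ (m : ℕ) (w : Rn m) (t : ℝ),
      charFun ((stdGaussian (Rn m)).map (fun z => inner ℝ w z)) t
        = Complex.exp (-(‖t • w‖ : ℂ) ^ 2 / 2) := by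
    intro m w t
    rw [← charFun_stdGaussian, charFun_apply, charFun_apply,
      integral_map (by fun_prop) (by fun_prop)]
    simp only [real_inner_smul_right, real_inner_comm w]
    simp [mul_comm]
  have : IsProbabilityMeasure ((stdGaussian (Rn n)).map (fun z => inner ℝ y z)) :=
    Measure.isProbabilityMeasure_map (by fun_prop)
  have : IsProbabilityMeasure
      ((stdGaussian (Rn 1)).map (fun z => inner ℝ (EuclideanSpace.single 0 ‖y‖) z)) :=
    Measure.isProbabilityMeasure_map (by fun_prop)
  apply Measure.ext_of_charFun
  ext t
  rw [key, key]
  simp [norm_smul]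

lemma integral_stdGaussian_norm (n : ℕ) [NeZero n] (f : ℝ → ℝ) (hf : Measurable f) :
    ∫ z, f ‖z‖ ∂(stdGaussian (Rn n)) = ∫ s, f s ∂(chi n) := by
  rw [← (measurePreserving_norm n).map_eq, integral_map (by fun_prop) (by fun_prop)]

lemma integrable_stdGaussian_norm_iff (n : ℕ) [NeZero n] (f : ℝ → ℝ) (hf : Measurable f) :
    Integrable (fun z => f ‖z‖) (stdGaussian (Rn n)) ↔ Integrable f (chi n) := by
  rw [← (measurePreserving_norm n).map_eq, integrable_map_measure (by fun_prop) (by fun_prop)]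
  rfl

lemma integral_inner_pow_stdGaussian (n : ℕ) (y : Rn n) (k : ℕ) :
    ∫ z, (inner ℝ y z : ℝ) ^ (2 * k) ∂(stdGaussian (Rn n))
      = ‖y‖ ^ (2 * k) * ∏ i ∈ Finset.range k, ((1 : ℝ) + 2 * i) := by
  have h1 : ∫ z, (inner ℝ y z : ℝ) ^ (2 * k) ∂(stdGaussian (Rn n))
      = ∫ t, t ^ (2 * k) ∂((stdGaussian (Rn n)).map (fun z => inner ℝ y z)) := by
    rw [integral_map (by fun_prop) (by fun_prop)]
  have h2 := integral_chi_pow 1 k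
  rw [h1, map_inner_stdGaussian, integral_map (by fun_prop) (by fun_prop), ← Nat.cast_one (R := ℝ),
    ← h2, ← integral_stdGaussian_norm 1 _ (by fun_prop), ← integral_const_mul]
  refine integral_congr_ae (Filter.Eventually.of_forall fun z => ?_)
  simp only [EuclideanSpace.inner_single_left, EuclideanSpace.norm_eq, Fin.sum_univ_one]
  rw [Real.sqrt_sq_eq_abs]
  simp [mul_pow, pow_mul]

lemma integral_stdGaussian_neg (n : ℕ) (f : Rn n → ℝ) (hf : Measurable f) :
    ∫ z, f (-z) ∂(stdGaussian (Rn n)) = ∫ z, f z ∂(stdGaussian (Rn n)) := by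
  have h : (stdGaussian (Rn n)).map (fun z => -z) = stdGaussian (Rn n) :=
    stdGaussian_map (LinearIsometryEquiv.neg ℝ)
  conv_rhs => rw [← h]
  rw [integral_map (by fun_prop) (by fun_prop)]

/-- The moments of a linear form on the sphere, from those of the Gaussian measure and of its
norm. -/
lemma integral_inner_pow_mul_chi (n : ℕ) [NeZero n] (y : Rn n) (k : ℕ) :
    (∫ θ, (inner ℝ y (θ : Rn n) : ℝ) ^ k ∂(uniformUnitSphere n)) * ∫ s, s ^ k ∂(chi n)
      = ∫ z, (inner ℝ y z : ℝ) ^ k ∂(stdGaussian (Rn n)) := by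
  rw [← (measurePreserving_polar n).map_eq, integral_map (by fun_prop) (by fun_prop),
    ← integral_prod_mul]
  simp only [inner_smul_right, mul_pow, mul_comm]

lemma integral_sphere_inner_pow_odd (n : ℕ) [NeZero n] (y : Rn n) (k : ℕ) :
    ∫ θ, (inner ℝ y (θ : Rn n) : ℝ) ^ (2 * k + 1) ∂(uniformUnitSphere n) = 0 := by
  have h := integral_inner_pow_mul_chi n y (2 * k + 1)
  have h2 := integral_stdGaussian_neg n (fun z => (inner ℝ y z : ℝ) ^ (2 * k + 1)) (by fun_prop)
  simp only [inner_neg_right, Odd.neg_pow ⟨k, rfl⟩, integral_neg] at h2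
  have h3 : ∫ z, (inner ℝ y z : ℝ) ^ (2 * k + 1) ∂(stdGaussian (Rn n)) = 0 := by linarith
  rw [h3] at h
  have hpos : 0 < ∫ s, s ^ (2 * k + 1) ∂(chi n) := by
    rw [integral_pos_iff_support_of_nonneg_ae]
    · have : (Function.support fun s : ℝ => s ^ (2 * k + 1)) =ᵐ[chi n] Set.univ := by
        filter_upwards [ae_chi_pos n] with s hs
        simp only [eq_iff_iff]
        change s ^ (2 * k + 1) ≠ 0 ↔ True
        simp [hs.ne']
      rw [measure_congr this]
      simp
    · filter_upwards [ae_chi_pos n] with s hs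
      simp only [Pi.zero_apply]
      positivity
    · exact (ExpGrowth.id.pow _).integrable_chi n (by fun_prop)
  exact (mul_eq_zero.1 h).resolve_right hpos.ne'

lemma integral_sphere_inner_pow_even (n : ℕ) [NeZero n] (y : Rn n) (k : ℕ) :
    ∫ θ, (inner ℝ y (θ : Rn n) : ℝ) ^ (2 * k) ∂(uniformUnitSphere n)
      = (2 * k).factorial * (sphCoeff n k * ‖y‖ ^ (2 * k)) := by
  have h0 := natCast_pos_of_neZero n
  have h := integral_inner_pow_mul_chi n y (2 * k)
  rw [integral_chi_pow, integral_inner_pow_stdGaussian] at h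
  have hpos : ∀ m : ℕ, 0 < ∏ i ∈ Finset.range m, ((n : ℝ) + 2 * i) := fun m =>
    Finset.prod_pos fun i _ => by positivity
  have hc : ∀ m : ℕ, (2 * m).factorial * sphCoeff n m * ∏ i ∈ Finset.range m, ((n : ℝ) + 2 * i)
      = ∏ i ∈ Finset.range m, ((1 : ℝ) + 2 * i) := by
    intro m
    induction m with
    | zero => simp [sphCoeff_zero]
    | succ m ih =>
      rw [Finset.prod_range_succ, Finset.prod_range_succ, ← ih, ← sphCoeff_succ n m,
        show 2 * (m + 1) = 2 * m + 1 + 1 by ring, Nat.factorial_succ, Nat.factorial_succ]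
      push_cast
      ring
  apply mul_right_cancel₀ (hpos k).ne'
  rw [h, ← hc k]
  ring

/-- The moment generating function of the uniform distribution on the unit sphere. -/
lemma integral_sphere_exp_inner (n : ℕ) [NeZero n] (y : Rn n) :
    ∫ θ, Real.exp (inner ℝ y (θ : Rn n)) ∂(uniformUnitSphere n) = sphMgf n ‖y‖ := by
  have hb : ∀ θ : Metric.sphere (0 : Rn n) 1, |(inner ℝ y (θ : Rn n) : ℝ)| ≤ ‖y‖ := by
    intro θ
    have := abs_real_inner_le_norm y (θ : Rn n)
    simpa using this
  have h1 : HasSum (fun k : ℕ => ∫ θ, (inner ℝ y (θ : Rn n) : ℝ) ^ k / k.factorial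
      ∂(uniformUnitSphere n)) (∫ θ, Real.exp (inner ℝ y (θ : Rn n)) ∂(uniformUnitSphere n)) := by
    refine hasSum_integral_of_dominated_convergence (fun k _ => ‖y‖ ^ k / k.factorial)
      (fun k => by fun_prop) (fun k => Filter.Eventually.of_forall fun θ => ?_)
      (Filter.Eventually.of_forall fun θ => Real.summable_pow_div_factorial _)
      (integrable_const _) (Filter.Eventually.of_forall fun θ => ?_)
    · rw [norm_div, norm_pow, Real.norm_eq_abs, Real.norm_natCast]
      have := hb θ
      gcongr
    · rw [Real.exp_eq_exp_ℝ]
      exact NormedSpace.expSeries_div_hasSum_exp _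
  refine h1.unique ?_
  rw [← add_zero (sphMgf n ‖y‖)]
  refine HasSum.even_add_odd ?_ ?_
  · convert! (summable_sphMgf n ‖y‖).hasSum using 2 with k
    rw [integral_div, integral_sphere_inner_pow_even]
    field_simp
  · convert! hasSum_zero using 2 with k
    rw [integral_div, integral_sphere_inner_pow_odd, zero_div]

/-- The law of the norm of `x + Z` depends on `x` only through `‖x‖`: it has density
`s ↦ exp (-‖x‖² / 2) Φ(‖x‖ s)` with respect to the law of `‖Z‖`. -/
lemma integral_stdGaussian_norm_add (n : ℕ) [NeZero n] (x : Rn n) (f : ℝ → ℝ) (hf : Measurable f)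
    (hfg : ExpGrowth f) :
    ∫ z, f ‖x + z‖ ∂(stdGaussian (Rn n))
      = ∫ s, Real.exp (-‖x‖ ^ 2 / 2) * (f s * sphMgf n (‖x‖ * s)) ∂(chi n) := by
  have hexp : ∀ (θ : Metric.sphere (0 : Rn n) 1) (s : ℝ),
      (inner ℝ x (s • (θ : Rn n)) : ℝ) = inner ℝ (s • x) (θ : Rn n) := fun θ s => by
    rw [inner_smul_right, real_inner_smul_left]
  have hdom : Integrable (fun s => Real.exp (‖x‖ * s) * f s) (chi n) :=
    ((ExpGrowth.exp ‖x‖).mul hfg).integrable_chi n (by fun_prop)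
  have hint : Integrable (fun p : Metric.sphere (0 : Rn n) 1 × ℝ =>
      Real.exp (inner ℝ x (p.2 • (p.1 : Rn n)) - ‖x‖ ^ 2 / 2) * f ‖p.2 • (p.1 : Rn n)‖)
      ((uniformUnitSphere n).prod (chi n)) := by
    refine ((hdom.norm).comp_snd (uniformUnitSphere n)).mono' (by fun_prop) ?_
    filter_upwards [(Measure.quasiMeasurePreserving_snd (μ := uniformUnitSphere n)
      (ν := chi n)).ae (ae_chi_pos n)] with p hp
    have hn : ‖p.2 • (p.1 : Rn n)‖ = p.2 := by simp [norm_smul, abs_of_pos hp]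
    rw [hn, norm_mul, norm_mul, Real.norm_of_nonneg (Real.exp_pos _).le,
      Real.norm_of_nonneg (Real.exp_pos _).le]
    refine mul_le_mul_of_nonneg_right (Real.exp_le_exp.2 ?_) (norm_nonneg _)
    have := real_inner_le_norm x (p.2 • (p.1 : Rn n))
    rw [hn] at this
    nlinarith [sq_nonneg ‖x‖]
  rw [integral_stdGaussian_add n x (fun z => f ‖z‖) (by fun_prop),
    ← (measurePreserving_polar n).map_eq, integral_map (by fun_prop) (by fun_prop),
    integral_prod_symm _ hint]
  refine integral_congr_ae ?_
  filter_upwards [ae_chi_pos n] with s hs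
  have h := integral_sphere_exp_inner n (s • x)
  rw [norm_smul, Real.norm_of_nonneg hs.le, mul_comm] at h
  rw [← h, ← integral_const_mul, ← integral_const_mul]
  refine integral_congr_ae (Filter.Eventually.of_forall fun θ => ?_)
  have hn : ‖s • (θ : Rn n)‖ = s := by simp [norm_smul, abs_of_pos hs]
  simp only [hexp, hn]
  rw [sub_eq_add_neg, Real.exp_add, neg_div]
  ring

/-! ### The information transmitted by a bounded input -/

/-- The density at `y` of the output law for the input `x`, with respect to the law of the
noise. -/
noncomputable def gaussTilt {n : ℕ} (x y : Rn n) : ℝ := Real.exp (inner ℝ x y - ‖x‖ ^ 2 / 2)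

/-- The density of the output law for the input law `P`, with respect to the law of the noise. -/
noncomputable def outDensity {n : ℕ} (P : Measure (Rn n)) (y : Rn n) : ℝ := ∫ x, gaussTilt x y ∂P

section Bounded

variable {n : ℕ} {R : ℝ} {P : Measure (Rn n)}

lemma gaussTilt_pos (x y : Rn n) : 0 < gaussTilt x y := Real.exp_pos _

@[fun_prop]
lemma measurable_gaussTilt : Measurable (fun p : Rn n × Rn n => gaussTilt p.1 p.2) := by
  unfold gaussTilt; fun_prop

lemma gaussTilt_le {x : Rn n} (hx : ‖x‖ ≤ R) (y : Rn n) : gaussTilt x y ≤ Real.exp (R * ‖y‖) := by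
  apply Real.exp_le_exp.2
  have := real_inner_le_norm x y
  nlinarith [norm_nonneg y, sq_nonneg ‖x‖]

lemma le_gaussTilt {x : Rn n} (hx : ‖x‖ ≤ R) (y : Rn n) :
    Real.exp (-(R * ‖y‖ + R ^ 2 / 2)) ≤ gaussTilt x y := by
  apply Real.exp_le_exp.2
  have h1 := neg_le_of_abs_le (abs_real_inner_le_norm x y)
  have h2 : ‖x‖ ^ 2 ≤ R ^ 2 := by gcongr
  nlinarith [norm_nonneg y]

lemma measurable_outDensity [SFinite P] : Measurable (outDensity P) := by
  have : StronglyMeasurable (fun p : Rn n × Rn n => gaussTilt p.2 p.1) := by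
    apply Measurable.stronglyMeasurable
    exact measurable_gaussTilt.comp measurable_swap
  exact (StronglyMeasurable.integral_prod_right this).measurable

variable [IsProbabilityMeasure P]

lemma integrable_gaussTilt (hP : ∀ᵐ x ∂P, ‖x‖ ≤ R) (y : Rn n) :
    Integrable (fun x => gaussTilt x y) P := by
  refine (integrable_const (Real.exp (R * ‖y‖))).mono' ?_ ?_
  · exact (measurable_gaussTilt.comp (measurable_id.prodMk measurable_const)).aestronglyMeasurable
  · filter_upwards [hP] with x hx
    rw [Real.norm_of_nonneg (gaussTilt_pos x y).le]
    exact gaussTilt_le hx y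

lemma outDensity_le (hP : ∀ᵐ x ∂P, ‖x‖ ≤ R) (y : Rn n) : outDensity P y ≤ Real.exp (R * ‖y‖) := by
  have := integral_mono_ae (integrable_gaussTilt hP y) (integrable_const (Real.exp (R * ‖y‖)))
    (hP.mono fun x hx => gaussTilt_le hx y)
  rw [outDensity]
  simpa using this

lemma le_outDensity (hP : ∀ᵐ x ∂P, ‖x‖ ≤ R) (y : Rn n) :
    Real.exp (-(R * ‖y‖ + R ^ 2 / 2)) ≤ outDensity P y := by
  have := integral_mono_ae (integrable_const (Real.exp (-(R * ‖y‖ + R ^ 2 / 2))))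
    (integrable_gaussTilt hP y) (hP.mono fun x hx => le_gaussTilt hx y)
  rw [outDensity]
  simpa using this

lemma outDensity_pos (hP : ∀ᵐ x ∂P, ‖x‖ ≤ R) (y : Rn n) : 0 < outDensity P y :=
  (Real.exp_pos _).trans_le (le_outDensity hP y)

lemma abs_log_outDensity_le (hP : ∀ᵐ x ∂P, ‖x‖ ≤ R) (y : Rn n) :
    |Real.log (outDensity P y)| ≤ R * ‖y‖ + R ^ 2 / 2 := by
  have h0 := outDensity_pos hP y
  rw [abs_le]
  constructor
  · rw [Real.le_log_iff_exp_le h0]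
    exact le_outDensity hP y
  · rw [Real.log_le_iff_le_exp h0]
    refine (outDensity_le hP y).trans (Real.exp_le_exp.2 ?_)
    nlinarith

lemma abs_log_outDensity_le_exp (hR : 0 ≤ R) (hP : ∀ᵐ x ∂P, ‖x‖ ≤ R) (y : Rn n) :
    |Real.log (outDensity P y)| ≤ Real.exp ((R + R ^ 2 / 2) * (1 + ‖y‖)) := by
  refine (abs_log_outDensity_le hP y).trans ?_
  have h1 := Real.add_one_le_exp ((R + R ^ 2 / 2) * (1 + ‖y‖))
  have h2 : 0 ≤ R ^ 2 / 2 * ‖y‖ := by positivity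
  nlinarith

lemma integrable_norm_sq (hP : ∀ᵐ x ∂P, ‖x‖ ≤ R) : Integrable (fun x => ‖x‖ ^ 2 / 2) P := by
  refine (integrable_const (R ^ 2 / 2)).mono' (by fun_prop) ?_
  filter_upwards [hP] with x hx
  rw [Real.norm_of_nonneg (by positivity)]
  gcongr

lemma integrable_exp_norm_stdGaussian (n : ℕ) [NeZero n] (C : ℝ) :
    Integrable (fun z => Real.exp (C * ‖z‖)) (stdGaussian (Rn n)) := by
  rw [integrable_stdGaussian_norm_iff n (fun s => Real.exp (C * s)) (by fun_prop)]
  exact integrable_exp_mul_chi n C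

/-- The law of the input and the output has a density with respect to the law of the independent
pair of the input and the noise. -/
lemma channelLaw_eq_withDensity (n : ℕ) (P : Measure (Rn n)) [SFinite P] :
    channelLaw n P = (P.prod (stdGaussian (Rn n))).withDensity
      (fun p => ENNReal.ofReal (gaussTilt p.1 p.2)) := by
  refine Measure.ext_of_lintegral _ fun F hF => ?_
  rw [channelLaw, lintegral_map hF (by fun_prop), lintegral_prod _ (by fun_prop),
    lintegral_withDensity_eq_lintegral_mul _ (by fun_prop) hF, lintegral_prod _ (by fun_prop)]
  refine lintegral_congr fun x => ?_
  exact lintegral_stdGaussian_add n x (fun z => F (x, z)) (by fun_prop)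

instance isProbabilityMeasure_channelLaw : IsProbabilityMeasure (channelLaw n P) :=
  Measure.isProbabilityMeasure_map (by fun_prop)

lemma fst_channelLaw (n : ℕ) (P : Measure (Rn n)) [SFinite P] : (channelLaw n P).fst = P := by
  rw [channelLaw, Measure.fst, Measure.map_map (by fun_prop) (by fun_prop)]
  exact Measure.fst_prod

lemma snd_channelLaw (hP : ∀ᵐ x ∂P, ‖x‖ ≤ R) : (channelLaw n P).snd
    = (stdGaussian (Rn n)).withDensity (fun y => ENNReal.ofReal (outDensity P y)) := by
  refine Measure.ext_of_lintegral _ fun F hF => ?_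
  have hm := measurable_outDensity (P := P)
  rw [Measure.snd, lintegral_map hF (by fun_prop), channelLaw_eq_withDensity,
    lintegral_withDensity_eq_lintegral_mul _ (by fun_prop) (by fun_prop),
    lintegral_withDensity_eq_lintegral_mul _ (by fun_prop) hF, lintegral_prod_symm _ (by fun_prop)]
  refine lintegral_congr fun y => ?_
  simp only [Pi.mul_apply]
  rw [lintegral_mul_const, outDensity, ofReal_integral_eq_lintegral_ofReal
    (integrable_gaussTilt hP y) (Filter.Eventually.of_forall fun x => (gaussTilt_pos x y).le)]
  exact (measurable_gaussTilt.comp (measurable_id.prodMk measurable_const)).ennreal_ofReal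

lemma channelLaw_eq_withDensity_prod (hP : ∀ᵐ x ∂P, ‖x‖ ≤ R) :
    channelLaw n P = ((channelLaw n P).fst.prod (channelLaw n P).snd).withDensity
      (fun p => ENNReal.ofReal (gaussTilt p.1 p.2 / outDensity P p.2)) := by
  have hm := measurable_outDensity (P := P)
  have h1 : P.prod (channelLaw n P).snd
      = (P.prod (stdGaussian (Rn n))).withDensity
        (fun p => ENNReal.ofReal (outDensity P p.2)) := by
    rw [snd_channelLaw hP, prod_withDensity_right (by fun_prop)]
  rw [fst_channelLaw, h1, ← withDensity_mul _ (by fun_prop) (by fun_prop)]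
  conv_lhs => rw [channelLaw_eq_withDensity]
  congr 1
  ext p
  rw [Pi.mul_apply, ← ENNReal.ofReal_mul (outDensity_pos hP _).le,
    mul_div_cancel₀ _ (outDensity_pos hP _).ne']

variable [NeZero n]

lemma integrable_comp_add (hP : ∀ᵐ x ∂P, ‖x‖ ≤ R) {g : Rn n → ℝ} (hg : Measurable g) {C : ℝ}
    (hC : ∀ y, |g y| ≤ Real.exp (C * (1 + ‖y‖))) :
    Integrable (fun p : Rn n × Rn n => g (p.1 + p.2)) (P.prod (stdGaussian (Rn n))) := by
  have h : Integrable (fun z => Real.exp (|C| * (1 + R)) * Real.exp (|C| * ‖z‖))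
      (stdGaussian (Rn n)) :=
    (integrable_exp_norm_stdGaussian n |C|).const_mul _
  refine (h.comp_snd P).mono' (hg.comp (measurable_fst.add measurable_snd)).aestronglyMeasurable ?_
  filter_upwards [(Measure.quasiMeasurePreserving_fst (μ := P) (ν := stdGaussian (Rn n))).ae hP]
    with p hp
  refine (hC _).trans ?_
  rw [← Real.exp_add]
  apply Real.exp_le_exp.2
  have h1 := norm_add_le p.1 p.2
  calc C * (1 + ‖p.1 + p.2‖) ≤ |C| * (1 + ‖p.1 + p.2‖) := by gcongr; exact le_abs_self C
    _ ≤ |C| * (1 + (R + ‖p.2‖)) := by gcongr; linarith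
    _ = _ := by ring

/-- The mean of a function of the output. -/
lemma integral_integral_comp_add (hP : ∀ᵐ x ∂P, ‖x‖ ≤ R) {g : Rn n → ℝ} (hg : Measurable g)
    {C : ℝ} (hC : ∀ y, |g y| ≤ Real.exp (C * (1 + ‖y‖))) :
    ∫ x, ∫ z, g (x + z) ∂(stdGaussian (Rn n)) ∂P
      = ∫ y, outDensity P y * g y ∂(stdGaussian (Rn n)) := by
  have hm := measurable_outDensity (P := P)
  rw [← integral_prod _ (integrable_comp_add hP hg hC)]
  have h1 : ∫ p, g (p.1 + p.2) ∂(P.prod (stdGaussian (Rn n))) = ∫ y, g y ∂(channelLaw n P).snd := by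
    rw [channelLaw, Measure.snd, integral_map (by fun_prop) hg.aestronglyMeasurable,
      integral_map (f := fun p : Rn n × Rn n => g p.2) (by fun_prop)
        (hg.comp measurable_snd).aestronglyMeasurable]
  rw [h1, snd_channelLaw hP, integral_withDensity_eq_integral_toReal_smul (by fun_prop) (by simp)]
  simp only [ENNReal.toReal_ofReal (outDensity_pos hP _).le, smul_eq_mul]

lemma integrable_outDensity_mul (hP : ∀ᵐ x ∂P, ‖x‖ ≤ R) {g : Rn n → ℝ} (hg : Measurable g)
    {C : ℝ} (hC : ∀ y, |g y| ≤ Real.exp (C * (1 + ‖y‖))) :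
    Integrable (fun y => outDensity P y * g y) (stdGaussian (Rn n)) := by
  have hm := measurable_outDensity (P := P)
  have h1 : Integrable g (channelLaw n P).snd := by
    rw [channelLaw, Measure.snd, integrable_map_measure hg.aestronglyMeasurable (by fun_prop),
      integrable_map_measure (hg.comp measurable_snd).aestronglyMeasurable (by fun_prop)]
    exact integrable_comp_add hP hg hC
  rw [snd_channelLaw hP,
    integrable_withDensity_iff_integrable_smul' (by fun_prop) (by simp)] at h1
  simpa only [ENNReal.toReal_ofReal (outDensity_pos hP _).le, smul_eq_mul] using h1

lemma integral_outDensity (hP : ∀ᵐ x ∂P, ‖x‖ ≤ R) :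
    ∫ y, outDensity P y ∂(stdGaussian (Rn n)) = 1 := by
  have := integral_integral_comp_add hP (g := fun _ => 1) measurable_const (C := 0) (by simp)
  simpa using this.symm

lemma integrable_outDensity (hP : ∀ᵐ x ∂P, ‖x‖ ≤ R) :
    Integrable (outDensity P) (stdGaussian (Rn n)) := by
  have := integrable_outDensity_mul hP (g := fun _ => 1) measurable_const (C := 0) (by simp)
  simpa using this

/-- The relative entropy of the output law for the input `x` with respect to the output law for
the input law `Q`. -/
noncomputable def infoDensity {n : ℕ} (Q : Measure (Rn n)) (x : Rn n) : ℝ :=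
  ‖x‖ ^ 2 / 2 - ∫ z, Real.log (outDensity Q (x + z)) ∂(stdGaussian (Rn n))

lemma integrable_log_outDensity_add {Q : Measure (Rn n)} [IsProbabilityMeasure Q] (hR : 0 ≤ R)
    (hP : ∀ᵐ x ∂P, ‖x‖ ≤ R) (hQ : ∀ᵐ x ∂Q, ‖x‖ ≤ R) :
    Integrable (fun p : Rn n × Rn n => Real.log (outDensity Q (p.1 + p.2)))
      (P.prod (stdGaussian (Rn n))) :=
  integrable_comp_add (g := fun y => Real.log (outDensity Q y)) hP measurable_outDensity.log
    (abs_log_outDensity_le_exp hR hQ)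

lemma integrable_infoDensity {Q : Measure (Rn n)} [IsProbabilityMeasure Q] (hR : 0 ≤ R)
    (hP : ∀ᵐ x ∂P, ‖x‖ ≤ R) (hQ : ∀ᵐ x ∂Q, ‖x‖ ≤ R) : Integrable (infoDensity Q) P :=
  (integrable_norm_sq hP).sub (integrable_log_outDensity_add hR hP hQ).integral_prod_left

/-- The transmitted information, for a bounded input. -/
lemma inputInfo_eq (hR : 0 ≤ R) (hP : ∀ᵐ x ∂P, ‖x‖ ≤ R) :
    inputInfo n P = ENNReal.ofReal (∫ x, infoDensity P x ∂P) ∧ 0 ≤ ∫ x, infoDensity P x ∂P := by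
  have hm := measurable_outDensity (P := P)
  set ρ := channelLaw n P with hρ
  have hwd := channelLaw_eq_withDensity_prod hP
  rw [← hρ] at hwd
  have hac : ρ ≪ ρ.fst.prod ρ.snd := by
    conv_lhs => rw [hwd]
    exact withDensity_absolutelyContinuous _ _
  have hllr : llr ρ (ρ.fst.prod ρ.snd)
      =ᵐ[ρ] fun p => inner ℝ p.1 p.2 - ‖p.1‖ ^ 2 / 2 - Real.log (outDensity P p.2) := by
    have h := Measure.rnDeriv_withDensity (ρ.fst.prod ρ.snd)
      (f := fun p => ENNReal.ofReal (gaussTilt p.1 p.2 / outDensity P p.2)) (by fun_prop)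
    rw [← hwd] at h
    filter_upwards [hac.ae_le h] with p hp
    have h0 := outDensity_pos hP p.2
    rw [llr, hp, ENNReal.toReal_ofReal (div_nonneg (gaussTilt_pos _ _).le h0.le),
      Real.log_div (gaussTilt_pos _ _).ne' h0.ne', gaussTilt, Real.log_exp]
  have hG : Measurable (fun p : Rn n × Rn n =>
      inner ℝ p.1 p.2 - ‖p.1‖ ^ 2 / 2 - Real.log (outDensity P p.2)) := by
    fun_prop
  have hinner : Integrable (fun p : Rn n × Rn n => inner ℝ p.1 p.2)
      (P.prod (stdGaussian (Rn n))) := by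
    have h : Integrable (fun z => R * Real.exp (1 * ‖z‖)) (stdGaussian (Rn n)) :=
      (integrable_exp_norm_stdGaussian n 1).const_mul R
    refine (h.comp_snd P).mono' (by fun_prop) ?_
    filter_upwards [(Measure.quasiMeasurePreserving_fst (μ := P) (ν := stdGaussian (Rn n))).ae hP]
      with p hp
    refine (abs_real_inner_le_norm _ _).trans ?_
    have := Real.add_one_le_exp (1 * ‖p.2‖)
    exact mul_le_mul hp (by linarith) (norm_nonneg _) hR
  have hform : ∀ p : Rn n × Rn n, (inner ℝ p.1 (p.1 + p.2) - ‖p.1‖ ^ 2 / 2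
      - Real.log (outDensity P (p.1 + p.2)) : ℝ)
      = ‖p.1‖ ^ 2 / 2 + inner ℝ p.1 p.2 - Real.log (outDensity P (p.1 + p.2)) := by
    intro p
    rw [inner_add_right, real_inner_self_eq_norm_sq]
    ring
  have hint' : Integrable (fun p : Rn n × Rn n =>
      ‖p.1‖ ^ 2 / 2 + inner ℝ p.1 p.2 - Real.log (outDensity P (p.1 + p.2)))
      (P.prod (stdGaussian (Rn n))) :=
    (((integrable_norm_sq hP).comp_fst _).add hinner).sub (integrable_log_outDensity_add hR hP hP)
  have hint : Integrable (llr ρ (ρ.fst.prod ρ.snd)) ρ := by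
    rw [integrable_congr hllr, hρ, channelLaw, integrable_map_measure (by fun_prop) (by fun_prop)]
    exact hint'.congr (Filter.Eventually.of_forall fun p => (hform p).symm)
  have hval : ∫ p, llr ρ (ρ.fst.prod ρ.snd) p ∂ρ = ∫ x, infoDensity P x ∂P := by
    rw [integral_congr_ae hllr]
    conv_lhs => rw [hρ, channelLaw]
    rw [integral_map (by fun_prop) (by fun_prop)]
    simp only [hform]
    rw [integral_prod _ hint']
    refine integral_congr_ae ?_
    have h1 := hinner.prod_right_ae
    have h2 := (integrable_log_outDensity_add hR hP hP).prod_right_ae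
    filter_upwards [h1, h2] with x hx1 hx2
    have hx1 : Integrable (fun z => (inner ℝ x z : ℝ)) (stdGaussian (Rn n)) := hx1
    have hx2 : Integrable (fun z => Real.log (outDensity P (x + z))) (stdGaussian (Rn n)) := hx2
    have hzero : ∫ z, (inner ℝ x z : ℝ) ∂(stdGaussian (Rn n)) = 0 := by
      have := integral_stdGaussian_neg n (fun z => (inner ℝ x z : ℝ)) (by fun_prop)
      simp only [inner_neg_right, integral_neg] at this
      linarith
    have e1 : ∫ z, (‖x‖ ^ 2 / 2 + inner ℝ x z : ℝ) ∂(stdGaussian (Rn n)) = ‖x‖ ^ 2 / 2 := by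
      rw [integral_add (integrable_const _) hx1, hzero]
      simp
    have hx3 : Integrable (fun z => (‖x‖ ^ 2 / 2 + inner ℝ x z : ℝ)) (stdGaussian (Rn n)) :=
      (integrable_const _).add hx1
    exact (integral_sub hx3 hx2).trans (by rw [e1, infoDensity])
  have hnn := InformationTheory.integral_llr_add_sub_measure_univ_nonneg hac hint
  rw [inputInfo, mutualInfo, ← hρ, InformationTheory.klDiv_of_ac_of_integrable hac hint, hval]
  rw [hval] at hnn
  simp only [probReal_univ, add_sub_cancel_right] at hnn ⊢
  exact ⟨trivial, hnn⟩

/-- The excess of the mean of `infoDensity Q` over that of `infoDensity P` is the relative entropy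
of the two output laws. -/
lemma integral_infoDensity_sub {Q : Measure (Rn n)} [IsProbabilityMeasure Q] (hR : 0 ≤ R)
    (hP : ∀ᵐ x ∂P, ‖x‖ ≤ R) (hQ : ∀ᵐ x ∂Q, ‖x‖ ≤ R) :
    ∫ x, infoDensity Q x ∂P - ∫ x, infoDensity P x ∂P
      = ∫ y, outDensity P y * (Real.log (outDensity P y)) ∂(stdGaussian (Rn n))
        - ∫ y, outDensity P y * (Real.log (outDensity Q y)) ∂(stdGaussian (Rn n)) := by
  have h1 := integral_integral_comp_add (g := fun y => Real.log (outDensity Q y)) hP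
    measurable_outDensity.log (abs_log_outDensity_le_exp hR hQ)
  have h2 := integral_integral_comp_add (g := fun y => Real.log (outDensity P y)) hP
    measurable_outDensity.log (abs_log_outDensity_le_exp hR hP)
  have i1 := (integrable_log_outDensity_add hR hP hQ).integral_prod_left
  have i2 := (integrable_log_outDensity_add hR hP hP).integral_prod_left
  simp only [infoDensity]
  rw [integral_sub (integrable_norm_sq hP) i1, integral_sub (integrable_norm_sq hP) i2]
  linarith

/-- Replacing the output density in `infoDensity` by that of another input increases its mean. -/
lemma integral_infoDensity_le {Q : Measure (Rn n)} [IsProbabilityMeasure Q] (hR : 0 ≤ R)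
    (hP : ∀ᵐ x ∂P, ‖x‖ ≤ R) (hQ : ∀ᵐ x ∂Q, ‖x‖ ≤ R) :
    ∫ x, infoDensity P x ∂P ≤ ∫ x, infoDensity Q x ∂P := by
  have h := integral_infoDensity_sub hR hP hQ
  have i1 := integrable_outDensity_mul hP (measurable_outDensity (P := P)).log
    (abs_log_outDensity_le_exp hR hP)
  have i2 := integrable_outDensity_mul hP (measurable_outDensity (P := Q)).log
    (abs_log_outDensity_le_exp hR hQ)
  rw [← integral_sub i1 i2] at h
  have hle : ∫ y, (outDensity P y - outDensity Q y) ∂(stdGaussian (Rn n)) ≤ _ :=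
    integral_mono ((integrable_outDensity hP).sub (integrable_outDensity hQ))
      (i1.sub i2) (fun y => ?_)
  · rw [integral_sub (integrable_outDensity hP) (integrable_outDensity hQ),
      integral_outDensity hP, integral_outDensity hQ] at hle
    linarith [hle.trans_eq h.symm]
  · have hp := outDensity_pos hP y
    have hq := outDensity_pos hQ y
    have hlog := Real.log_le_sub_one_of_pos (div_pos hq hp)
    rw [Real.log_div hq.ne' hp.ne'] at hlog
    have e : outDensity P y * (outDensity Q y / outDensity P y) = outDensity Q y := by
      field_simp
    simp only [Pi.sub_apply]
    nlinarith [mul_le_mul_of_nonneg_left hlog hp.le]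

end Bounded

/-! ### The uniform input on a sphere -/

section Sphere

variable (n : ℕ) [NeZero n]

instance isProbabilityMeasure_uniformSphere (R : ℝ) : IsProbabilityMeasure (uniformSphere n R) :=
  Measure.isProbabilityMeasure_map (by fun_prop)

lemma ae_norm_uniformSphere (n : ℕ) {R : ℝ} (hR : 0 ≤ R) : ∀ᵐ x ∂(uniformSphere n R), ‖x‖ = R := by
  rw [uniformSphere, ae_map_iff (by fun_prop)
    (measurableSet_eq_fun (by fun_prop) (by fun_prop))]
  refine Filter.Eventually.of_forall fun u => ?_
  simp [norm_smul, abs_of_nonneg hR]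

lemma outDensity_uniformSphere {R : ℝ} (hR : 0 ≤ R) (y : Rn n) :
    outDensity (uniformSphere n R) y = Real.exp (-R ^ 2 / 2) * sphMgf n (R * ‖y‖) := by
  have hm : Measurable (fun x : Rn n => gaussTilt x y) :=
    measurable_gaussTilt.comp (measurable_id.prodMk measurable_const)
  have h := integral_sphere_exp_inner n (R • y)
  rw [norm_smul, Real.norm_of_nonneg hR] at h
  rw [outDensity, uniformSphere, integral_map (by fun_prop) hm.aestronglyMeasurable, ← h,
    ← integral_const_mul]
  refine integral_congr_ae (Filter.Eventually.of_forall fun u => ?_)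
  have hu : ‖R • (u : Rn n)‖ = R := by simp [norm_smul, abs_of_nonneg hR]
  simp only [gaussTilt]
  rw [hu, ← Real.exp_add, real_inner_smul_left, real_inner_smul_left, real_inner_comm]
  ring_nf

lemma log_sphMgf_nonneg (x : ℝ) : 0 ≤ Real.log (sphMgf n x) := Real.log_nonneg (one_le_sphMgf n x)

lemma log_sphMgf_le {x : ℝ} (hx : 0 ≤ x) : Real.log (sphMgf n x) ≤ x :=
  (Real.log_le_iff_le_exp (sphMgf_pos n x)).2 (sphMgf_le_exp n hx)

@[fun_prop]
lemma continuous_log_sphMgf : Continuous (fun x => Real.log (sphMgf n x)) :=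
  (continuous_sphMgf n).log fun x => (sphMgf_pos n x).ne'

lemma expGrowth_sphMgf {r : ℝ} (hr : 0 ≤ r) : ExpGrowth (fun s => sphMgf n (r * s)) :=
  (ExpGrowth.exp r).of_abs_le fun s hs => by
    rw [abs_of_pos (sphMgf_pos n _), abs_of_pos (Real.exp_pos _)]
    exact sphMgf_le_exp n (by positivity)

lemma expGrowth_log_sphMgf {R : ℝ} (hR : 0 ≤ R) :
    ExpGrowth (fun s => Real.log (sphMgf n (R * s))) :=
  ((ExpGrowth.const R).mul ExpGrowth.id).of_abs_le fun s hs => by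
    rw [abs_of_nonneg (log_sphMgf_nonneg n _), abs_of_nonneg (by positivity)]
    exact log_sphMgf_le n (by positivity)

/-- The density `s ↦ exp (-r² / 2) Φ(r s)` of the noncentral laws of the norm integrates to one. -/
lemma integral_chi_exp_mul_sphMgf {r : ℝ} (hr : 0 ≤ r) :
    ∫ s, Real.exp (-r ^ 2 / 2) * sphMgf n (r * s) ∂(chi n) = 1 := by
  have h := integral_stdGaussian_norm_add n (EuclideanSpace.single ⟨0, Nat.pos_of_ne_zero
    (NeZero.ne n)⟩ r) (fun _ => 1) measurable_const (ExpGrowth.const 1)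
  simp only [PiLp.norm_single, Real.norm_of_nonneg hr, one_mul] at h
  rw [← h]
  simp

/-- The value of `infoDensity` for the uniform input on the sphere of radius `R` at the points of
norm `r`. -/
noncomputable def sphProfile (R r : ℝ) : ℝ :=
  r ^ 2 / 2 + R ^ 2 / 2
    - ∫ s, Real.exp (-r ^ 2 / 2) * (Real.log (sphMgf n (R * s)) * sphMgf n (r * s)) ∂(chi n)

lemma infoDensity_uniformSphere {R : ℝ} (hR : 0 ≤ R) (x : Rn n) :
    infoDensity (uniformSphere n R) x = sphProfile n R ‖x‖ := by
  have hlog : ∀ y : Rn n, Real.log (outDensity (uniformSphere n R) y)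
      = -R ^ 2 / 2 + Real.log (sphMgf n (R * ‖y‖)) := fun y => by
    rw [outDensity_uniformSphere n hR, Real.log_mul (Real.exp_pos _).ne' (sphMgf_pos n _).ne',
      Real.log_exp]
  have hint : Integrable (fun z => Real.log (sphMgf n (R * ‖x + z‖))) (stdGaussian (Rn n)) := by
    have h := integrable_comp_add (P := Measure.dirac x) (R := ‖x‖) (n := n) (by simp)
      (g := fun y => Real.log (sphMgf n (R * ‖y‖))) (by fun_prop) (C := R) (fun y => by
        rw [abs_of_nonneg (log_sphMgf_nonneg n _)]
        refine (log_sphMgf_le n (by positivity)).trans ?_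
        have := Real.add_one_le_exp (R * (1 + ‖y‖))
        linarith)
    rw [integrable_prod_iff h.aestronglyMeasurable] at h
    simpa using h.1
  simp only [infoDensity, hlog]
  rw [integral_add (integrable_const _) hint,
    integral_stdGaussian_norm_add n x (fun s => Real.log (sphMgf n (R * s))) (by fun_prop)
      (expGrowth_log_sphMgf n hR), sphProfile]
  simp
  ring

lemma uniformSphere_mem_ballInputs {R : ℝ} (hR : 0 ≤ R) : uniformSphere n R ∈ ballInputs n R := by
  refine ⟨inferInstance, ?_⟩
  filter_upwards [ae_norm_uniformSphere n hR] with x hx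
  simp [hx]

lemma integral_infoDensity_uniformSphere {R : ℝ} (hR : 0 ≤ R) :
    ∫ x, infoDensity (uniformSphere n R) x ∂(uniformSphere n R) = sphProfile n R R := by
  rw [integral_congr_ae (g := fun _ => sphProfile n R R)]
  · simp
  · filter_upwards [ae_norm_uniformSphere n hR] with x hx
    rw [infoDensity_uniformSphere n hR, hx]

/-- If `infoDensity` of the uniform input is maximal on the sphere, then this input is optimal. -/
lemma isCapacityAchieving_of_sphProfile_le {R : ℝ} (hR : 0 ≤ R)
    (h : ∀ r, 0 ≤ r → r ≤ R → sphProfile n R r ≤ sphProfile n R R) :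
    IsCapacityAchieving n R (uniformSphere n R) := by
  refine ⟨uniformSphere_mem_ballInputs n hR, fun P hP => ?_⟩
  have hprob := hP.1
  have hPR : ∀ᵐ x ∂P, ‖x‖ ≤ R := by simpa using hP.2
  have hQR : ∀ᵐ x ∂(uniformSphere n R), ‖x‖ ≤ R := (ae_norm_uniformSphere n hR).mono fun x hx => hx.le
  rw [(inputInfo_eq hR hPR).1, (inputInfo_eq hR hQR).1, integral_infoDensity_uniformSphere n hR]
  refine ENNReal.ofReal_le_ofReal ((integral_infoDensity_le hR hPR hQR).trans ?_)
  have := integral_mono_ae (integrable_infoDensity hR hPR hQR)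
    (integrable_const (sphProfile n R R)) (hPR.mono fun x hx => by
      rw [infoDensity_uniformSphere n hR]
      exact h _ (norm_nonneg x) hx)
  simpa using this

/-- The mixture of an input law with the constant input `0`. -/
noncomputable def mixZero {n : ℕ} (Q : Measure (Rn n)) (ε : ℝ) : Measure (Rn n) :=
  ENNReal.ofReal (1 - ε) • Q + ENNReal.ofReal ε • Measure.dirac 0

lemma isProbabilityMeasure_mixZero (n : ℕ) (Q : Measure (Rn n)) [IsProbabilityMeasure Q] {ε : ℝ}
    (h0 : 0 ≤ ε) (h1 : ε ≤ 1) : IsProbabilityMeasure (mixZero Q ε) := by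
  constructor
  simp only [mixZero, Measure.add_apply, Measure.smul_apply, measure_univ, smul_eq_mul, mul_one]
  rw [← ENNReal.ofReal_add (by linarith) h0]
  simp

lemma integral_mixZero (n : ℕ) (Q : Measure (Rn n)) [IsProbabilityMeasure Q] {ε : ℝ}
    (h0 : 0 ≤ ε) (h1 : ε ≤ 1) {f : Rn n → ℝ} (hf : Integrable f Q) :
    ∫ x, f x ∂(mixZero Q ε) = (1 - ε) * ∫ x, f x ∂Q + ε * f 0 := by
  rw [mixZero, integral_add_measure (hf.smul_measure (by simp))
    ((integrable_dirac (by simp)).smul_measure (by simp)), integral_smul_measure,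
    integral_smul_measure, integral_dirac, ENNReal.toReal_ofReal (by linarith),
    ENNReal.toReal_ofReal h0]
  simp

/-- When a mass `ε` moves from the uniform input to the center, the information changes to first
order as the mean of `infoDensity`; the second-order loss is a relative entropy of output laws,
bounded by their `χ²`-divergence, hence by `ε² exp (R² / 2)`. -/
lemma integral_infoDensity_mixZero_ge {R ε : ℝ} (hR : 0 ≤ R) (h0 : 0 ≤ ε) (h1 : ε ≤ 1) :
    (1 - ε) * sphProfile n R R + ε * sphProfile n R 0 - ε ^ 2 * Real.exp (R ^ 2 / 2)
      ≤ ∫ x, infoDensity (mixZero (uniformSphere n R) ε) x ∂(mixZero (uniformSphere n R) ε) := by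
  set Q := uniformSphere n R with hQ
  set P := mixZero Q ε with hP
  have hprob : IsProbabilityMeasure P := isProbabilityMeasure_mixZero n Q h0 h1
  have hQR : ∀ᵐ x ∂Q, ‖x‖ ≤ R := (ae_norm_uniformSphere n hR).mono fun x hx => hx.le
  have hPR : ∀ᵐ x ∂P, ‖x‖ ≤ R := by
    rw [hP, mixZero, ae_add_measure_iff]
    refine ⟨Measure.ae_smul_measure hQR _, Measure.ae_smul_measure ?_ _⟩
    rw [ae_dirac_eq]
    simpa using hR
  have hmean : ∫ x, infoDensity Q x ∂P = (1 - ε) * sphProfile n R R + ε * sphProfile n R 0 := by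
    rw [hP, integral_mixZero n Q h0 h1 (integrable_infoDensity hR hQR hQR),
      integral_infoDensity_uniformSphere n hR, infoDensity_uniformSphere n hR, norm_zero]
  have hout : ∀ y, outDensity P y = (1 - ε) * outDensity Q y + ε := by
    intro y
    rw [outDensity, hP, integral_mixZero n Q h0 h1 (integrable_gaussTilt hQR y)]
    simp [outDensity, gaussTilt]
  have h := integral_infoDensity_sub hR hPR hQR
  have i1 := integrable_outDensity_mul hPR (measurable_outDensity (P := P)).log
    (abs_log_outDensity_le_exp hR hPR)
  have i2 := integrable_outDensity_mul hPR (measurable_outDensity (P := Q)).log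
    (abs_log_outDensity_le_exp hR hQR)
  rw [← integral_sub i1 i2, hmean] at h
  have i3 : Integrable (fun y => ε * (1 - ε) * (1 - outDensity Q y)) (stdGaussian (Rn n)) :=
    ((integrable_const 1).sub (integrable_outDensity hQR)).const_mul _
  have hle : ∫ y, (outDensity P y * Real.log (outDensity P y)
        - outDensity P y * Real.log (outDensity Q y)) ∂(stdGaussian (Rn n))
      ≤ ∫ y, (ε * (1 - ε) * (1 - outDensity Q y) + ε ^ 2 * Real.exp (R ^ 2 / 2))
          ∂(stdGaussian (Rn n)) := by
    refine integral_mono (i1.sub i2) (i3.add (integrable_const _)) fun y => ?_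
    have hp := outDensity_pos hPR y
    have hq := outDensity_pos hQR y
    -- the relative entropy is at most the `χ²`-divergence
    have hlog := Real.log_le_sub_one_of_pos (div_pos hp hq)
    rw [Real.log_div hp.ne' hq.ne'] at hlog
    have hinv : 1 / outDensity Q y ≤ Real.exp (R ^ 2 / 2) := by
      rw [hQ, outDensity_uniformSphere n hR, div_le_iff₀ (mul_pos (Real.exp_pos _) (sphMgf_pos n _)),
        ← mul_assoc, ← Real.exp_add, show R ^ 2 / 2 + -R ^ 2 / 2 = 0 by ring, Real.exp_zero, one_mul]
      exact one_le_sphMgf n _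
    calc outDensity P y * Real.log (outDensity P y) - outDensity P y * Real.log (outDensity Q y)
        = outDensity P y * (Real.log (outDensity P y) - Real.log (outDensity Q y)) := by ring
      _ ≤ outDensity P y * (outDensity P y / outDensity Q y - 1) :=
          mul_le_mul_of_nonneg_left hlog hp.le
      _ = ε * (1 - ε) * (1 - outDensity Q y) + ε ^ 2 * (1 / outDensity Q y - 1) := by
          rw [hout]; field_simp; ring
      _ ≤ _ := by
          gcongr
          linarith
  rw [integral_add i3 (integrable_const _), integral_const_mul,
    integral_sub (integrable_const _) (integrable_outDensity hQR), integral_outDensity hQR] at hle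
  simp only [integral_const, probReal_univ, smul_eq_mul, one_mul, sub_self, mul_zero, zero_add] at hle
  linarith

/-- If the uniform input is optimal, then `infoDensity` is not larger at the center than on the
sphere: otherwise it would pay to move a small mass to the center. -/
lemma sphProfile_zero_le_of_isCapacityAchieving {R : ℝ} (hR : 0 ≤ R)
    (h : IsCapacityAchieving n R (uniformSphere n R)) : sphProfile n R 0 ≤ sphProfile n R R := by
  by_contra! hlt
  set δ := sphProfile n R 0 - sphProfile n R R with hδ
  have hδ0 : 0 < δ := by linarith
  set K := Real.exp (R ^ 2 / 2) with hK
  have hK0 : 0 < K := Real.exp_pos _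
  -- a mass for which the first-order gain `ε δ` exceeds the second-order loss `ε² K`
  set ε := δ / (2 * (K + δ)) with hε
  have he0 : 0 < ε := by positivity
  have he1 : ε ≤ 1 := by rw [hε, div_le_one (by positivity)]; linarith
  have heK : ε * K < δ := by
    rw [hε, div_mul_eq_mul_div, div_lt_iff₀ (by positivity)]
    nlinarith
  have hprob := isProbabilityMeasure_mixZero n (uniformSphere n R) he0.le he1
  have hQR : ∀ᵐ x ∂(uniformSphere n R), ‖x‖ ≤ R :=
    (ae_norm_uniformSphere n hR).mono fun x hx => hx.le
  have hPR : ∀ᵐ x ∂(mixZero (uniformSphere n R) ε), ‖x‖ ≤ R := by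
    rw [mixZero, ae_add_measure_iff]
    refine ⟨Measure.ae_smul_measure hQR _, Measure.ae_smul_measure ?_ _⟩
    rw [ae_dirac_eq]
    simpa using hR
  have hle := h.2 (mixZero (uniformSphere n R) ε) ⟨hprob, by simpa using hPR⟩
  obtain ⟨e1, p1⟩ := inputInfo_eq hR hPR
  obtain ⟨e2, p2⟩ := inputInfo_eq hR hQR
  rw [e1, e2, ENNReal.ofReal_le_ofReal_iff p2, integral_infoDensity_uniformSphere n hR] at hle
  have hge := integral_infoDensity_mixZero_ge n hR he0.le he1
  nlinarith [mul_lt_mul_of_pos_left heK he0]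

end Sphere

/-! ### Integrals depending on a parameter -/

section Parameter

variable (n : ℕ) [NeZero n]

lemma sphMgf_neg (n : ℕ) (x : ℝ) : sphMgf n (-x) = sphMgf n x := by
  unfold sphMgf
  simp only [pow_mul, neg_sq]

lemma sphMgfDeriv_neg (n : ℕ) (x : ℝ) : sphMgfDeriv n (-x) = -sphMgfDeriv n x := by
  unfold sphMgfDeriv
  rw [sphMgf_neg]
  ring

lemma sphMgf_le_exp_abs (x : ℝ) : sphMgf n x ≤ Real.exp |x| := by
  rcases abs_choice x with h | h
  · rw [h]; exact sphMgf_le_exp n (h ▸ abs_nonneg x)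
  · rw [h, ← sphMgf_neg]; exact sphMgf_le_exp n (h ▸ abs_nonneg x)

lemma abs_sphMgfDeriv_le (x : ℝ) : |sphMgfDeriv n x| ≤ sphMgf n x := by
  have key : ∀ y, 0 ≤ y → |sphMgfDeriv n y| ≤ sphMgf n y := fun y hy => by
    refine abs_le_of_sq_le_sq ?_ (sphMgf_pos n y).le
    linarith [one_le_sphMgf_sq_sub n hy]
  rcases le_total 0 x with h | h
  · exact key x h
  · have := key (-x) (by linarith)
    rwa [sphMgfDeriv_neg, abs_neg, sphMgf_neg] at this

lemma abs_sphRatio_le_one (x : ℝ) : |sphRatio n x| ≤ 1 := by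
  rw [sphRatio, abs_div, abs_of_pos (sphMgf_pos n x), div_le_one (sphMgf_pos n x)]
  exact abs_sphMgfDeriv_le n x

lemma log_sphMgf_le_abs (x : ℝ) : Real.log (sphMgf n x) ≤ |x| :=
  (Real.log_le_iff_le_exp (sphMgf_pos n x)).2 (sphMgf_le_exp_abs n x)

lemma hasDerivAt_log_sphMgf (x : ℝ) :
    HasDerivAt (fun x => Real.log (sphMgf n x)) (sphRatio n x) x :=
  (hasDerivAt_sphMgf n x).log (sphMgf_pos n x).ne'

lemma abs_mul_le_of_abs_sub_lt {r r' s : ℝ} (h : |r' - r| < 1) (hs : 0 < s) :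
    |r' * s| ≤ (|r| + 1) * s := by
  rw [abs_mul, abs_of_pos hs]
  have : |r'| ≤ |r| + 1 := by
    have := abs_add_le (r' - r) r
    rw [sub_add_cancel] at this
    linarith
  gcongr

/-- Differentiation under the integral sign. -/
lemma hasDerivAt_integral_chi {F F' : ℝ → ℝ → ℝ} {r : ℝ} {g : ℝ → ℝ}
    (hF : ∀ r', Measurable (F r')) (hF' : Measurable (F' r)) (hi : Integrable (F r) (chi n))
    (hg : ExpGrowth g) (hgm : Measurable g)
    (hb : ∀ r' s, |r' - r| < 1 → 0 < s → |F' r' s| ≤ g s)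
    (hd : ∀ r' s, HasDerivAt (fun x => F x s) (F' r' s) r') :
    HasDerivAt (fun x => ∫ s, F x s ∂(chi n)) (∫ s, F' r s ∂(chi n)) r := by
  refine (hasDerivAt_integral_of_dominated_loc_of_deriv_le (s := Metric.ball r 1) (bound := g)
    (Metric.ball_mem_nhds r one_pos)
    (Filter.Eventually.of_forall fun r' => (hF r').aestronglyMeasurable) hi
    hF'.aestronglyMeasurable ?_ (hg.integrable_chi n hgm.aestronglyMeasurable)
    (Filter.Eventually.of_forall fun s r' _ => hd r' s)).2
  filter_upwards [ae_chi_pos n] with s hs r' hr'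
  exact hb r' s (by simpa [Real.dist_eq] using hr') hs

lemma hasDerivAt_integral_mul_sphMgf {f : ℝ → ℝ} (hf : ExpGrowth f) (hfm : Measurable f) (r : ℝ) :
    HasDerivAt (fun r => ∫ s, f s * sphMgf n (r * s) ∂(chi n))
      (∫ s, f s * (s * sphMgfDeriv n (r * s)) ∂(chi n)) r := by
  have hbd : ∀ r' s, |r' - r| < 1 → 0 < s → sphMgf n (r' * s) ≤ Real.exp ((|r| + 1) * s) :=
    fun r' s h hs => (sphMgf_le_exp_abs n _).trans
      (Real.exp_le_exp.2 (abs_mul_le_of_abs_sub_lt h hs))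
  have hg : ExpGrowth (fun s => |f s| * (|s| * Real.exp ((|r| + 1) * s))) := by
    refine (hf.mul (ExpGrowth.id.mul (ExpGrowth.exp (|r| + 1)))).of_abs_le fun s hs => ?_
    simp [abs_mul]
  refine hasDerivAt_integral_chi n (g := fun s => |f s| * (|s| * Real.exp ((|r| + 1) * s)))
    (F := fun r s => f s * sphMgf n (r * s)) (F' := fun r s => f s * (s * sphMgfDeriv n (r * s)))
    (fun r' => by fun_prop) (by fun_prop) ?_ hg (by fun_prop) ?_ ?_
  · refine ExpGrowth.integrable_chi ?_ n (by fun_prop)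
    refine hf.mul ((ExpGrowth.exp (|r| + 1)).of_abs_le fun s hs => ?_)
    rw [abs_of_pos (sphMgf_pos n _), abs_of_pos (Real.exp_pos _)]
    exact hbd r s (by simp) hs
  · intro r' s h hs
    rw [abs_mul, abs_mul]
    have := (abs_sphMgfDeriv_le n (r' * s)).trans (hbd r' s h hs)
    gcongr
  · intro r' s
    have h1 : HasDerivAt (fun x : ℝ => x * s) s r' := by simpa using (hasDerivAt_id r').mul_const s
    convert! ((hasDerivAt_sphMgf n (r' * s)).comp r' h1).const_mul (f s) using 1
    unfold sphMgfDeriv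
    ring

/-- Stein's identity for the function `s ↦ f s * Φ'(r s)`. -/
lemma integral_chi_stein_sphMgfDeriv {f f' : ℝ → ℝ} {r : ℝ} (hr : 0 ≤ r)
    (hf : ∀ s, HasDerivAt f (f' s) s) (hfg : ExpGrowth f) (hfg' : ExpGrowth f')
    (hfm' : Measurable f') :
    ∫ s, f s * (s * sphMgfDeriv n (r * s)) ∂(chi n)
      = r * ∫ s, f s * sphMgf n (r * s) ∂(chi n) + ∫ s, f' s * sphMgfDeriv n (r * s) ∂(chi n) := by
  have h0 := natCast_pos_of_neZero n
  have hfc : Continuous f := continuous_iff_continuousAt.2 fun x => (hf x).continuousAt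
  have hΦ := expGrowth_sphMgf n hr
  have hΦ' : ExpGrowth (fun s => sphMgfDeriv n (r * s)) := hΦ.of_abs_le fun s hs => by
    rw [abs_of_pos (sphMgf_pos n _)]; exact abs_sphMgfDeriv_le n _
  have i1 : Integrable (fun s => f s * (s * sphMgfDeriv n (r * s))) (chi n) :=
    (hfg.mul (ExpGrowth.id.mul hΦ')).integrable_chi n (by fun_prop)
  have i2 : Integrable (fun s => f s * sphMgf n (r * s)) (chi n) :=
    (hfg.mul hΦ).integrable_chi n (by fun_prop)
  have i3 : Integrable (fun s => f' s * sphMgfDeriv n (r * s)) (chi n) :=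
    (hfg'.mul hΦ').integrable_chi n (by fun_prop)
  have hform : ∀ s, 0 < s →
      (f' s * sphMgfDeriv n (r * s)
        + f s * (r * (sphMgf n (r * s) - (n - 1) * (sphMgf (n + 2) (r * s) / n))))
        + (n - 1) * (f s * sphMgfDeriv n (r * s) / s) - s * (f s * sphMgfDeriv n (r * s))
      = f' s * sphMgfDeriv n (r * s) + r * (f s * sphMgf n (r * s))
        - f s * (s * sphMgfDeriv n (r * s)) := by
    intro s hs
    unfold sphMgfDeriv
    field_simp
    ring
  have hae := (ae_chi_pos n).mono hform
  have h := integral_chi_stein n (u := fun s => f s * sphMgfDeriv n (r * s))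
    (v := fun s => f' s * sphMgfDeriv n (r * s)
      + f s * (r * (sphMgf n (r * s) - (n - 1) * (sphMgf (n + 2) (r * s) / n))))
    (fun s _ => ?_) (by fun_prop) (by simp [sphMgfDeriv]) (hfg.mul hΦ')
    (((i3.add (i2.const_mul r)).sub i1).congr (hae.mono fun s hs => hs.symm))
  · have i4 : Integrable (fun s => f' s * sphMgfDeriv n (r * s) + r * (f s * sphMgf n (r * s)))
      (chi n) := i3.add (i2.const_mul r)
    rw [integral_congr_ae hae, integral_sub i4 i1, integral_add i3 (i2.const_mul r),
      integral_const_mul] at h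
    linarith
  · have h1 : HasDerivAt (fun x : ℝ => r * x) r s := by simpa using (hasDerivAt_id s).const_mul r
    convert! (hf s).mul ((hasDerivAt_sphMgfDeriv n (r * s)).comp s h1) using 1
    simp only [Function.comp_apply]
    ring

/-- The derivative in `r` of the mean of `f` under the noncentral law of the norm. -/
lemma hasDerivAt_noncentral {f f' : ℝ → ℝ} {r : ℝ} (hr : 0 ≤ r)
    (hf : ∀ s, HasDerivAt f (f' s) s) (hfg : ExpGrowth f) (hfg' : ExpGrowth f')
    (hfm' : Measurable f') :
    HasDerivAt (fun r => ∫ s, Real.exp (-r ^ 2 / 2) * (f s * sphMgf n (r * s)) ∂(chi n))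
      (∫ s, Real.exp (-r ^ 2 / 2) * (f' s * sphMgfDeriv n (r * s)) ∂(chi n)) r := by
  have hfc : Continuous f := continuous_iff_continuousAt.2 fun x => (hf x).continuousAt
  simp only [integral_const_mul]
  have h1 : HasDerivAt (fun r : ℝ => Real.exp (-r ^ 2 / 2)) (Real.exp (-r ^ 2 / 2) * (-r)) r := by
    convert! (((hasDerivAt_id r).pow 2).neg.div_const 2).exp using 1
    simp; ring
  convert! h1.mul (hasDerivAt_integral_mul_sphMgf n hfg hfc.measurable r) using 1
  rw [integral_chi_stein_sphMgfDeriv n hr hf hfg hfg' hfm']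
  ring

/-! ### Stochastic monotonicity -/

/-- The noncentral laws of the norm have a monotone likelihood ratio: `log Φ(r₂ s) - log Φ(r₁ s)`
is nondecreasing in `s`, because `x ↦ x h(x)` is. -/
lemma sphMgf_mul_le_mul {r₁ r₂ t s : ℝ} (hr₁ : 0 ≤ r₁) (hr : r₁ ≤ r₂) (ht : 0 ≤ t) (hts : t ≤ s) :
    sphMgf n (r₁ * s) * sphMgf n (r₂ * t) ≤ sphMgf n (r₂ * s) * sphMgf n (r₁ * t) := by
  have hmono : MonotoneOn
      (fun s => Real.log (sphMgf n (r₂ * s)) - Real.log (sphMgf n (r₁ * s))) (Set.Ici 0) := by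
    refine monotoneOn_of_hasDerivWithinAt_nonneg (convex_Ici 0)
      (((continuous_log_sphMgf n).comp (continuous_const_mul r₂)).sub
        ((continuous_log_sphMgf n).comp (continuous_const_mul r₁))).continuousOn
      (f' := fun s => sphRatio n (r₂ * s) * r₂ - sphRatio n (r₁ * s) * r₁)
      (fun y _ => ?_) fun y hy => ?_
    · have h : ∀ r : ℝ, HasDerivAt (fun x : ℝ => r * x) r y := fun r => by
        simpa using (hasDerivAt_id y).const_mul r
      exact (((hasDerivAt_log_sphMgf n (r₂ * y)).comp y (h r₂)).sub
        ((hasDerivAt_log_sphMgf n (r₁ * y)).comp y (h r₁))).hasDerivWithinAt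
    · rw [interior_Ici] at hy
      have hy : 0 < y := hy
      have h1 : 0 ≤ r₁ * y := by positivity
      have h2 : r₁ * y ≤ r₂ * y := by gcongr
      have h3 := (strictMonoOn_sphRatio n).monotoneOn h1 (h1.trans h2) h2
      have h4 := sphRatio_nonneg n h1
      have : sphRatio n (r₁ * y) * r₁ ≤ sphRatio n (r₂ * y) * r₂ := by
        apply mul_le_mul h3 hr hr₁ (h4.trans h3)
      linarith
  have h := hmono (Set.mem_Ici.2 ht) (Set.mem_Ici.2 (ht.trans hts)) hts
  have p := sphMgf_pos n
  have h' : Real.log (sphMgf n (r₁ * s) * sphMgf n (r₂ * t))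
      ≤ Real.log (sphMgf n (r₂ * s) * sphMgf n (r₁ * t)) := by
    rw [Real.log_mul (p _).ne' (p _).ne', Real.log_mul (p _).ne' (p _).ne']
    simp only at h
    linarith
  exact (Real.log_le_log_iff (mul_pos (p _) (p _)) (mul_pos (p _) (p _))).1 h'

/-- A monotone likelihood ratio implies stochastic monotonicity: with two independent copies `s`, `t`
of the variable, `(f s - f t) (q₂ s q₁ t - q₁ s q₂ t)` is nonnegative and has twice the difference of
the means as its integral. -/
lemma integral_mul_le_of_likelihoodRatio (n : ℕ) {q₁ q₂ f : ℝ → ℝ} (hf : MonotoneOn f (Set.Ioi 0))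
    (hq : ∀ t s, 0 < t → t ≤ s → q₁ s * q₂ t ≤ q₂ s * q₁ t)
    (i₁ : Integrable q₁ (chi n)) (i₂ : Integrable q₂ (chi n))
    (j₁ : Integrable (fun s => f s * q₁ s) (chi n)) (j₂ : Integrable (fun s => f s * q₂ s) (chi n))
    (h₁ : ∫ s, q₁ s ∂(chi n) = 1) (h₂ : ∫ s, q₂ s ∂(chi n) = 1) :
    ∫ s, f s * q₁ s ∂(chi n) ≤ ∫ s, f s * q₂ s ∂(chi n) := by
  have hnn : 0 ≤ ∫ p : ℝ × ℝ, ((f p.1 * q₂ p.1) * q₁ p.2 + q₁ p.1 * (f p.2 * q₂ p.2))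
      - ((f p.1 * q₁ p.1) * q₂ p.2 + q₂ p.1 * (f p.2 * q₁ p.2)) ∂((chi n).prod (chi n)) := by
    apply integral_nonneg_of_ae
    filter_upwards [(Measure.quasiMeasurePreserving_fst (μ := chi n) (ν := chi n)).ae (ae_chi_pos n),
      (Measure.quasiMeasurePreserving_snd (μ := chi n) (ν := chi n)).ae (ae_chi_pos n)]
      with p hp1 hp2
    have e : ((f p.1 * q₂ p.1) * q₁ p.2 + q₁ p.1 * (f p.2 * q₂ p.2))
      - ((f p.1 * q₁ p.1) * q₂ p.2 + q₂ p.1 * (f p.2 * q₁ p.2))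
      = (f p.1 - f p.2) * (q₂ p.1 * q₁ p.2 - q₁ p.1 * q₂ p.2) := by ring
    simp only [Pi.zero_apply]
    rw [e]
    rcases le_total p.1 p.2 with h | h
    · apply mul_nonneg_of_nonpos_of_nonpos
      · linarith [hf hp1 hp2 h]
      · have := hq _ _ hp1 h
        linarith
    · apply mul_nonneg
      · linarith [hf hp2 hp1 h]
      · have := hq _ _ hp2 h
        linarith
  have k₁ : Integrable (fun p : ℝ × ℝ => (f p.1 * q₂ p.1) * q₁ p.2 + q₁ p.1 * (f p.2 * q₂ p.2))
      ((chi n).prod (chi n)) := (j₂.mul_prod i₁).add (i₁.mul_prod j₂)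
  have k₂ : Integrable (fun p : ℝ × ℝ => (f p.1 * q₁ p.1) * q₂ p.2 + q₂ p.1 * (f p.2 * q₁ p.2))
      ((chi n).prod (chi n)) := (j₁.mul_prod i₂).add (i₂.mul_prod j₁)
  rw [integral_sub k₁ k₂,
    integral_add (j₂.mul_prod i₁) (i₁.mul_prod j₂), integral_add (j₁.mul_prod i₂) (i₂.mul_prod j₁),
    integral_prod_mul (fun s => f s * q₂ s), integral_prod_mul q₁ (fun s => f s * q₂ s),
    integral_prod_mul (fun s => f s * q₁ s), integral_prod_mul q₂ (fun s => f s * q₁ s),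
    h₁, h₂] at hnn
  linarith

/-! ### The shape of the profile -/

/-- The density, with respect to `chi n`, of the law of the norm of a noncentral Gaussian vector in
`ℝⁿ⁺²` whose mean has norm `r`. -/
noncomputable def shiftedDensity (r s : ℝ) : ℝ :=
  Real.exp (-r ^ 2 / 2) * (s ^ 2 * (sphMgf (n + 2) (r * s) / n))

lemma expGrowth_shiftedDensity (n : ℕ) {r : ℝ} (hr : 0 ≤ r) : ExpGrowth (shiftedDensity n r) := by
  have h := (ExpGrowth.const (Real.exp (-r ^ 2 / 2))).mul
    ((ExpGrowth.id.pow 2).mul ((expGrowth_sphMgf (n + 2) hr).mul (ExpGrowth.const (1 / n))))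
  have h' : ExpGrowth (fun s => shiftedDensity n r s) := by
    simpa only [mul_one_div, shiftedDensity] using h
  exact h'

@[fun_prop]
lemma continuous_shiftedDensity (n : ℕ) [NeZero n] (r : ℝ) : Continuous (shiftedDensity n r) := by
  unfold shiftedDensity; fun_prop

lemma shiftedDensity_nonneg (n : ℕ) (r s : ℝ) : 0 ≤ shiftedDensity n r s := by
  have := sphMgf_pos (n + 2) (r * s)
  unfold shiftedDensity; positivity

lemma integral_shiftedDensity {r : ℝ} (hr : 0 < r) : ∫ s, shiftedDensity n r s ∂(chi n) = 1 := by
  have h0 := natCast_pos_of_neZero n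
  have h := integral_chi_stein_sphMgfDeriv n hr.le (f := fun _ => 1) (f' := fun _ => 0)
    (fun s => hasDerivAt_const s 1) (ExpGrowth.const 1) (ExpGrowth.const 0) measurable_const
  have h1 := integral_chi_exp_mul_sphMgf n hr.le
  simp only [one_mul, zero_mul, integral_zero, add_zero] at h
  rw [integral_const_mul] at h1
  have e : ∀ s, shiftedDensity n r s
      = Real.exp (-r ^ 2 / 2) * (1 / r) * (s * sphMgfDeriv n (r * s)) := by
    intro s
    unfold shiftedDensity sphMgfDeriv
    field_simp
  simp only [e]
  rw [integral_const_mul, h, mul_assoc, ← mul_assoc (1 / r), one_div_mul_cancel hr.ne', one_mul, h1]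

/-- The mean of `h(R s) / (R s)` with respect to `shiftedDensity n r`. -/
noncomputable def slopeMean (R r : ℝ) : ℝ := ∫ s, sphSlope n (R * s) * shiftedDensity n r s ∂(chi n)

lemma integrable_slopeMean {R r : ℝ} (hR : 0 ≤ R) (hr : 0 ≤ r) :
    Integrable (fun s => sphSlope n (R * s) * shiftedDensity n r s) (chi n) := by
  refine ExpGrowth.integrable_chi (ExpGrowth.mul ?_ (expGrowth_shiftedDensity n hr)) n (by fun_prop)
  refine (ExpGrowth.const (1 / n)).of_abs_le fun s hs => ?_
  rw [abs_of_pos (sphSlope_pos n _)]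
  exact (sphSlope_le n (by positivity)).trans (le_abs_self _)

lemma slopeMean_le {R r : ℝ} (hR : 0 ≤ R) (hr : 0 < r) : slopeMean n R r ≤ 1 / n := by
  have i := (expGrowth_shiftedDensity n hr.le).integrable_chi n (by fun_prop)
  calc slopeMean n R r ≤ ∫ s, 1 / n * shiftedDensity n r s ∂(chi n) := by
        refine integral_mono_ae (integrable_slopeMean n hR hr.le) (i.const_mul _) ?_
        filter_upwards [ae_chi_pos n] with s hs
        exact mul_le_mul_of_nonneg_right (sphSlope_le n (by positivity))
          (shiftedDensity_nonneg n r s)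
    _ = 1 / n := by rw [integral_const_mul, integral_shiftedDensity n hr, mul_one]

/-- `h(x) / x` is nonincreasing and the laws `shiftedDensity n r` increase stochastically with `r`. -/
lemma slopeMean_anti {R r₁ r₂ : ℝ} (hR : 0 ≤ R) (hr₁ : 0 < r₁) (hr : r₁ ≤ r₂) :
    slopeMean n R r₂ ≤ slopeMean n R r₁ := by
  have hr₂ := hr₁.trans_le hr
  have h := integral_mul_le_of_likelihoodRatio n (f := fun s => -sphSlope n (R * s))
    (q₁ := shiftedDensity n r₁) (q₂ := shiftedDensity n r₂) ?_ ?_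
    ((expGrowth_shiftedDensity n hr₁.le).integrable_chi n (by fun_prop))
    ((expGrowth_shiftedDensity n hr₂.le).integrable_chi n (by fun_prop))
    (by simpa using (integrable_slopeMean n hR hr₁.le).neg)
    (by simpa using (integrable_slopeMean n hR hr₂.le).neg)
    (integral_shiftedDensity n hr₁) (integral_shiftedDensity n hr₂)
  · simp only [neg_mul, integral_neg] at h
    unfold slopeMean
    linarith
  · intro t ht s hs hts
    have ht : 0 < t := ht
    have hs : 0 < s := hs
    have := antitoneOn_sphSlope n (Set.mem_Ici.2 (by positivity : 0 ≤ R * t))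
      (Set.mem_Ici.2 (by positivity : 0 ≤ R * s)) (by gcongr)
    simpa using this
  · intro t s ht hts
    have h1 := sphMgf_mul_le_mul (n + 2) hr₁.le hr ht.le hts
    unfold shiftedDensity
    have hp : 0 ≤ Real.exp (-r₁ ^ 2 / 2) * Real.exp (-r₂ ^ 2 / 2) * (s ^ 2 * t ^ 2 / n ^ 2) := by
      positivity
    calc _ = Real.exp (-r₁ ^ 2 / 2) * Real.exp (-r₂ ^ 2 / 2) * (s ^ 2 * t ^ 2 / n ^ 2)
          * (sphMgf (n + 2) (r₁ * s) * sphMgf (n + 2) (r₂ * t)) := by ring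
      _ ≤ Real.exp (-r₁ ^ 2 / 2) * Real.exp (-r₂ ^ 2 / 2) * (s ^ 2 * t ^ 2 / n ^ 2)
          * (sphMgf (n + 2) (r₂ * s) * sphMgf (n + 2) (r₁ * t)) :=
          mul_le_mul_of_nonneg_left h1 hp
      _ = _ := by ring

lemma hasDerivAt_sphProfile {R r : ℝ} (hR : 0 ≤ R) (hr : 0 ≤ r) :
    HasDerivAt (sphProfile n R) (r * (1 - R ^ 2 * slopeMean n R r)) r := by
  have h1 : ∀ s, HasDerivAt (fun s => Real.log (sphMgf n (R * s))) (sphRatio n (R * s) * R) s :=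
    fun s => (hasDerivAt_log_sphMgf n (R * s)).comp s
      (by simpa using (hasDerivAt_id s).const_mul R)
  have h2 := hasDerivAt_noncentral n hr h1 (expGrowth_log_sphMgf n hR)
    ((ExpGrowth.const R).of_abs_le fun s _ => by
      rw [abs_mul]
      exact mul_le_of_le_one_left (abs_nonneg _) (abs_sphRatio_le_one n _)) (by fun_prop)
  have h3 : HasDerivAt (fun r : ℝ => r ^ 2 / 2 + R ^ 2 / 2) r r := by
    convert! ((hasDerivAt_pow 2 r).div_const 2).add_const (R ^ 2 / 2) using 1
    simp
  convert! h3.sub h2 using 1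
  rw [slopeMean, mul_sub, mul_one, ← mul_assoc, ← integral_const_mul]
  congr 2
  ext s
  rw [sphRatio_eq]
  unfold shiftedDensity sphMgfDeriv
  ring

lemma continuousOn_sphProfile {R : ℝ} (hR : 0 ≤ R) {s : Set ℝ} (hs : s ⊆ Set.Ici 0) :
    ContinuousOn (sphProfile n R) s :=
  fun _ hr => (hasDerivAt_sphProfile n hR (hs hr)).continuousAt.continuousWithinAt

/-- As a function of `r²`, the profile is convex, so that it is maximal at an end point of
`[0, R]`. -/
lemma sphProfile_le {R : ℝ} (hR : 0 ≤ R) (h : sphProfile n R 0 ≤ sphProfile n R R) {r : ℝ}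
    (hr : 0 ≤ r) (hrR : r ≤ R) : sphProfile n R r ≤ sphProfile n R R := by
  rcases hr.eq_or_lt with rfl | hr0
  · exact h
  rcases le_total 0 (1 - R ^ 2 * slopeMean n R r) with hs | hs
  · have hsub : Set.Icc r R ⊆ Set.Ici 0 := fun x hx => hr.trans hx.1
    have hmono : MonotoneOn (sphProfile n R) (Set.Icc r R) := by
      refine monotoneOn_of_hasDerivWithinAt_nonneg (convex_Icc _ _)
        (continuousOn_sphProfile n hR hsub)
        (fun y hy => (hasDerivAt_sphProfile n hR (hsub (interior_subset hy))).hasDerivWithinAt)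
        fun y hy => ?_
      have hy := interior_subset hy
      have := slopeMean_anti n hR hr0 hy.1
      refine mul_nonneg (hr.trans hy.1) ?_
      nlinarith [sq_nonneg R]
    exact hmono ⟨le_rfl, hrR⟩ ⟨hrR, le_rfl⟩ hrR
  · have hsub : Set.Icc 0 r ⊆ Set.Ici 0 := fun x hx => hx.1
    have hanti : AntitoneOn (sphProfile n R) (Set.Icc 0 r) := by
      refine antitoneOn_of_hasDerivWithinAt_nonpos (convex_Icc _ _)
        (continuousOn_sphProfile n hR hsub)
        (fun y hy => (hasDerivAt_sphProfile n hR (hsub (interior_subset hy))).hasDerivWithinAt)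
        fun y hy => ?_
      rw [interior_Icc] at hy
      have := slopeMean_anti n hR hy.1 hy.2.le
      refine mul_nonpos_of_nonneg_of_nonpos hy.1.le ?_
      nlinarith [sq_nonneg R]
    exact (hanti ⟨le_rfl, hr⟩ ⟨hr, le_rfl⟩ hr).trans h

/-- The uniform input is optimal if and only if the center is not more informative than the
sphere. -/
lemma isCapacityAchieving_uniformSphere_iff {R : ℝ} (hR : 0 ≤ R) :
    IsCapacityAchieving n R (uniformSphere n R) ↔ sphProfile n R 0 ≤ sphProfile n R R :=
  ⟨sphProfile_zero_le_of_isCapacityAchieving n hR, fun h =>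
    isCapacityAchieving_of_sphProfile_le n hR fun _ hr hrR => sphProfile_le n hR h hr hrR⟩

/-- For `R² ≤ n` the profile is nondecreasing. -/
lemma sphProfile_zero_le_of_sq_le {R : ℝ} (hR : 0 ≤ R) (hRn : R ^ 2 ≤ n) :
    sphProfile n R 0 ≤ sphProfile n R R := by
  have h0 := natCast_pos_of_neZero n
  have hsub : Set.Icc 0 R ⊆ Set.Ici 0 := fun x hx => hx.1
  have hmono : MonotoneOn (sphProfile n R) (Set.Icc 0 R) := by
    refine monotoneOn_of_hasDerivWithinAt_nonneg (convex_Icc _ _)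
      (continuousOn_sphProfile n hR hsub)
      (fun y hy => (hasDerivAt_sphProfile n hR (hsub (interior_subset hy))).hasDerivWithinAt)
      fun y hy => ?_
    rw [interior_Icc] at hy
    have h1 := slopeMean_le n hR hy.1
    rw [le_div_iff₀ h0] at h1
    have h2 : 0 ≤ slopeMean n R y := integral_nonneg fun s =>
      mul_nonneg (sphSlope_pos n _).le (shiftedDensity_nonneg n y s)
    exact mul_nonneg hy.1.le (by nlinarith)
  exact hmono ⟨le_rfl, hR⟩ ⟨hR, le_rfl⟩ hR

end Parameter

/-! ### The integral equation -/

section Equation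

variable (n : ℕ) [NeZero n]

/-- `E[h²(r ‖Z‖)]`. -/
noncomputable def centralMean (r : ℝ) : ℝ := ∫ s, sphRatio n (r * s) ^ 2 ∂(chi n)

/-- `E[h²(r ‖x + Z‖)]` for `‖x‖ = r`. -/
noncomputable def noncentralMean (r : ℝ) : ℝ :=
  ∫ s, Real.exp (-r ^ 2 / 2) * (sphRatio n (r * s) ^ 2 * sphMgf n (r * s)) ∂(chi n)

lemma abs_sphRatio_sq_le_one (x : ℝ) : |sphRatio n x ^ 2| ≤ 1 := by
  rw [abs_pow]
  exact pow_le_one₀ (abs_nonneg _) (abs_sphRatio_le_one n x)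

lemma expGrowth_sphRatio_sq (r : ℝ) : ExpGrowth (fun s => sphRatio n (r * s) ^ 2) :=
  (ExpGrowth.const 1).of_abs_le fun s _ => by
    rw [abs_one]; exact abs_sphRatio_sq_le_one n _

lemma integrable_centralMean (r : ℝ) : Integrable (fun s => sphRatio n (r * s) ^ 2) (chi n) :=
  (expGrowth_sphRatio_sq n r).integrable_chi n (by fun_prop)

lemma integrable_noncentralMean (r : ℝ) {r' : ℝ} (hr' : 0 ≤ r') :
    Integrable (fun s => sphRatio n (r * s) ^ 2 * (Real.exp (-r' ^ 2 / 2) * sphMgf n (r' * s)))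
      (chi n) :=
  ((expGrowth_sphRatio_sq n r).mul ((ExpGrowth.const _).mul (expGrowth_sphMgf n hr'))).integrable_chi
    n (by fun_prop)

lemma sphRatio_sq_mono {x y : ℝ} (hx : 0 ≤ x) (hxy : x ≤ y) :
    sphRatio n x ^ 2 ≤ sphRatio n y ^ 2 := by
  have := (strictMonoOn_sphRatio n).monotoneOn hx (hx.trans hxy) hxy
  have := sphRatio_nonneg n hx
  gcongr

lemma centralMean_strictMono {r₁ r₂ : ℝ} (hr₁ : 0 ≤ r₁) (hr : r₁ < r₂) :
    centralMean n r₁ < centralMean n r₂ := by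
  have hpos : ∀ s, 0 < s → 0 < sphRatio n (r₂ * s) ^ 2 - sphRatio n (r₁ * s) ^ 2 := fun s hs => by
    have h1 : 0 ≤ r₁ * s := by positivity
    have h2 : r₁ * s < r₂ * s := by gcongr
    have h3 := strictMonoOn_sphRatio n h1 (h1.trans h2.le) h2
    have h4 := sphRatio_nonneg n h1
    nlinarith
  have h : 0 < ∫ s, (sphRatio n (r₂ * s) ^ 2 - sphRatio n (r₁ * s) ^ 2) ∂(chi n) := by
    rw [integral_pos_iff_support_of_nonneg_ae]
    · have : (Function.support fun s : ℝ => sphRatio n (r₂ * s) ^ 2 - sphRatio n (r₁ * s) ^ 2)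
          =ᵐ[chi n] Set.univ := by
        filter_upwards [ae_chi_pos n] with s hs
        simp only [eq_iff_iff]
        change sphRatio n (r₂ * s) ^ 2 - sphRatio n (r₁ * s) ^ 2 ≠ 0 ↔ True
        simp [(hpos s hs).ne']
      rw [measure_congr this]
      simp
    · filter_upwards [ae_chi_pos n] with s hs
      exact (hpos s hs).le
    · exact (integrable_centralMean n r₂).sub (integrable_centralMean n r₁)
  rw [integral_sub (integrable_centralMean n r₂) (integrable_centralMean n r₁)] at h
  unfold centralMean
  linarith

/-- The mean of the increasing function `s ↦ h²(r s)` increases with the noncentrality. -/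
lemma integral_sphRatio_sq_noncentral_mono {r r₁ r₂ : ℝ} (hr : 0 ≤ r) (hr₁ : 0 ≤ r₁) (h : r₁ ≤ r₂) :
    ∫ s, sphRatio n (r * s) ^ 2 * (Real.exp (-r₁ ^ 2 / 2) * sphMgf n (r₁ * s)) ∂(chi n)
      ≤ ∫ s, sphRatio n (r * s) ^ 2 * (Real.exp (-r₂ ^ 2 / 2) * sphMgf n (r₂ * s)) ∂(chi n) := by
  have hr₂ := hr₁.trans h
  have hq : ∀ r, 0 ≤ r → Integrable (fun s => Real.exp (-r ^ 2 / 2) * sphMgf n (r * s)) (chi n) :=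
    fun r hr => ((expGrowth_sphMgf n hr).integrable_chi n (by fun_prop)).const_mul _
  refine integral_mul_le_of_likelihoodRatio n ?_ ?_ (hq r₁ hr₁) (hq r₂ hr₂)
    (integrable_noncentralMean n r hr₁) (integrable_noncentralMean n r hr₂)
    (integral_chi_exp_mul_sphMgf n hr₁) (integral_chi_exp_mul_sphMgf n hr₂)
  · intro t ht s hs hts
    have ht : 0 < t := ht
    exact sphRatio_sq_mono n (by positivity) (by gcongr)
  · intro t s ht hts
    have h1 := sphMgf_mul_le_mul n hr₁ h ht.le hts
    calc _ = Real.exp (-r₁ ^ 2 / 2) * Real.exp (-r₂ ^ 2 / 2)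
          * (sphMgf n (r₁ * s) * sphMgf n (r₂ * t)) := by ring
      _ ≤ Real.exp (-r₁ ^ 2 / 2) * Real.exp (-r₂ ^ 2 / 2)
          * (sphMgf n (r₂ * s) * sphMgf n (r₁ * t)) := mul_le_mul_of_nonneg_left h1 (by positivity)
      _ = _ := by ring

lemma noncentralMean_eq (n : ℕ) (r : ℝ) : noncentralMean n r
    = ∫ s, sphRatio n (r * s) ^ 2 * (Real.exp (-r ^ 2 / 2) * sphMgf n (r * s)) ∂(chi n) := by
  unfold noncentralMean
  congr 1
  ext s
  ring

lemma noncentralMean_mono {r₁ r₂ : ℝ} (hr₁ : 0 ≤ r₁) (hr : r₁ ≤ r₂) :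
    noncentralMean n r₁ ≤ noncentralMean n r₂ := by
  have hr₂ := hr₁.trans hr
  rw [noncentralMean_eq, noncentralMean_eq]
  refine le_trans ?_ (integral_sphRatio_sq_noncentral_mono n hr₂ hr₁ hr)
  refine integral_mono_ae (integrable_noncentralMean n r₁ hr₁) (integrable_noncentralMean n r₂ hr₁) ?_
  filter_upwards [ae_chi_pos n] with s hs
  have := sphMgf_pos n (r₁ * s)
  exact mul_le_mul_of_nonneg_right (sphRatio_sq_mono n (by positivity) (by gcongr)) (by positivity)

lemma centralMean_le_noncentralMean {r : ℝ} (hr : 0 ≤ r) : centralMean n r ≤ noncentralMean n r := by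
  have h := integral_sphRatio_sq_noncentral_mono n hr le_rfl hr
  rw [noncentralMean_eq]
  refine le_trans (le_of_eq ?_) h
  simp [centralMean, sphMgf_zero]

/-- `∫₀¹ E[h²(√γ R ‖Z‖)] + E[h²(√γ R ‖√γ x + Z‖)] dγ` for `‖x‖ = R`. -/
noncomputable def radiusMean (R : ℝ) : ℝ :=
  ∫ γ in (0 : ℝ)..1, (centralMean n (√γ * R) + noncentralMean n (√γ * R))

lemma radiusIntegral_eq {R : ℝ} {x : Rn n} (hx : ‖x‖ = R) : radiusIntegral n R x = radiusMean n R := by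
  have hR : 0 ≤ R := hx ▸ norm_nonneg x
  unfold radiusIntegral radiusMean
  congr 1
  ext γ
  have hγ : 0 ≤ √γ := Real.sqrt_nonneg γ
  congr 1
  · rw [centralMean, ← integral_stdGaussian_norm n _ (by fun_prop)]
    congr 1
    ext z
    rw [besselRatio_half n (by positivity)]
  · have h := integral_stdGaussian_norm_add n (√γ • x) (fun s => sphRatio n (√γ * R * s) ^ 2)
      (by fun_prop) (expGrowth_sphRatio_sq n _)
    rw [norm_smul, Real.norm_of_nonneg hγ, hx] at h
    rw [noncentralMean, ← h]
    congr 1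
    ext z
    rw [besselRatio_half n (by positivity)]

lemma intervalIntegrable_radiusMean {R : ℝ} (hR : 0 ≤ R) :
    IntervalIntegrable (fun γ => centralMean n (√γ * R) + noncentralMean n (√γ * R)) volume 0 1 := by
  apply MonotoneOn.intervalIntegrable
  intro γ₁ _ γ₂ _ h
  have h1 : √γ₁ * R ≤ √γ₂ * R := by gcongr
  have h2 : 0 ≤ √γ₁ * R := by positivity
  refine add_le_add ?_ (noncentralMean_mono n h2 h1)
  rcases h1.eq_or_lt with h3 | h3
  · rw [h3]
  · exact (centralMean_strictMono n h2 h3).le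

lemma radiusMean_strictMonoOn : StrictMonoOn (radiusMean n) (Set.Ici 0) := by
  intro R₁ hR₁ R₂ hR₂ h
  have hR₁ : 0 ≤ R₁ := hR₁
  have hR₂ : 0 ≤ R₂ := hR₂
  rw [← sub_pos, radiusMean, radiusMean, ← intervalIntegral.integral_sub
    (intervalIntegrable_radiusMean n hR₂) (intervalIntegrable_radiusMean n hR₁)]
  refine intervalIntegral.intervalIntegral_pos_of_pos_on
    ((intervalIntegrable_radiusMean n hR₂).sub (intervalIntegrable_radiusMean n hR₁))
    (fun γ hγ => ?_) one_pos
  have hγ' : 0 < √γ := Real.sqrt_pos.2 hγ.1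
  have h1 : √γ * R₁ < √γ * R₂ := by gcongr
  have h2 : 0 ≤ √γ * R₁ := by positivity
  have := centralMean_strictMono n h2 h1
  have := noncentralMean_mono n h2 h1.le
  linarith

/-- `E[log Φ(r ‖Z‖)]` has derivative `r (1 - E[h²(r ‖Z‖)])`. -/
lemma hasDerivAt_integral_log_sphMgf (r : ℝ) :
    HasDerivAt (fun r => ∫ s, Real.log (sphMgf n (r * s)) ∂(chi n)) (r * (1 - centralMean n r)) r := by
  have h0 := natCast_pos_of_neZero n
  have hh : ExpGrowth (fun s => sphRatio n (r * s)) :=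
    (ExpGrowth.const 1).of_abs_le fun s _ => by rw [abs_one]; exact abs_sphRatio_le_one n _
  have i1 : Integrable (fun s => s * sphRatio n (r * s)) (chi n) :=
    (ExpGrowth.id.mul hh).integrable_chi n (by fun_prop)
  have i2 := integrable_centralMean n r
  have hmul : ∀ s : ℝ, HasDerivAt (fun x : ℝ => r * x) r s := fun s => by
    simpa using (hasDerivAt_id s).const_mul r
  have hform : ∀ s, 0 < s → (1 - sphRatio n (r * s) ^ 2 - (n - 1) * sphSlope n (r * s)) * r
      + (n - 1) * (sphRatio n (r * s) / s) - s * sphRatio n (r * s)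
      = r * (1 - sphRatio n (r * s) ^ 2) - s * sphRatio n (r * s) := by
    intro s hs
    have : sphRatio n (r * s) / s = r * sphSlope n (r * s) := by
      rw [sphRatio_eq]; field_simp
    rw [this]
    ring
  have hae := (ae_chi_pos n).mono hform
  have i3 : Integrable (fun s => r * (1 - sphRatio n (r * s) ^ 2)) (chi n) :=
    ((integrable_const 1).sub i2).const_mul r
  -- the Riccati equation cancels the terms in `h / s` of Stein's identity for `s ↦ h(r s)`
  have h := integral_chi_stein n (u := fun s => sphRatio n (r * s))
    (v := fun s => (1 - sphRatio n (r * s) ^ 2 - (n - 1) * sphSlope n (r * s)) * r)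
    (fun s _ => (hasDerivAt_sphRatio n (r * s)).comp s (hmul s))
    (by fun_prop) (by simp [sphRatio_zero]) hh ((i3.sub i1).congr (hae.mono fun s hs => hs.symm))
  rw [integral_congr_ae hae, integral_sub i3 i1, integral_const_mul,
    integral_sub (integrable_const _) i2] at h
  have hd := hasDerivAt_integral_chi n (r := r) (g := fun s => |s|)
    (F := fun r s => Real.log (sphMgf n (r * s))) (F' := fun r s => sphRatio n (r * s) * s)
    (fun r' => by fun_prop) (by fun_prop) ?_ (ExpGrowth.id.of_abs_le fun s _ => by rw [abs_abs])
    (by fun_prop) ?_ ?_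
  · convert! hd using 1
    have e : ∫ s, sphRatio n (r * s) * s ∂(chi n) = ∫ s, s * sphRatio n (r * s) ∂(chi n) := by
      congr 1
      ext s
      ring
    simp only [integral_const, probReal_univ, smul_eq_mul, mul_one] at h
    rw [e, centralMean]
    linarith
  · refine ExpGrowth.integrable_chi (((ExpGrowth.const |r|).mul ExpGrowth.id).of_abs_le fun s _ => ?_)
      n (Measurable.aestronglyMeasurable (by fun_prop))
    rw [abs_of_nonneg (log_sphMgf_nonneg n _), abs_mul, abs_abs, ← abs_mul]
    exact log_sphMgf_le_abs n _
  · intro r' s _ _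
    rw [abs_mul]
    exact mul_le_of_le_one_left (abs_nonneg _) (abs_sphRatio_le_one n _)
  · intro r' s
    exact (hasDerivAt_log_sphMgf n (r' * s)).comp r' (by simpa using (hasDerivAt_id r').mul_const s)

/-- `E[log Φ(r ‖x + Z‖)]`, for `‖x‖ = r`, has derivative `r (1 + E[h²(r ‖x + Z‖)])`. -/
lemma hasDerivAt_integral_log_sphMgf_mul {r : ℝ} (hr : 0 ≤ r) :
    HasDerivAt
      (fun r => ∫ s, Real.exp (-r ^ 2 / 2) * (Real.log (sphMgf n (r * s)) * sphMgf n (r * s)) ∂(chi n))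
      (r * (1 + noncentralMean n r)) r := by
  have hmul : ∀ s : ℝ, HasDerivAt (fun x : ℝ => r * x) r s := fun s => by
    simpa using (hasDerivAt_id s).const_mul r
  have hlog := expGrowth_log_sphMgf n hr
  have hΦ := expGrowth_sphMgf n hr
  have i1 : Integrable (fun s => Real.log (sphMgf n (r * s)) * sphMgf n (r * s)) (chi n) :=
    (hlog.mul hΦ).integrable_chi n (Measurable.aestronglyMeasurable (by fun_prop))
  have i2 : Integrable (fun s => sphMgf n (r * s)) (chi n) := hΦ.integrable_chi n (by fun_prop)
  have i3 : Integrable (fun s => sphRatio n (r * s) ^ 2 * sphMgf n (r * s)) (chi n) :=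
    ((expGrowth_sphRatio_sq n r).mul hΦ).integrable_chi n (by fun_prop)
  -- the factor `log Φ + 1` comes from `(Φ log Φ)' = (log Φ + 1) Φ'`
  have hst := integral_chi_stein_sphMgfDeriv n hr (f := fun s => Real.log (sphMgf n (r * s)) + 1)
    (f' := fun s => sphRatio n (r * s) * r)
    (fun s => ((hasDerivAt_log_sphMgf n (r * s)).comp s (hmul s)).add_const 1)
    (hlog.add (ExpGrowth.const 1))
    ((ExpGrowth.const r).of_abs_le fun s _ => by
      rw [abs_mul]
      exact mul_le_of_le_one_left (abs_nonneg _) (abs_sphRatio_le_one n _)) (by fun_prop)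
  have e1 : ∫ s, sphRatio n (r * s) * r * sphMgfDeriv n (r * s) ∂(chi n)
      = r * ∫ s, sphRatio n (r * s) ^ 2 * sphMgf n (r * s) ∂(chi n) := by
    rw [← integral_const_mul]
    congr 1
    ext s
    have := (sphMgf_pos n (r * s)).ne'
    unfold sphRatio
    field_simp
  have e2 : ∫ s, (Real.log (sphMgf n (r * s)) + 1) * sphMgf n (r * s) ∂(chi n)
      = ∫ s, Real.log (sphMgf n (r * s)) * sphMgf n (r * s) ∂(chi n)
        + ∫ s, sphMgf n (r * s) ∂(chi n) := by
    rw [← integral_add i1 i2]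
    congr 1
    ext s
    ring
  rw [e1, e2] at hst
  have hbd : ∀ r' s, |r' - r| < 1 → 0 < s → |r' * s| ≤ (|r| + 1) * s := fun r' s h hs =>
    abs_mul_le_of_abs_sub_lt h hs
  have hB : 0 ≤ |r| + 1 := by positivity
  have hd := hasDerivAt_integral_chi n (r := r)
    (g := fun s => ((|r| + 1) * |s| + 1) * (|s| * Real.exp ((|r| + 1) * s)))
    (F := fun r s => Real.log (sphMgf n (r * s)) * sphMgf n (r * s))
    (F' := fun r s => (Real.log (sphMgf n (r * s)) + 1) * (s * sphMgfDeriv n (r * s)))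
    (fun r' => by fun_prop) (by fun_prop) i1 ?_ (by fun_prop) ?_ ?_
  · have h1 : HasDerivAt (fun r : ℝ => Real.exp (-r ^ 2 / 2)) (Real.exp (-r ^ 2 / 2) * (-r)) r := by
      convert! (((hasDerivAt_id r).pow 2).neg.div_const 2).exp using 1
      simp; ring
    have h2 := integral_chi_exp_mul_sphMgf n hr
    rw [integral_const_mul] at h2
    have h3 := h1.mul hd
    simp only [integral_const_mul]
    convert! h3 using 1
    rw [hst, noncentralMean, integral_const_mul]
    linear_combination (-r) * h2
  · refine ExpGrowth.mul (ExpGrowth.add (ExpGrowth.mul (ExpGrowth.const _) ?_) (ExpGrowth.const 1))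
      (ExpGrowth.mul ?_ (ExpGrowth.exp _)) <;>
    exact ExpGrowth.id.of_abs_le fun s _ => by rw [abs_abs]
  · intro r' s h hs
    have h1 := hbd r' s h hs
    have h2 := log_sphMgf_le_abs n (r' * s)
    have h3 := log_sphMgf_nonneg n (r' * s)
    have h4 := (abs_sphMgfDeriv_le n (r' * s)).trans ((sphMgf_le_exp_abs n _).trans
      (Real.exp_le_exp.2 h1))
    rw [abs_mul, abs_mul, abs_of_nonneg (by positivity : 0 ≤ Real.log (sphMgf n (r' * s)) + 1),
      abs_of_pos hs]
    gcongr
    linarith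
  · intro r' s
    have hm : HasDerivAt (fun x : ℝ => x * s) s r' := by simpa using (hasDerivAt_id r').mul_const s
    have p := (sphMgf_pos n (r' * s)).ne'
    convert! ((hasDerivAt_log_sphMgf n (r' * s)).comp r' hm).mul
      ((hasDerivAt_sphMgf n (r' * s)).comp r' hm) using 1
    simp only [Function.comp_apply]
    unfold sphRatio sphMgfDeriv
    field_simp
    ring

/-- `E[log Φ(r ‖x + Z‖)] - E[log Φ(r ‖Z‖)]` for `‖x‖ = r`. -/
noncomputable def logGap (r : ℝ) : ℝ :=
  (∫ s, Real.exp (-r ^ 2 / 2) * (Real.log (sphMgf n (r * s)) * sphMgf n (r * s)) ∂(chi n))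
    - ∫ s, Real.log (sphMgf n (r * s)) ∂(chi n)

lemma hasDerivAt_logGap {r : ℝ} (hr : 0 ≤ r) :
    HasDerivAt (logGap n) (r * (centralMean n r + noncentralMean n r)) r := by
  convert! (hasDerivAt_integral_log_sphMgf_mul n hr).sub (hasDerivAt_integral_log_sphMgf n r) using 1
  ring

lemma logGap_eq {R : ℝ} (hR : 0 ≤ R) : logGap n R = R ^ 2 / 2 * radiusMean n R := by
  have h := intervalIntegral.integral_eq_sub_of_hasDerivAt_of_le (a := 0) (b := 1)
    (f := fun γ => logGap n (√γ * R))
    (f' := fun γ => R ^ 2 / 2 * (centralMean n (√γ * R) + noncentralMean n (√γ * R))) zero_le_one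
    ?_ ?_ ((intervalIntegrable_radiusMean n hR).const_mul _)
  · rw [intervalIntegral.integral_const_mul, ← radiusMean] at h
    rw [h]
    simp [logGap, sphMgf_zero]
  · intro γ _
    have h1 : ContinuousAt (logGap n) (√γ * R) :=
      (hasDerivAt_logGap n (by positivity)).continuousAt
    exact (ContinuousAt.comp (f := fun γ => √γ * R) h1 (by fun_prop)).continuousWithinAt
  · intro γ hγ
    have hγ' : 0 < √γ := Real.sqrt_pos.2 hγ.1
    have h1 : HasDerivAt (fun γ : ℝ => √γ * R) (1 / (2 * √γ) * R) γ :=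
      (Real.hasDerivAt_sqrt hγ.1.ne').mul_const R
    convert! (hasDerivAt_logGap n (by positivity : 0 ≤ √γ * R)).comp γ h1 using 1
    field_simp

/-- The increase of the profile between the center and the sphere. -/
lemma sphProfile_sub {R : ℝ} (hR : 0 ≤ R) :
    sphProfile n R R - sphProfile n R 0 = R ^ 2 / 2 * (1 - radiusMean n R) := by
  have h := logGap_eq n hR
  unfold logGap at h
  unfold sphProfile
  simp only [zero_mul, sphMgf_zero, mul_one, ne_eq, OfNat.ofNat_ne_zero, not_false_eq_true,
    zero_pow, neg_zero, zero_div, Real.exp_zero, one_mul, zero_add]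
  linarith

lemma sphProfile_zero_le_iff {R : ℝ} (hR : 0 < R) :
    sphProfile n R 0 ≤ sphProfile n R R ↔ radiusMean n R ≤ 1 := by
  have h := sphProfile_sub n hR.le
  have hp : 0 < R ^ 2 / 2 := by positivity
  constructor
  · intro h1
    have : 0 ≤ R ^ 2 / 2 * (1 - radiusMean n R) := by linarith
    linarith [nonneg_of_mul_nonneg_right this hp]
  · intro h1
    have : 0 ≤ R ^ 2 / 2 * (1 - radiusMean n R) := mul_nonneg hp.le (by linarith)
    linarith

lemma continuousOn_radiusMean : ContinuousOn (radiusMean n) (Set.Ioi 0) := by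
  have h : ContinuousOn (fun R => logGap n R / (R ^ 2 / 2)) (Set.Ioi 0) := by
    intro R hR
    have hR : 0 < R := hR
    exact ((hasDerivAt_logGap n hR.le).continuousAt.div (by fun_prop)
      (by positivity)).continuousWithinAt
  refine h.congr fun R hR => ?_
  have hR : 0 < R := hR
  simp only
  rw [logGap_eq n hR.le]
  field_simp

lemma tendsto_sphRatio_sq : Filter.Tendsto (fun x => sphRatio n x ^ 2) Filter.atTop (nhds 1) := by
  have h : Filter.Tendsto (fun x : ℝ => 1 - n / x) Filter.atTop (nhds 1) := by
    simpa using (tendsto_const_nhds (x := (1 : ℝ))).sub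
      (Filter.Tendsto.const_div_atTop Filter.tendsto_id (n : ℝ))
  refine tendsto_of_tendsto_of_tendsto_of_le_of_le' h tendsto_const_nhds ?_ ?_
  · filter_upwards [Filter.eventually_gt_atTop 0] with x hx
    have h1 := one_sub_sphRatio_sq_sub_nonpos n hx.le
    have h2 := sphRatio_lt_one n hx.le
    rw [sphRatio_eq] at h2
    have h3 : sphSlope n x ≤ 1 / x := by
      rw [le_div_iff₀ hx]; linarith
    have h4 : n * sphSlope n x ≤ n / x := by
      rw [div_eq_mul_one_div]; gcongr
    linarith
  · filter_upwards [Filter.eventually_gt_atTop 0] with x hx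
    exact (sphRatio_sq_lt_one n hx.le).le

lemma tendsto_centralMean : Filter.Tendsto (centralMean n) Filter.atTop (nhds 1) := by
  have h := tendsto_integral_filter_of_dominated_convergence (μ := chi n) (l := Filter.atTop)
    (F := fun r s => sphRatio n (r * s) ^ 2) (f := fun _ => 1) (fun _ => 1)
    (Filter.Eventually.of_forall fun r => by fun_prop)
    (Filter.Eventually.of_forall fun r => Filter.Eventually.of_forall fun s =>
      abs_sphRatio_sq_le_one n _) (integrable_const _)
    ((ae_chi_pos n).mono fun s hs =>
      (tendsto_sphRatio_sq n).comp (Filter.tendsto_id.atTop_mul_const hs))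
  simp only [integral_const, probReal_univ, smul_eq_mul, mul_one] at h
  exact h

/-- If `E[h²(r ‖Z‖)] > 3/4`, then at radius `2 r` the integrand exceeds `3/2` for `γ ∈ [1/4, 1]`,
where `√γ (2 r) ≥ r`. -/
lemma exists_one_lt_radiusMean (R₀ : ℝ) : ∃ R, R₀ ≤ R ∧ 0 < R ∧ 1 < radiusMean n R := by
  obtain ⟨r, hr1, hr2, hr3⟩ := ((tendsto_centralMean n).eventually_const_lt
    (by norm_num : (3 / 4 : ℝ) < 1) |>.and ((Filter.eventually_gt_atTop 0).and
      (Filter.eventually_ge_atTop R₀))).exists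
  refine ⟨2 * r, by linarith, by linarith, ?_⟩
  have hi := intervalIntegrable_radiusMean n (R := 2 * r) (by linarith)
  have h4 : (1 / 4 : ℝ) ∈ Set.uIcc 0 1 := by
    rw [Set.uIcc_of_le zero_le_one]; constructor <;> norm_num
  have hi1 := hi.mono_set (Set.uIcc_subset_uIcc_left h4)
  have hi2 := hi.mono_set (Set.uIcc_subset_uIcc_right h4)
  have hnn : ∀ x, 0 ≤ centralMean n x := fun x => integral_nonneg fun s => sq_nonneg _
  have hnn' : ∀ x, 0 ≤ noncentralMean n x := fun x => integral_nonneg fun s => by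
    have := sphMgf_pos n (x * s)
    positivity
  have h5 : 0 ≤ ∫ γ in (0 : ℝ)..(1 / 4),
      (centralMean n (√γ * (2 * r)) + noncentralMean n (√γ * (2 * r))) :=
    intervalIntegral.integral_nonneg (by norm_num) fun γ _ => add_nonneg (hnn _) (hnn' _)
  have h6 : ∫ γ in (1 / 4 : ℝ)..1, (3 / 2 : ℝ) ≤ ∫ γ in (1 / 4 : ℝ)..1,
      (centralMean n (√γ * (2 * r)) + noncentralMean n (√γ * (2 * r))) := by
    refine intervalIntegral.integral_mono_on (by norm_num) (by simp) hi2 fun γ hγ => ?_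
    have h7 : 1 / 2 ≤ √γ := Real.le_sqrt_of_sq_le (by linarith [hγ.1])
    have h8 : r ≤ √γ * (2 * r) := by nlinarith
    have h9 := centralMean_le_noncentralMean n (hr2.le.trans h8)
    rcases h8.eq_or_lt with h | h
    · rw [← h] at h9 ⊢; linarith
    · have := centralMean_strictMono n hr2.le h
      linarith
  rw [radiusMean, ← intervalIntegral.integral_add_adjacent_intervals hi1 hi2]
  simp only [intervalIntegral.integral_const, smul_eq_mul] at h6
  linarith

/-- The integral equation has a solution, which separates the radii for which the uniform input
is optimal from the others. -/
lemma exists_radiusMean_eq_one : ∃ ρ, √(n : ℝ) ≤ ρ ∧ radiusMean n ρ = 1 ∧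
    ∀ R, 0 ≤ R → (IsCapacityAchieving n R (uniformSphere n R) ↔ R ≤ ρ) := by
  have h0 := natCast_pos_of_neZero n
  have hs : 0 < √(n : ℝ) := Real.sqrt_pos.2 h0
  obtain ⟨R₁, h1, h2, h3⟩ := exists_one_lt_radiusMean n (√(n : ℝ))
  have h4 : radiusMean n (√(n : ℝ)) ≤ 1 :=
    (sphProfile_zero_le_iff n hs).1
      (sphProfile_zero_le_of_sq_le n hs.le (Real.sq_sqrt h0.le).le)
  obtain ⟨ρ, hρ, hρ1⟩ := intermediate_value_Icc h1
    ((continuousOn_radiusMean n).mono fun x hx => hs.trans_le hx.1) ⟨h4, h3.le⟩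
  refine ⟨ρ, hρ.1, hρ1, fun R hR => ?_⟩
  have hρ0 := hs.trans_le hρ.1
  rw [isCapacityAchieving_uniformSphere_iff n hR]
  rcases hR.eq_or_lt with rfl | hR'
  · simp [hρ0.le]
  · rw [sphProfile_zero_le_iff n hR', ← hρ1, (radiusMean_strictMonoOn n).le_iff_le hR hρ0.le]

end Equation

/-! ### High dimensions -/

/-- The limit of `h²_{n/2}(n s)` as `n → ∞`, as a function of `p = s²`. -/
noncomputable def limitRatioSq (p : ℝ) : ℝ := p / (1 / 2 + √(1 / 4 + p)) ^ 2

lemma limitRatioSq_eq {p : ℝ} (hp : 0 ≤ p) :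
    limitRatioSq p = (√(1 / 4 + p) - 1 / 2) / (√(1 / 4 + p) + 1 / 2) := by
  have h := Real.sq_sqrt (by linarith : 0 ≤ 1 / 4 + p)
  have h0 := Real.sqrt_nonneg (1 / 4 + p)
  rw [limitRatioSq, div_eq_div_iff (by positivity) (by positivity)]
  linear_combination (-(√(1 / 4 + p) + 1 / 2)) * h

lemma half_le_sqrt {p : ℝ} (hp : 0 ≤ p) : 1 / 2 ≤ √(1 / 4 + p) :=
  Real.le_sqrt_of_sq_le (by linarith)

lemma limitRatioSq_sub_le {p q : ℝ} (hp : 0 ≤ p) (hpq : p ≤ q) :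
    limitRatioSq q - limitRatioSq p ≤ q - p := by
  rw [limitRatioSq_eq hp, limitRatioSq_eq (hp.trans hpq)]
  have h1 := Real.sq_sqrt (by linarith : 0 ≤ 1 / 4 + p)
  have h2 := Real.sq_sqrt (by linarith : 0 ≤ 1 / 4 + q)
  have h3 := half_le_sqrt hp
  have h4 := half_le_sqrt (hp.trans hpq)
  have h5 : √(1 / 4 + p) ≤ √(1 / 4 + q) := Real.sqrt_le_sqrt (by linarith)
  set a := √(1 / 4 + p)
  set b := √(1 / 4 + q)
  have e : (b - 1 / 2) / (b + 1 / 2) - (a - 1 / 2) / (a + 1 / 2)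
      = (b - a) / ((b + 1 / 2) * (a + 1 / 2)) := by
    field_simp
    ring
  rw [e, show q - p = (b - a) * (b + a) by linear_combination h1 - h2]
  refine (div_le_self (by linarith) (by nlinarith)).trans ?_
  nlinarith

lemma limitRatioSq_strictMono {p q : ℝ} (hp : 0 ≤ p) (hpq : p < q) :
    limitRatioSq p < limitRatioSq q := by
  rw [limitRatioSq_eq hp, limitRatioSq_eq (hp.trans hpq.le)]
  have h3 := half_le_sqrt hp
  have h5 : √(1 / 4 + p) < √(1 / 4 + q) := Real.sqrt_lt_sqrt (by linarith) (by linarith)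
  rw [div_lt_div_iff₀ (by linarith) (by linarith)]
  nlinarith

lemma abs_limitRatioSq_sub_le {p q : ℝ} (hp : 0 ≤ p) (hq : 0 ≤ q) :
    |limitRatioSq p - limitRatioSq q| ≤ |p - q| := by
  have mono : ∀ {p q : ℝ}, 0 ≤ p → p ≤ q → limitRatioSq p ≤ limitRatioSq q := fun hp hpq => by
    rcases hpq.eq_or_lt with rfl | h
    · exact le_rfl
    · exact (limitRatioSq_strictMono hp h).le
  rcases le_total p q with h | h
  · rw [abs_of_nonpos (by linarith [mono hp h]), abs_of_nonpos (by linarith)]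
    linarith [limitRatioSq_sub_le hp h]
  · rw [abs_of_nonneg (by linarith [mono hq h]), abs_of_nonneg (by linarith)]
    linarith [limitRatioSq_sub_le hq h]

@[fun_prop]
lemma continuousOn_limitRatioSq : ContinuousOn limitRatioSq (Set.Ici 0) := by
  unfold limitRatioSq
  refine ContinuousOn.div (by fun_prop) (by fun_prop) fun p hp => ?_
  have := Real.sqrt_nonneg (1 / 4 + p)
  positivity

section Limit

variable (n : ℕ) [NeZero n]

/-- The Bessel ratio is within `1 / n` of the solution `g` of `g² + g / s = 1`: the two bounds for
`h = h_{n/2}(n s)` say that `1 ≤ h² + h / s < 1 + h / (n s)`. -/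
lemma abs_sphRatio_sq_sub_limitRatioSq_le {s : ℝ} (hs : 0 ≤ s) :
    |sphRatio n (n * s) ^ 2 - limitRatioSq (s ^ 2)| ≤ 2 / n := by
  have h0 := natCast_pos_of_neZero n
  rcases hs.eq_or_lt with rfl | hs
  · simp only [mul_zero, sphRatio_zero, limitRatioSq]
    norm_num
    positivity
  have hns : 0 < n * s := by positivity
  have b1 := one_sub_sphRatio_sq_sub_nonpos n hns.le
  have b2 := one_sub_sphRatio_sq_sub_pos n hns
  have b3 := sphRatio_lt_one n hns.le
  have b4 := sphRatio_pos n hns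
  have hsl : n * sphSlope n (n * s) = sphRatio n (n * s) / s := by
    rw [sphRatio_eq]; field_simp
  have hsl' : sphSlope n (n * s) = sphRatio n (n * s) / (n * s) := by
    rw [sphRatio_eq]; field_simp
  set h := sphRatio n (n * s) with hh
  rw [sub_mul, one_mul, hsl, hsl'] at b2
  rw [hsl] at b1
  set q := √(1 / 4 + s ^ 2) with hq
  have hq2 : q ^ 2 = 1 / 4 + s ^ 2 := Real.sq_sqrt (by positivity)
  have hq0 : 1 / 2 ≤ q := half_le_sqrt (by positivity)
  set g := s / (1 / 2 + q) with hg
  have hg0 : 0 < g := by positivity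
  have hg1 : g < 1 := by
    rw [hg, div_lt_one (by positivity)]
    nlinarith
  have hgs : g ^ 2 + g / s = 1 := by
    rw [hg]
    field_simp
    linear_combination -4 * hq2
  have hlim : limitRatioSq (s ^ 2) = g ^ 2 := by
    rw [limitRatioSq, hg, div_pow]
  have hgh : g ≤ h := by
    by_contra! hlt
    have : h / s < g / s := by gcongr
    nlinarith
  have hd : h - g ≤ 1 / n := by
    have e1 : (h - g) / s ≤ h / (n * s) := by
      rw [sub_div]
      nlinarith
    rw [div_le_div_iff₀ hs hns] at e1
    have e2 : (h - g) * n ≤ h := by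
      have : ((h - g) * n) * s ≤ h * s := by linarith
      exact le_of_mul_le_mul_right this hs
    rw [le_div_iff₀ h0]
    linarith
  rw [hlim, abs_of_nonneg (by nlinarith)]
  have e3 : h ^ 2 - g ^ 2 = (h - g) * (h + g) := by ring
  rw [e3, show (2 : ℝ) / n = 1 / n * 2 by ring]
  exact mul_le_mul hd (by linarith) (by linarith) (by positivity)

/-- The variance of `‖Z‖²`. -/
lemma integral_sq_norm_sub_sq :
    ∫ z : Rn n, (‖z‖ ^ 2 - n) ^ 2 ∂(stdGaussian (Rn n)) = 2 * n := by
  have hint : ∀ j : ℕ, Integrable (fun s : ℝ => s ^ j) (chi n) := fun j =>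
    (ExpGrowth.id.pow j).integrable_chi n (by fun_prop)
  have m1 := integral_chi_pow n 1
  have m2 := integral_chi_pow n 2
  rw [integral_stdGaussian_norm n (fun s => (s ^ 2 - n) ^ 2) (by fun_prop)]
  have e : ∀ s : ℝ, (s ^ 2 - n) ^ 2 = s ^ (2 * 2) - 2 * n * s ^ (2 * 1) + (n : ℝ) ^ 2 :=
    fun s => by ring
  simp only [e]
  have i1 : Integrable (fun s : ℝ => s ^ (2 * 2) - 2 * n * s ^ (2 * 1)) (chi n) :=
    (hint _).sub ((hint _).const_mul _)
  rw [integral_add i1 (integrable_const _), integral_sub (hint _) ((hint _).const_mul _),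
    integral_const_mul, m1, m2]
  simp [Finset.prod_range_succ]
  ring

/-- The squared norm of `x + Z` concentrates around `n + ‖x‖²`. -/
lemma integrable_and_integral_sq_norm_add_sub_sq_le (x : Rn n) :
    Integrable (fun z => (‖x + z‖ ^ 2 - (n + ‖x‖ ^ 2)) ^ 2) (stdGaussian (Rn n)) ∧
    ∫ z, (‖x + z‖ ^ 2 - (n + ‖x‖ ^ 2)) ^ 2 ∂(stdGaussian (Rn n)) ≤ 4 * n + 8 * ‖x‖ ^ 2 := by
  have h1 := integral_sq_norm_sub_sq n
  have h2 := integral_inner_pow_stdGaussian n x 1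
  have i1 : Integrable (fun z : Rn n => (‖z‖ ^ 2 - n) ^ 2) (stdGaussian (Rn n)) := by
    rw [integrable_stdGaussian_norm_iff n (fun s => (s ^ 2 - n) ^ 2) (by fun_prop)]
    exact (((ExpGrowth.id.pow 2).sub (ExpGrowth.const n)).pow 2).integrable_chi n (by fun_prop)
  have i3 : Integrable (fun z : Rn n => ‖x‖ ^ 2 * ‖z‖ ^ 2) (stdGaussian (Rn n)) := by
    refine Integrable.const_mul ?_ _
    rw [integrable_stdGaussian_norm_iff n (fun s => s ^ 2) (by fun_prop)]
    exact (ExpGrowth.id.pow 2).integrable_chi n (by fun_prop)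
  have i2 : Integrable (fun z : Rn n => (inner ℝ x z : ℝ) ^ 2) (stdGaussian (Rn n)) := by
    refine i3.mono' (by fun_prop) (Filter.Eventually.of_forall fun z => ?_)
    rw [norm_pow, ← mul_pow]
    have := abs_real_inner_le_norm x z
    exact pow_le_pow_left₀ (norm_nonneg _) this 2
  have i4 : Integrable (fun z : Rn n => 2 * (‖z‖ ^ 2 - n) ^ 2 + 8 * (inner ℝ x z : ℝ) ^ 2)
      (stdGaussian (Rn n)) := (i1.const_mul 2).add (i2.const_mul 8)
  have hle : ∀ z : Rn n, (‖x + z‖ ^ 2 - (n + ‖x‖ ^ 2)) ^ 2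
      ≤ 2 * (‖z‖ ^ 2 - n) ^ 2 + 8 * (inner ℝ x z : ℝ) ^ 2 := fun z => by
    rw [norm_add_sq_real]
    nlinarith [sq_nonneg ((‖z‖ ^ 2 - n) - 2 * (inner ℝ x z : ℝ))]
  have i5 : Integrable (fun z => (‖x + z‖ ^ 2 - (n + ‖x‖ ^ 2)) ^ 2) (stdGaussian (Rn n)) := by
    refine i4.mono' (by fun_prop) (Filter.Eventually.of_forall fun z => ?_)
    rw [Real.norm_of_nonneg (sq_nonneg _)]
    exact hle z
  refine ⟨i5, (integral_mono i5 i4 hle).trans ?_⟩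
  rw [integral_add (i1.const_mul 2) (i2.const_mul 8), integral_const_mul, integral_const_mul, h1]
  rw [mul_one] at h2
  rw [h2]
  simp
  linarith

/-- The mean of `h²(√(n ρ) ‖x + Z‖)` is close to the value obtained when `‖x + Z‖²` is replaced by
`n + ‖x‖²`. -/
lemma abs_integral_sphRatio_sq_sub_le {ρ : ℝ} (hρ : 0 ≤ ρ) (x : Rn n) :
    |∫ z, sphRatio n (√(n * ρ) * ‖x + z‖) ^ 2 ∂(stdGaussian (Rn n))
        - limitRatioSq (ρ / n * (n + ‖x‖ ^ 2))|
      ≤ 2 / n + ρ / n * √(4 * n + 8 * ‖x‖ ^ 2) := by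
  have h0 := natCast_pos_of_neZero n
  set δ := √(4 * n + 8 * ‖x‖ ^ 2) with hδ
  have hδ0 : 0 < δ := Real.sqrt_pos.2 (by positivity)
  have hδ2 : δ ^ 2 = 4 * n + 8 * ‖x‖ ^ 2 := Real.sq_sqrt (by positivity)
  obtain ⟨i1, h1⟩ := integrable_and_integral_sq_norm_add_sub_sq_le n x
  have i2 : Integrable (fun z => sphRatio n (√(n * ρ) * ‖x + z‖) ^ 2) (stdGaussian (Rn n)) := by
    refine (integrable_const 1).mono' (by fun_prop) (Filter.Eventually.of_forall fun z => ?_)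
    exact abs_sphRatio_sq_le_one n _
  have hpt : ∀ z, |sphRatio n (√(n * ρ) * ‖x + z‖) ^ 2 - limitRatioSq (ρ / n * (n + ‖x‖ ^ 2))|
      ≤ 2 / n + ρ / n * (((‖x + z‖ ^ 2 - (n + ‖x‖ ^ 2)) ^ 2 / δ + δ) / 2) := by
    intro z
    set S := √(ρ / n) * ‖x + z‖ with hS
    have hS0 : 0 ≤ S := by positivity
    have hS2 : S ^ 2 = ρ / n * ‖x + z‖ ^ 2 := by
      rw [hS, mul_pow, Real.sq_sqrt (by positivity)]
    have hnS : √(n * ρ) * ‖x + z‖ = n * S := by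
      rw [hS, ← mul_assoc]
      congr 1
      rw [show (n : ℝ) * ρ = n ^ 2 * (ρ / n) by field_simp, Real.sqrt_mul (by positivity),
        Real.sqrt_sq h0.le]
    rw [hnS]
    have a1 := abs_sphRatio_sq_sub_limitRatioSq_le n hS0
    have a2 := abs_limitRatioSq_sub_le (p := S ^ 2) (q := ρ / n * (n + ‖x‖ ^ 2)) (by positivity)
      (by positivity)
    rw [hS2, ← mul_sub, abs_mul, abs_of_nonneg (by positivity : 0 ≤ ρ / n)] at a2
    -- `2 t ≤ t² / δ + δ`, optimal for `δ` the bound on the standard deviation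
    have a3 : |‖x + z‖ ^ 2 - (n + ‖x‖ ^ 2)|
        ≤ ((‖x + z‖ ^ 2 - (n + ‖x‖ ^ 2)) ^ 2 / δ + δ) / 2 := by
      rw [← sq_abs (‖x + z‖ ^ 2 - (n + ‖x‖ ^ 2))]
      set t := |‖x + z‖ ^ 2 - (n + ‖x‖ ^ 2)|
      rw [le_div_iff₀ two_pos, div_add' _ _ _ hδ0.ne', le_div_iff₀ hδ0]
      nlinarith [sq_nonneg (t - δ)]
    have a4 := abs_sub_le (sphRatio n (n * S) ^ 2) (limitRatioSq (S ^ 2))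
      (limitRatioSq (ρ / n * (n + ‖x‖ ^ 2)))
    rw [← hS2] at a2
    have a5 := mul_le_mul_of_nonneg_left a3 (by positivity : 0 ≤ ρ / n)
    linarith
  have i3 : Integrable (fun z => (‖x + z‖ ^ 2 - (n + ‖x‖ ^ 2)) ^ 2 / δ + δ) (stdGaussian (Rn n)) :=
    (i1.div_const δ).add (integrable_const δ)
  have i4 : Integrable (fun z => ρ / n * (((‖x + z‖ ^ 2 - (n + ‖x‖ ^ 2)) ^ 2 / δ + δ) / 2))
      (stdGaussian (Rn n)) := (i3.div_const 2).const_mul _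
  have e : ∫ z, sphRatio n (√(n * ρ) * ‖x + z‖) ^ 2 ∂(stdGaussian (Rn n))
        - limitRatioSq (ρ / n * (n + ‖x‖ ^ 2))
      = ∫ z, (sphRatio n (√(n * ρ) * ‖x + z‖) ^ 2 - limitRatioSq (ρ / n * (n + ‖x‖ ^ 2)))
        ∂(stdGaussian (Rn n)) := by
    rw [integral_sub i2 (integrable_const _)]
    simp
  rw [e]
  refine (abs_integral_le_integral_abs).trans ((integral_mono (i2.sub (integrable_const _)).abs
    ((integrable_const (2 / (n : ℝ))).add i4) hpt).trans ?_)
  have e2 : ∫ z, (2 / (n : ℝ) + ρ / n * (((‖x + z‖ ^ 2 - (n + ‖x‖ ^ 2)) ^ 2 / δ + δ) / 2))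
      ∂(stdGaussian (Rn n)) = 2 / n + ρ / n * (((∫ z, (‖x + z‖ ^ 2 - (n + ‖x‖ ^ 2)) ^ 2
        ∂(stdGaussian (Rn n))) / δ + δ) / 2) := by
    rw [integral_add (integrable_const _) i4, integral_const_mul,
      integral_div 2 (fun z : Rn n => (‖x + z‖ ^ 2 - (n + ‖x‖ ^ 2)) ^ 2 / δ + δ),
      integral_add (i1.div_const δ) (integrable_const δ), integral_div δ]
    simp
  refine e2.le.trans ?_
  have h2 : (∫ z, (‖x + z‖ ^ 2 - (n + ‖x‖ ^ 2)) ^ 2 ∂(stdGaussian (Rn n))) / δ ≤ δ := by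
    rw [div_le_iff₀ hδ0, ← sq, hδ2]
    exact h1
  gcongr
  linarith

lemma limitIntegral_eq (c : ℝ) : limitIntegral c
    = ∫ γ in (0 : ℝ)..1, (limitRatioSq (γ * c ^ 2) + limitRatioSq (γ * c ^ 2 * (1 + γ * c ^ 2))) :=
  rfl

lemma intervalIntegrable_limitIntegral (c : ℝ) : IntervalIntegrable
    (fun γ => limitRatioSq (γ * c ^ 2) + limitRatioSq (γ * c ^ 2 * (1 + γ * c ^ 2)))
    volume 0 1 := by
  apply ContinuousOn.intervalIntegrable
  rw [Set.uIcc_of_le zero_le_one]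
  refine ContinuousOn.add (continuousOn_limitRatioSq.comp (by fun_prop) fun γ hγ => ?_)
    (continuousOn_limitRatioSq.comp (by fun_prop) fun γ hγ => ?_) <;>
  · have := hγ.1
    simp only [Set.mem_Ici]
    positivity

lemma exists_norm_eq_of_nonneg {r : ℝ} (hr : 0 ≤ r) : ∃ x : Rn n, ‖x‖ = r :=
  ⟨EuclideanSpace.single ⟨0, Nat.pos_of_ne_zero (NeZero.ne n)⟩ r, by simp [abs_of_nonneg hr]⟩

lemma abs_radiusMean_sub_limitIntegral_le {c : ℝ} (hc : 0 ≤ c) :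
    |radiusMean n (c * √n) - limitIntegral c|
      ≤ 4 / n + 2 * c ^ 2 * √(4 + 8 * c ^ 2) / √n := by
  have h0 := natCast_pos_of_neZero n
  have hn : 0 < √(n : ℝ) := Real.sqrt_pos.2 h0
  have hn2 : √(n : ℝ) ^ 2 = n := Real.sq_sqrt h0.le
  have hi1 := intervalIntegrable_radiusMean n (R := c * √n) (by positivity)
  have hi2 := intervalIntegrable_limitIntegral c
  rw [limitIntegral_eq, radiusMean, ← intervalIntegral.integral_sub hi1 hi2]
  have key := intervalIntegral.norm_integral_le_of_norm_le_const (a := (0 : ℝ)) (b := 1)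
    (C := 4 / n + 2 * c ^ 2 * √(4 + 8 * c ^ 2) / √n)
    (f := fun γ => (centralMean n (√γ * (c * √n)) + noncentralMean n (√γ * (c * √n)))
      - (limitRatioSq (γ * c ^ 2) + limitRatioSq (γ * c ^ 2 * (1 + γ * c ^ 2)))) ?_
  · simpa using key
  intro γ hγ
  rw [Set.uIoc_of_le zero_le_one] at hγ
  have hγ0 : 0 ≤ γ := hγ.1.le
  have hr : √γ * (c * √n) = √(n * (γ * c ^ 2)) := by
    rw [Real.sqrt_mul h0.le, Real.sqrt_mul hγ0, Real.sqrt_sq hc]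
    ring
  have hr0 : 0 ≤ √γ * (c * √n) := by positivity
  obtain ⟨x, hx⟩ := exists_norm_eq_of_nonneg n hr0
  have hx2 : ‖x‖ ^ 2 = n * (γ * c ^ 2) := by rw [hx, hr, Real.sq_sqrt (by positivity)]
  have e1 : centralMean n (√γ * (c * √n))
      = ∫ z, sphRatio n (√(n * (γ * c ^ 2)) * ‖(0 : Rn n) + z‖) ^ 2 ∂(stdGaussian (Rn n)) := by
    rw [← hr, centralMean, ← integral_stdGaussian_norm n _ (by fun_prop)]
    simp
  have e2 : noncentralMean n (√γ * (c * √n))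
      = ∫ z, sphRatio n (√(n * (γ * c ^ 2)) * ‖x + z‖) ^ 2 ∂(stdGaussian (Rn n)) := by
    have h := integral_stdGaussian_norm_add n x (fun s => sphRatio n (√γ * (c * √n) * s) ^ 2)
      (by fun_prop) (expGrowth_sphRatio_sq n _)
    rw [hx] at h
    rw [← hr, noncentralMean, ← h]
  have b1 := abs_integral_sphRatio_sq_sub_le n (ρ := γ * c ^ 2) (by positivity) (0 : Rn n)
  have b2 := abs_integral_sphRatio_sq_sub_le n (ρ := γ * c ^ 2) (by positivity) x
  rw [← e1] at b1
  rw [← e2, hx2] at b2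
  have f1 : γ * c ^ 2 / n * (n + ‖(0 : Rn n)‖ ^ 2) = γ * c ^ 2 := by
    rw [norm_zero]; field_simp; ring
  have f2 : γ * c ^ 2 / n * (n + n * (γ * c ^ 2)) = γ * c ^ 2 * (1 + γ * c ^ 2) := by
    field_simp
  rw [f1] at b1
  rw [f2] at b2
  have hρ : γ * c ^ 2 ≤ c ^ 2 := mul_le_of_le_one_left (sq_nonneg c) hγ.2
  have g : ∀ y, 0 ≤ y → y ≤ n * c ^ 2 →
      γ * c ^ 2 / n * √(4 * n + 8 * y) ≤ c ^ 2 * √(4 + 8 * c ^ 2) / √n := by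
    intro y hy0 hy
    have s1 : √(4 * n + 8 * y) ≤ √n * √(4 + 8 * c ^ 2) := by
      rw [← Real.sqrt_mul h0.le]
      apply Real.sqrt_le_sqrt
      linarith
    calc γ * c ^ 2 / n * √(4 * n + 8 * y) ≤ c ^ 2 / n * (√n * √(4 + 8 * c ^ 2)) := by gcongr
      _ = c ^ 2 * √(4 + 8 * c ^ 2) / √n := by
          nth_rw 1 [← hn2]
          field_simp
  have g1 := g (‖(0 : Rn n)‖ ^ 2) (by positivity) (by rw [norm_zero, zero_pow two_ne_zero]; positivity)
  have g2 := g (n * (γ * c ^ 2)) (by positivity) (by gcongr)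
  have tri := abs_add_le (centralMean n (√γ * (c * √n)) - limitRatioSq (γ * c ^ 2))
    (noncentralMean n (√γ * (c * √n)) - limitRatioSq (γ * c ^ 2 * (1 + γ * c ^ 2)))
  rw [Real.norm_eq_abs, add_sub_add_comm]
  have e3 : 4 / (n : ℝ) + 2 * c ^ 2 * √(4 + 8 * c ^ 2) / √n
      = 2 / n + 2 / n + (c ^ 2 * √(4 + 8 * c ^ 2) / √n + c ^ 2 * √(4 + 8 * c ^ 2) / √n) := by ring
  rw [e3]
  linarith

end Limit

lemma tendsto_radiusMean {c : ℝ} (hc : 0 ≤ c) :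
    Filter.Tendsto (fun n : ℕ => radiusMean n (c * √n)) Filter.atTop (nhds (limitIntegral c)) := by
  rw [tendsto_iff_norm_sub_tendsto_zero]
  have h1 : Filter.Tendsto (fun n : ℕ => 4 / (n : ℝ) + 2 * c ^ 2 * √(4 + 8 * c ^ 2) / √n)
      Filter.atTop (nhds 0) := by
    have a := Filter.Tendsto.const_div_atTop tendsto_natCast_atTop_atTop (4 : ℝ)
    have b := Filter.Tendsto.const_div_atTop
      (Real.tendsto_sqrt_atTop.comp tendsto_natCast_atTop_atTop) (2 * c ^ 2 * √(4 + 8 * c ^ 2))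
    simpa using a.add b
  refine squeeze_zero' (Filter.Eventually.of_forall fun _ => norm_nonneg _) ?_ h1
  filter_upwards [Filter.eventually_ge_atTop 1] with n hn
  have : NeZero n := ⟨by omega⟩
  exact abs_radiusMean_sub_limitIntegral_le n hc

lemma limitIntegral_strictMonoOn : StrictMonoOn limitIntegral (Set.Ici 0) := by
  intro c₁ hc₁ c₂ hc₂ h
  have hc₁ : 0 ≤ c₁ := hc₁
  rw [← sub_pos, limitIntegral_eq, limitIntegral_eq, ← intervalIntegral.integral_sub
    (intervalIntegrable_limitIntegral c₂) (intervalIntegrable_limitIntegral c₁)]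
  refine intervalIntegral.intervalIntegral_pos_of_pos_on
    ((intervalIntegrable_limitIntegral c₂).sub (intervalIntegrable_limitIntegral c₁))
    (fun γ hγ => ?_) one_pos
  have hγ := hγ.1
  have h1 : γ * c₁ ^ 2 < γ * c₂ ^ 2 := by gcongr
  have h2 : 0 ≤ γ * c₁ ^ 2 := by positivity
  have h3 := limitRatioSq_strictMono h2 h1
  have h4 := limitRatioSq_strictMono (p := γ * c₁ ^ 2 * (1 + γ * c₁ ^ 2))
    (q := γ * c₂ ^ 2 * (1 + γ * c₂ ^ 2)) (by positivity) (by nlinarith)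
  linarith

/-! ### The numerical value of the limit -/

/-- The integral of the limiting equation in closed form. The second summand is elementary since
`1/4 + t (1 + t) = (t + 1/2)²`. -/
lemma sq_mul_limitIntegral (c : ℝ) : c ^ 2 * limitIntegral c
    = 2 * c ^ 2 + 1 - 2 * √(1 / 4 + c ^ 2) + Real.log (√(1 / 4 + c ^ 2) + 1 / 2)
      - Real.log (1 + c ^ 2) := by
  -- a primitive of `c²` times the integrand
  set A : ℝ → ℝ := fun γ => (γ * c ^ 2 - Real.log (1 + γ * c ^ 2))
    + (γ * c ^ 2 + 1 - 2 * √(1 / 4 + γ * c ^ 2) + Real.log (√(1 / 4 + γ * c ^ 2) + 1 / 2)) with hA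
  have hderiv : ∀ γ ∈ Set.uIcc (0 : ℝ) 1, HasDerivAt A
      (c ^ 2 * (limitRatioSq (γ * c ^ 2) + limitRatioSq (γ * c ^ 2 * (1 + γ * c ^ 2)))) γ := by
    intro γ hγ
    rw [Set.uIcc_of_le zero_le_one] at hγ
    have hγ0 := hγ.1
    have ht : 0 ≤ γ * c ^ 2 := by positivity
    have d0 : HasDerivAt (fun γ : ℝ => γ * c ^ 2) (c ^ 2) γ := by
      simpa using (hasDerivAt_id γ).mul_const (c ^ 2)
    have d1 := (d0.const_add 1).log (by positivity)
    have d2 := (d0.const_add (1 / 4)).sqrt (by positivity)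
    have hq := half_le_sqrt ht
    have d3 := (d2.add_const (1 / 2)).log (by positivity)
    have hd := (d0.sub d1).add (((d0.add_const 1).sub (d2.const_mul 2)).add d3)
    have e : √(1 / 4 + γ * c ^ 2 * (1 + γ * c ^ 2)) = γ * c ^ 2 + 1 / 2 := by
      rw [show 1 / 4 + γ * c ^ 2 * (1 + γ * c ^ 2) = (γ * c ^ 2 + 1 / 2) ^ 2 by ring,
        Real.sqrt_sq (by positivity)]
    convert! hd using 1
    rw [limitRatioSq_eq ht, limitRatioSq_eq (by positivity), e]
    field_simp
    ring
  have h := intervalIntegral.integral_eq_sub_of_hasDerivAt hderiv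
    ((intervalIntegrable_limitIntegral c).const_mul _)
  rw [intervalIntegral.integral_const_mul, ← limitIntegral_eq] at h
  rw [h, hA]
  have e4 : √(1 / 4 : ℝ) = 1 / 2 := by
    rw [show (1 / 4 : ℝ) = (1 / 2) ^ 2 by norm_num, Real.sqrt_sq (by norm_num)]
  simp only [one_mul, zero_mul, add_zero, e4]
  norm_num
  ring

lemma limitIntegral_lt_one_iff {c : ℝ} (hc : 0 < c) : limitIntegral c < 1 ↔
    c ^ 2 + 1 - 2 * √(1 / 4 + c ^ 2)
      < Real.log ((1 + c ^ 2) / (√(1 / 4 + c ^ 2) + 1 / 2)) := by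
  have h := sq_mul_limitIntegral c
  have hq := half_le_sqrt (sq_nonneg c)
  rw [Real.log_div (by positivity) (by positivity), ← mul_lt_mul_iff_right₀ (sq_pos_of_pos hc), h]
  constructor <;> intro h <;> linarith

lemma one_lt_limitIntegral_iff {c : ℝ} (hc : 0 < c) : 1 < limitIntegral c ↔
    Real.log ((1 + c ^ 2) / (√(1 / 4 + c ^ 2) + 1 / 2))
      < c ^ 2 + 1 - 2 * √(1 / 4 + c ^ 2) := by
  have h := sq_mul_limitIntegral c
  have hq := half_le_sqrt (sq_nonneg c)
  rw [Real.log_div (by positivity) (by positivity), ← mul_lt_mul_iff_right₀ (sq_pos_of_pos hc), h]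
  constructor <;> intro h <;> linarith

lemma limitIntegral_lt_one : limitIntegral (1.860935682 - 5 * 10 ^ (-10 : ℤ)) < 1 := by
  have hc : (1.860935682 - 5 * 10 ^ (-10 : ℤ) : ℝ) = 1.8609356815 := by norm_num
  rw [hc, limitIntegral_lt_one_iff (by norm_num)]
  have h1 : (1.926935808655 : ℝ) ≤ √(1 / 4 + 1.8609356815 ^ 2) :=
    Real.le_sqrt_of_sq_le (by norm_num)
  have h2 : √(1 / 4 + 1.8609356815 ^ 2) ≤ (1.926935808656 : ℝ) := Real.sqrt_le_iff.2 (by norm_num)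
  -- `(1 + x) / (1 - x)` for this `x` is a lower bound for the argument of the logarithm
  have h3 := Real.sum_range_le_log_div (x := 0.29552113994786) (by norm_num) (by norm_num) 11
  have h4 : Real.log ((1 + 0.29552113994786) / (1 - 0.29552113994786))
      ≤ Real.log ((1 + 1.8609356815 ^ 2) / (√(1 / 4 + 1.8609356815 ^ 2) + 1 / 2)) := by
    apply Real.log_le_log (by norm_num)
    rw [le_div_iff₀ (by linarith)]
    nlinarith
  norm_num [Finset.sum_range_succ] at h3
  norm_num at h1 h2 h4 ⊢
  linarith

lemma one_lt_limitIntegral : 1 < limitIntegral (1.860935682 + 5 * 10 ^ (-10 : ℤ)) := by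
  have hc : (1.860935682 + 5 * 10 ^ (-10 : ℤ) : ℝ) = 1.8609356825 := by norm_num
  rw [hc, one_lt_limitIntegral_iff (by norm_num)]
  have h1 : (1.926935809621 : ℝ) ≤ √(1 / 4 + 1.8609356825 ^ 2) :=
    Real.le_sqrt_of_sq_le (by norm_num)
  have h2 : √(1 / 4 + 1.8609356825 ^ 2) ≤ (1.926935809622 : ℝ) := Real.sqrt_le_iff.2 (by norm_num)
  -- `(1 + x) / (1 - x)` for this `x` is an upper bound for the argument of the logarithm
  have h3 := Real.log_div_le_sum_range_add (x := 0.29552114014715) (by norm_num) (by norm_num) 11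
  have h4 : Real.log ((1 + 1.8609356825 ^ 2) / (√(1 / 4 + 1.8609356825 ^ 2) + 1 / 2))
      ≤ Real.log ((1 + 0.29552114014715) / (1 - 0.29552114014715)) := by
    apply Real.log_le_log (div_pos (by norm_num) (by linarith))
    rw [div_le_iff₀ (by linarith)]
    nlinarith
  norm_num [Finset.sum_range_succ] at h3
  norm_num at h1 h2 h4 ⊢
  linarith

lemma exists_limitIntegral_eq_one : ∃ c : ℝ, 0 < c ∧ limitIntegral c = 1 ∧
    |c - 1.860935682| ≤ 5 * 10 ^ (-10 : ℤ) := by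
  have hcont : ContinuousOn limitIntegral (Set.Icc (1.860935682 - 5 * 10 ^ (-10 : ℤ))
      (1.860935682 + 5 * 10 ^ (-10 : ℤ))) := by
    have hpos : ∀ c ∈ Set.Icc (1.860935682 - 5 * 10 ^ (-10 : ℤ) : ℝ)
        (1.860935682 + 5 * 10 ^ (-10 : ℤ)), 0 < c := fun c hc =>
      lt_of_lt_of_le (by norm_num) hc.1
    have h : ContinuousOn (fun c : ℝ => (2 * c ^ 2 + 1 - 2 * √(1 / 4 + c ^ 2)
        + Real.log (√(1 / 4 + c ^ 2) + 1 / 2) - Real.log (1 + c ^ 2)) / c ^ 2)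
        (Set.Icc (1.860935682 - 5 * 10 ^ (-10 : ℤ)) (1.860935682 + 5 * 10 ^ (-10 : ℤ))) := by
      refine ContinuousOn.div ?_ (by fun_prop) fun c hc => by have := hpos c hc; positivity
      refine ContinuousOn.sub (ContinuousOn.add (by fun_prop) (ContinuousOn.log (by fun_prop)
        fun c _ => ?_)) (ContinuousOn.log (by fun_prop) fun c _ => by positivity)
      have := Real.sqrt_nonneg (1 / 4 + c ^ 2)
      positivity
    refine h.congr fun c hc => ?_
    have hc0 := hpos c hc
    simp only
    rw [← sq_mul_limitIntegral _]
    field_simp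
  obtain ⟨c, hc, hc1⟩ := intermediate_value_Icc (by norm_num) hcont
    ⟨limitIntegral_lt_one.le, one_lt_limitIntegral.le⟩
  refine ⟨c, lt_of_lt_of_le (by norm_num) hc.1, hc1, ?_⟩
  rw [abs_le]
  constructor <;> linarith [hc.1, hc.2]

/-! ### The critical radius -/

/-- The critical radius is the unique root of `radiusMean n R = 1`, and it is positive. -/
lemma Rbar_spec (n : ℕ) [NeZero n] :
    IsGreatest (smallAmplitudeRadii n) (Rbar n) ∧
      (∀ R : ℝ, 0 ≤ R → (IsCapacityAchieving n R (uniformSphere n R) ↔ R ≤ Rbar n)) ∧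
      √(n : ℝ) ≤ Rbar n ∧ radiusMean n (Rbar n) = 1 := by
  obtain ⟨ρ, h1, h2, h3⟩ := exists_radiusMean_eq_one n
  have hρ : 0 ≤ ρ := (Real.sqrt_nonneg _).trans h1
  have hg : IsGreatest (smallAmplitudeRadii n) ρ :=
    ⟨⟨hρ, (h3 ρ hρ).2 le_rfl⟩, fun R hR => (h3 R hR.1).1 hR.2⟩
  have hR : Rbar n = ρ := hg.csSup_eq
  rw [hR]
  exact ⟨hg, h3, h1, h2⟩

lemma Rbar_pos (n : ℕ) [NeZero n] : 0 < Rbar n :=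
  (Real.sqrt_pos.2 (natCast_pos_of_neZero n)).trans_le (Rbar_spec n).2.2.1

/-- The normalized critical radii converge to any root of the limiting equation: a radius
`c' √n` with `c'` on one side of the root has `radiusMean n (c' √n)` on the same side of `1` for
large `n`, by the pointwise limit and strict monotonicity of the two integrals. -/
lemma tendsto_Rbar_div_sqrt {c : ℝ} (hc : 0 < c) (h : limitIntegral c = 1) :
    Filter.Tendsto (fun n : ℕ => Rbar n / √(n : ℝ)) Filter.atTop (nhds c) := by
  refine tendsto_order.2 ⟨fun a ha => ?_, fun a ha => ?_⟩
  · rcases lt_or_ge a 0 with h0 | h0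
    · filter_upwards [Filter.eventually_gt_atTop 0] with n hn
      have : NeZero n := ⟨hn.ne'⟩
      exact h0.trans_le (div_nonneg (Rbar_pos n).le (Real.sqrt_nonneg _))
    · have hlt : limitIntegral a < 1 := h ▸ limitIntegral_strictMonoOn h0 hc.le ha
      filter_upwards [(tendsto_radiusMean h0).eventually_lt_const hlt,
        Filter.eventually_gt_atTop 0] with n hn hn0
      have : NeZero n := ⟨hn0.ne'⟩
      rw [lt_div_iff₀ (Real.sqrt_pos.2 (natCast_pos_of_neZero n))]
      refine (radiusMean_strictMonoOn n).lt_iff_lt (Set.mem_Ici.2 (by positivity))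
        (Rbar_pos n).le |>.1 ?_
      rwa [(Rbar_spec n).2.2.2]
  · have h0 : 0 ≤ a := (hc.trans ha).le
    have hlt : 1 < limitIntegral a := h ▸ limitIntegral_strictMonoOn hc.le h0 ha
    filter_upwards [(tendsto_radiusMean h0).eventually_const_lt hlt,
      Filter.eventually_gt_atTop 0] with n hn hn0
    have : NeZero n := ⟨hn0.ne'⟩
    rw [div_lt_iff₀ (Real.sqrt_pos.2 (natCast_pos_of_neZero n))]
    refine (radiusMean_strictMonoOn n).lt_iff_lt (Rbar_pos n).le
      (Set.mem_Ici.2 (by positivity)) |>.1 ?_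
    rwa [(Rbar_spec n).2.2.2]

theorem mainTheorem1 :
    (∀ n : ℕ, 1 ≤ n →
      -- the maximum that defines `R̄ₙ` exists
      IsGreatest (smallAmplitudeRadii n) (Rbar n) ∧
      -- the uniform input on the sphere of radius `R` is optimal if and only if `R ≤ R̄ₙ`
      (∀ R : ℝ, 0 ≤ R → (IsCapacityAchieving n R (uniformSphere n R) ↔ R ≤ Rbar n)) ∧
      -- `R̄ₙ` is the unique positive solution of the integral equation
      0 < Rbar n ∧
      (∀ x : Rn n, ‖x‖ = Rbar n → radiusIntegral n (Rbar n) x = 1) ∧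
      (∀ R : ℝ, 0 < R → ∀ x : Rn n, ‖x‖ = R → radiusIntegral n R x = 1 → R = Rbar n) ∧
      -- `R ≤ √n` is sufficient
      √(n : ℝ) ≤ Rbar n) ∧
    -- the limit of `R̄ₙ / √n` is the unique positive solution of the limiting equation
    ∃ c : ℝ, 0 < c ∧ limitIntegral c = 1 ∧
      (∀ c' : ℝ, 0 < c' → limitIntegral c' = 1 → c' = c) ∧
      |c - 1.860935682| ≤ 5 * 10 ^ (-10 : ℤ) ∧
      Filter.Tendsto (fun n : ℕ => Rbar n / √(n : ℝ)) Filter.atTop (nhds c) := by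
  refine ⟨fun n hn => ?_, ?_⟩
  · have : NeZero n := ⟨by omega⟩
    obtain ⟨hg, hiff, hsqrt, hone⟩ := Rbar_spec n
    refine ⟨hg, hiff, Rbar_pos n, fun x hx => ?_, fun R hR x hx h => ?_, hsqrt⟩
    · rw [radiusIntegral_eq n hx, hone]
    · rw [radiusIntegral_eq n hx, ← hone] at h
      exact (radiusMean_strictMonoOn n).injOn hR.le (Rbar_pos n).le h
  · obtain ⟨c, hc, h1, habs⟩ := exists_limitIntegral_eq_one
    exact ⟨c, hc, h1, fun c' hc' h' =>
      limitIntegral_strictMonoOn.injOn hc'.le hc.le (h'.trans h1.symm), habs,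
      tendsto_Rbar_div_sqrt hc h1⟩
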